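/- Let $M$ be a closed oriented three-dimensional Riemannian manifold with Riemannian volume form $d\mu$. All fields and forms are smooth. The curl of a vector field $v$ is the field $\operatorname{curl} v$ with $i_{\operatorname{curl} v}\,d\mu = d(v^\flat)$. Let $\mathfrak X(M)$ be the space of exact divergence-free vector fields $w$ on $M$ (those for which the two-form $i_w\,d\mu$ is exact), let $\operatorname{curl}^{-1}:\mathfrak X(M)\to\mathfrak X(M)$ be the inverse of the curl on this space, and for $\omega,B\in\mathfrak X(M)$ put $$H(\omega,B)=\int_M B\cdot\operatorname{curl}^{-1}\omega\,d\mu .$$ (i) Let $(v,B,p)$ be a solution, on a time interval $J$, of the ideal MHD equations $$\partial_t v=-(v,\nabla)v+(\operatorname{curl}B)\times B-\nabla p,\qquad \partial_t B=-[v,B],\qquad \operatorname{div}B=\operatorname{div}v=0,$$ with $B(t)\in\mathfrak X(M)$ for all $t\in J$, where $\nabla$ in $(v,\nabla)v=\nabla_v v$ is the Levi-Civita connection, and let $\omega=\operatorname{curl}v$ be the vorticity. Then the magnetic helicity $H(B,B)$ and the cross-helicity $H(\omega,B)$ do not depend on $t\in J$. (ii) Let $\mathfrak X^*(M)=\Omega^1(M)/\ker(d:\Omega^1(M)\to\Omega^2(M))$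 be the (regular) dual of $\mathfrak X(M)$, and let $\mathrm{SDiff}(M)$ be the group of diffeomorphisms $\varphi$ of $M$ with $\varphi^*d\mu=d\mu$, acting on $\mathfrak X^*(M)$ by $\varphi\cdot[\alpha]=[(\varphi^{-1})^*\alpha]$. Let $G=\mathrm{SDiff}(M)\ltimes\mathfrak X^*(M)$, with product $(\varphi,a)(\psi,b)=(\varphi\psi,\,a+\varphi\cdot b)$; it acts on its Lie algebra $\mathfrak g=\mathfrak X(M)\ltimes\mathfrak X^*(M)$ by $\mathrm{Ad}_{(\varphi,a)}(w,c)=(\varphi_*w,\ \varphi\cdot c+L_{\varphi_*w}a)$. Identify the dual space $\mathfrak g^*=\mathfrak X^*(M)\oplus\mathfrak X(M)$ with the space of pairs $(\omega,B)\in\mathfrak X(M)\times\mathfrak X(M)$ by means of the pairing $$\langle(\omega,B),(w,[\gamma])\rangle=\int_M\operatorname{curl}^{-1}\omega\cdot w\,d\mu+\int_M\gamma(B)\,d\mu .$$ Then for every $\Phi\in G$ and every $(\omega,B)\in\mathfrak g^*$ there is exactly one $(\omega',B')=\mathrm{Ad}^*_\Phi(\omega,B)\in\mathfrak g^*$ with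 $\langle(\omega',B'),\xi\rangle=\langle(\omega,B),\mathrm{Ad}_{\Phi^{-1}}\xi\rangle$ for all $\xi\in\mathfrak g$, and $$H(B',B')=H(B,B),\qquad H(\omega',B')=H(\omega,B);$$ that is, the magnetic helicity and the cross-helicity are Casimirs. -/

import Mathlib

open scoped Manifold ContDiff Bundle

namespace MHD

noncomputable section

/-! ### Vector fields and differential forms on a three-manifold -/

/-- The model space `ℝ³`. -/
abbrev E3 : Type := EuclideanSpace ℝ (Fin 3)

section Forms

variable {M : Type*} [TopologicalSpace M] [ChartedSpace E3 M]

variable (M) in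
/-- (Not necessarily smooth) vector fields on `M`. -/
abbrev VField : Type _ := (x : M) → TangentSpace (𝓡 3) x

variable (M) in
/-- (Not necessarily smooth) differential one-forms on `M`. -/
abbrev CovField : Type _ := (x : M) → (TangentSpace (𝓡 3) x →L[ℝ] ℝ)

variable (M) in
/-- (Not necessarily smooth) differential three-forms on `M`. -/
abbrev TopForm : Type _ := (x : M) → AlternatingMap ℝ (TangentSpace (𝓡 3) x) ℝ (Fin 3)

/-- Smooth functions. -/
def SmoothFun (f : M → ℝ) : Prop := ContMDiff (𝓡 3) 𝓘(ℝ, ℝ) ∞ f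

/-- The derivative `X f` of a function along a vector field. -/
def dirDeriv (X : VField M) (f : M → ℝ) (x : M) : ℝ := mvfderiv (𝓡 3) f x (X x)

/-- The Lie bracket of vector fields, `[X, Y] f = X (Y f) - Y (X f)`. -/
def bracket (X Y : VField M) : VField M := VectorField.mlieBracket (𝓡 3) X Y

/-- The contraction of a one-form with a vector field. -/
def contract (α : CovField M) (X : VField M) (x : M) : ℝ := α x (X x)

/-- The value of the exterior derivative of a one-form on two vector fields,
`dα(X, Y) = X (α Y) - Y (α X) - α [X, Y]`. -/
def dForm (α : CovField M) (X Y : VField M) (x : M) : ℝ :=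
  dirDeriv X (contract α Y) x - dirDeriv Y (contract α X) x - contract α (bracket X Y) x

lemma SmoothFun.mdiff {f : M → ℝ} (hf : SmoothFun f) (x : M) :
    MDifferentiableAt (𝓡 3) 𝓘(ℝ, ℝ) f x := (ContMDiff.mdifferentiable hf (by simp)) x

lemma dForm_zero (X Y : VField M) (x : M) : dForm (0 : CovField M) X Y x = 0 := by
  have h : ∀ Z : VField M, contract (0 : CovField M) Z = fun _ => (0 : ℝ) := fun Z => rfl
  simp [dForm, dirDeriv, h, mvfderiv_const]

variable [IsManifold (𝓡 3) ∞ M]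

/-- Smooth vector fields. -/
def SmoothField (X : VField M) : Prop :=
  ContMDiff (𝓡 3) (𝓡 3).tangent ∞ (fun x => (⟨x, X x⟩ : TangentBundle (𝓡 3) M))

variable (M) in
/-- The smooth one-forms: those whose contraction with every smooth vector field is a smooth
function. -/
def SmoothForms : Submodule ℝ (CovField M) where
  carrier := {α | ∀ X : VField M, SmoothField X → SmoothFun (contract α X)}
  add_mem' := fun ha hb X hX => (ha X hX).add (hb X hX)
  zero_mem' := fun _ _ => contMDiff_const
  smul_mem' := fun _ _ ha X hX => contMDiff_const.mul (ha X hX)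

variable (M) in
/-- The real vector space `Ω¹(M)` of smooth one-forms. -/
def OneForm : Type _ := SmoothForms M

instance : AddCommGroup (OneForm M) := inferInstanceAs (AddCommGroup (SmoothForms M))

instance : Module ℝ (OneForm M) := inferInstanceAs (Module ℝ (SmoothForms M))

/-- The field of covectors underlying a smooth one-form. -/
def OneForm.val (α : OneForm M) : CovField M := Subtype.val (p := fun a => a ∈ SmoothForms M) α

lemma OneForm.val_mem (α : OneForm M) : α.val ∈ SmoothForms M :=
  Subtype.prop (p := fun a => a ∈ SmoothForms M) α

lemma OneForm.val_add (α β : OneForm M) : (α + β).val = α.val + β.val := rfl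

lemma OneForm.val_smul (c : ℝ) (α : OneForm M) : (c • α).val = c • α.val := rfl

lemma OneForm.ext {α β : OneForm M} (h : α.val = β.val) : α = β :=
  Subtype.ext (p := fun a => a ∈ SmoothForms M) h

lemma dForm_add {α β : CovField M} (hα : α ∈ SmoothForms M) (hβ : β ∈ SmoothForms M) {X Y : VField M}
    (hX : SmoothField X) (hY : SmoothField Y) (x : M) :
    dForm (α + β) X Y x = dForm α X Y x + dForm β X Y x := by
  have h : ∀ Z : VField M, SmoothField Z → ∀ v, mvfderiv (𝓡 3) (contract (α + β) Z) x v =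
      mvfderiv (𝓡 3) (contract α Z) x v + mvfderiv (𝓡 3) (contract β Z) x v := by
    intro Z hZ v
    have := mvfderiv_add ((hα Z hZ).mdiff x) ((hβ Z hZ).mdiff x)
    exact congrArg (fun L => L v) this
  simp only [dForm, dirDeriv, h X hX, h Y hY, contract, Pi.add_apply, add_apply]
  ring

lemma dForm_smul (c : ℝ) {α : CovField M} (hα : α ∈ SmoothForms M) {X Y : VField M}
    (hX : SmoothField X) (hY : SmoothField Y) (x : M) :
    dForm (c • α) X Y x = c * dForm α X Y x := by
  have h : ∀ Z : VField M, SmoothField Z → ∀ v, mvfderiv (𝓡 3) (contract (c • α) Z) x v =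
      c * mvfderiv (𝓡 3) (contract α Z) x v := by
    intro Z hZ v
    have := mvfderiv_mul (mdifferentiableAt_const (c := c)) ((hα Z hZ).mdiff x)
    have h2 := congrArg (fun L => L v) this
    have h3 : contract (c • α) Z = (fun _ => c) * contract α Z := rfl
    rw [h3, h2, mvfderiv_const]
    simp
  simp only [dForm, dirDeriv, h X hX, h Y hY, contract, Pi.smul_apply,
    smul_apply, smul_eq_mul]
  ring

variable (M) in
/-- The closed smooth one-forms, i.e. the kernel of `d : Ω¹(M) → Ω²(M)`. -/
def ClosedForm : Submodule ℝ (OneForm M) where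
  carrier := {α | ∀ X Y : VField M, SmoothField X → SmoothField Y → ∀ x, dForm α.val X Y x = 0}
  add_mem' := by
    intro a b ha hb X Y hX hY x
    rw [OneForm.val_add, dForm_add a.val_mem b.val_mem hX hY, ha X Y hX hY, hb X Y hX hY, add_zero]
  zero_mem' := fun X Y _ _ x => dForm_zero X Y x
  smul_mem' := by
    intro c a ha X Y hX hY x
    rw [OneForm.val_smul, dForm_smul c a.val_mem hX hY, ha X Y hX hY, mul_zero]

variable (M) in
/-- The regular dual `𝔛*(M) = Ω¹(M) / ker (d : Ω¹(M) → Ω²(M))` of the space of exact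
divergence-free vector fields. -/
abbrev DualX : Type _ := OneForm M ⧸ ClosedForm M

/-- A smooth one-form representing a coset. -/
def rep (a : DualX M) : OneForm M := Quotient.out a

lemma mk_rep (a : DualX M) : Submodule.Quotient.mk (rep a) = a := Quotient.out_eq a

/-! ### Volume forms, exact fields, divergence -/

/-- `i_w μ = dα`, as an identity between two-forms. -/
def ContractsTo (μ : TopForm M) (w : VField M) (α : CovField M) : Prop :=
  ∀ X Y : VField M, SmoothField X → SmoothField Y →
    ∀ x, μ x ![w x, X x, Y x] = dForm α X Y x

/-- The space `𝔛(M)` of exact divergence-free fields: the smooth fields `w` such that the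
two-form `i_w μ` is exact. (As `d (i_w μ) = L_w μ`, such a field is divergence free.) -/
def ExactField (μ : TopForm M) : Submodule ℝ (VField M) where
  carrier := {w | SmoothField w ∧ ∃ α ∈ SmoothForms M, ContractsTo μ w α}
  add_mem' := by
    rintro a b ⟨ha, α, hα, haα⟩ ⟨hb, β, hβ, hbβ⟩
    refine ⟨ContMDiff.add_section ha hb, α + β, add_mem hα hβ, fun X Y hX hY x => ?_⟩
    rw [dForm_add hα hβ hX hY, ← haα X Y hX hY, ← hbβ X Y hX hY]
    exact (μ x).map_vecCons_add ![X x, Y x] (a x) (b x)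
  zero_mem' := by
    refine ⟨Bundle.contMDiff_zeroSection ℝ _, 0, zero_mem _, fun X Y hX hY x => ?_⟩
    rw [dForm_zero]
    exact (μ x).map_coord_zero 0 rfl
  smul_mem' := by
    rintro c a ⟨ha, α, hα, haα⟩
    refine ⟨ContMDiff.const_smul_section ha, c • α, Submodule.smul_mem _ c hα,
      fun X Y hX hY x => ?_⟩
    rw [dForm_smul c hα hX hY, ← haα X Y hX hY]
    exact (μ x).map_vecCons_smul ![X x, Y x] c (a x)

/-- `X` is divergence free with respect to `μ`: the Lie derivative `L_X μ` vanishes. -/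
def DivFree (μ : TopForm M) (X : VField M) : Prop :=
  ∀ Y : Fin 3 → VField M, (∀ i, SmoothField (Y i)) → ∀ x,
    dirDeriv X (fun y => μ y (fun i => Y i y)) x -
      ∑ i, μ x (Function.update (fun j => Y j x) i (bracket X (Y i) x)) = 0

/-! ### Volume-preserving diffeomorphisms and their action -/

/-- The push-forward `φ_* X` of a vector field. -/
def pushField (φ : Equiv.Perm M) (X : VField M) : VField M :=
  VectorField.mpullback (𝓡 3) (𝓡 3) φ.symm X

/-- The pull-back `f^* α` of a one-form. -/
def pullForm (f : M → M) (α : CovField M) : CovField M :=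
  fun x => (α (f x)).comp (mfderiv (𝓡 3) (𝓡 3) f x)

/-- The push-forward `(φ⁻¹)^* α` of a one-form. -/
def pushForm (φ : Equiv.Perm M) (α : CovField M) : CovField M := pullForm φ.symm α

/-- `φ` is a diffeomorphism of `M`. -/
def IsDiffeo (φ : Equiv.Perm M) : Prop :=
  ContMDiff (𝓡 3) (𝓡 3) ∞ φ ∧ ContMDiff (𝓡 3) (𝓡 3) ∞ φ.symm

lemma IsDiffeo.symm {φ : Equiv.Perm M} (h : IsDiffeo φ) : IsDiffeo φ.symm := ⟨h.2, h.1⟩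

lemma IsDiffeo.mdiff {φ : Equiv.Perm M} (h : IsDiffeo φ) (x : M) :
    MDifferentiableAt (𝓡 3) (𝓡 3) φ x := h.1.mdifferentiable (by simp) x

lemma IsDiffeo.mul {φ ψ : Equiv.Perm M} (hφ : IsDiffeo φ) (hψ : IsDiffeo ψ) :
    IsDiffeo (φ * ψ) := ⟨hφ.1.comp hψ.1, hψ.2.comp hφ.2⟩

lemma IsDiffeo.mfderiv_symm_comp {φ : Equiv.Perm M} (h : IsDiffeo φ) (x : M) :
    (mfderiv (𝓡 3) (𝓡 3) φ.symm (φ x)).comp (mfderiv (𝓡 3) (𝓡 3) φ x) =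
      ContinuousLinearMap.id ℝ (TangentSpace (𝓡 3) x) := by
  rw [← mfderiv_comp x (h.symm.mdiff (φ x)) (h.mdiff x)]
  have : (φ.symm ∘ φ : M → M) = id := by ext y; simp
  rw [this, mfderiv_id]

lemma IsDiffeo.isInvertible {φ : Equiv.Perm M} (h : IsDiffeo φ) (x : M) :
    (mfderiv (𝓡 3) (𝓡 3) φ x).IsInvertible := by
  have h1 := h.mfderiv_symm_comp x
  have h2 := h.symm.mfderiv_symm_comp (φ x)
  simp only [Equiv.symm_symm] at h2
  rw [Equiv.symm_apply_apply] at h2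
  exact ContinuousLinearMap.IsInvertible.of_inverse h2 h1

lemma IsDiffeo.pushField_smooth {φ : Equiv.Perm M} (h : IsDiffeo φ) {X : VField M}
    (hX : SmoothField X) : SmoothField (pushField φ X) :=
  ContMDiff.mpullback_vectorField hX h.2 (fun x => h.symm.isInvertible x) (by simp)

lemma IsDiffeo.mfderiv_pushField {φ : Equiv.Perm M} (h : IsDiffeo φ) (X : VField M) (x : M) :
    mfderiv (𝓡 3) (𝓡 3) φ.symm x (pushField φ X x) = X (φ.symm x) := by
  obtain ⟨e, he⟩ := h.symm.isInvertible x
  simp [pushField, VectorField.mpullback_apply, ← he]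

lemma IsDiffeo.contract_push {φ : Equiv.Perm M} (h : IsDiffeo φ) (α : CovField M)
    (X : VField M) : contract (pushForm φ α) (pushField φ X) = contract α X ∘ φ.symm := by
  funext x
  simp [contract, pushForm, pullForm, h.mfderiv_pushField]

lemma IsDiffeo.pushField_symm {φ : Equiv.Perm M} (h : IsDiffeo φ) (X : VField M) :
    pushField φ (pushField φ.symm X) = X := by
  funext x
  have h0 : (φ ∘ φ.symm : M → M) = id := by ext y; simp
  have h1 := VectorField.mpullbackWithin_comp_of_left (I := 𝓡 3) (I' := 𝓡 3) (I'' := 𝓡 3) (g := φ)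
    (f := φ.symm) (V := X) (x₀ := x) (s := Set.univ) (t := Set.univ)
    ((h.symm.mdiff x).mdifferentiableWithinAt) (Set.mapsTo_univ _ _) (uniqueMDiffWithinAt_univ _)
    (by rw [mfderivWithin_univ]; exact h.isInvertible _)
  simp only [VectorField.mpullbackWithin_univ] at h1
  rw [h0, VectorField.mpullback_id] at h1
  exact h1.symm

lemma IsDiffeo.pushForm_smooth {φ : Equiv.Perm M} (h : IsDiffeo φ) {α : CovField M}
    (hα : α ∈ SmoothForms M) : pushForm φ α ∈ SmoothForms M := by
  intro X hX
  rw [← h.pushField_symm X, h.contract_push]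
  exact (hα _ (h.symm.pushField_smooth hX)).comp h.2

lemma IsDiffeo.dirDeriv_push {φ : Equiv.Perm M} (h : IsDiffeo φ) {f : M → ℝ} (hf : SmoothFun f)
    (X : VField M) (x : M) : dirDeriv (pushField φ X) (f ∘ φ.symm) x = dirDeriv X f (φ.symm x) := by
  unfold dirDeriv
  rw [mvfderiv_comp x (hf.mdiff _) (h.symm.mdiff x), ← h.mfderiv_pushField X x]
  rfl

lemma IsDiffeo.bracket_push {φ : Equiv.Perm M} (h : IsDiffeo φ) {X Y : VField M}
    (hX : SmoothField X) (hY : SmoothField Y) :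
    bracket (pushField φ X) (pushField φ Y) = pushField φ (bracket X Y) := by
  funext x
  have : IsManifold (𝓡 3) (minSmoothness ℝ 2) M := by
    rw [minSmoothness_of_isRCLikeNormedField]; infer_instance
  refine (VectorField.mpullback_mlieBracket (n := ∞) ?_ ?_ (h.2 x) ?_).symm
  · exact (ContMDiff.mdifferentiable hX (by simp)) _
  · exact (ContMDiff.mdifferentiable hY (by simp)) _
  · simpa using (ENat.LEInfty.out : (2 : ℕ∞ω) ≤ ∞)

lemma IsDiffeo.dForm_push {φ : Equiv.Perm M} (h : IsDiffeo φ) {α : CovField M}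
    (hα : α ∈ SmoothForms M) {X Y : VField M} (hX : SmoothField X) (hY : SmoothField Y) (x : M) :
    dForm (pushForm φ α) (pushField φ X) (pushField φ Y) x = dForm α X Y (φ.symm x) := by
  unfold dForm
  rw [h.bracket_push hX hY]
  simp only [h.contract_push]
  rw [h.dirDeriv_push (hα Y hY), h.dirDeriv_push (hα X hX)]
  rfl

lemma pullForm_id (α : CovField M) : pullForm id α = α := by
  funext x
  ext v
  simp only [pullForm, mfderiv_id]
  rfl

lemma pushForm_one (α : CovField M) : pushForm 1 α = α := pullForm_id α

lemma pullForm_comp {f g : M → M} (hf : MDifferentiable (𝓡 3) (𝓡 3) f)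
    (hg : MDifferentiable (𝓡 3) (𝓡 3) g) (α : CovField M) :
    pullForm (f ∘ g) α = pullForm g (pullForm f α) := by
  funext x
  ext v
  simp only [pullForm]
  rw [mfderiv_comp x (hf _) (hg x)]
  rfl

lemma pushForm_mul {φ ψ : Equiv.Perm M} (hφ : IsDiffeo φ) (hψ : IsDiffeo ψ) (α : CovField M) :
    pushForm (φ * ψ) α = pushForm φ (pushForm ψ α) :=
  pullForm_comp hψ.symm.mdiff hφ.symm.mdiff α

/-- The group `SDiff(M)` of diffeomorphisms `φ` of `M` that preserve the volume form,
`φ^* μ = μ`. -/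
def SDiff (μ : TopForm M) : Subgroup (Equiv.Perm M) where
  carrier := {φ | IsDiffeo φ ∧ ∀ (x : M) (u : Fin 3 → TangentSpace (𝓡 3) x),
    μ (φ x) (fun i => mfderiv (𝓡 3) (𝓡 3) φ x (u i)) = μ x u}
  mul_mem' := by
    rintro φ ψ ⟨hφ, hφ'⟩ ⟨hψ, hψ'⟩
    refine ⟨hφ.mul hψ, fun x u => ?_⟩
    have e : ((φ * ψ : Equiv.Perm M) : M → M) = φ ∘ ψ := rfl
    rw [e, mfderiv_comp x (hφ.mdiff _) (hψ.mdiff x), ← hψ' x u]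
    exact hφ' (ψ x) (fun i => mfderiv (𝓡 3) (𝓡 3) ψ x (u i))
  one_mem' := by
    refine ⟨⟨contMDiff_id, contMDiff_id⟩, fun x u => ?_⟩
    have e : ((1 : Equiv.Perm M) : M → M) = id := rfl
    rw [e, mfderiv_id]
    rfl
  inv_mem' := by
    rintro φ ⟨hφ, hφ'⟩
    refine ⟨hφ.symm, fun x u => ?_⟩
    have h1 := hφ.symm.mfderiv_symm_comp x
    simp only [Equiv.symm_symm] at h1
    have h2 := hφ' (φ.symm x) (fun i => mfderiv (𝓡 3) (𝓡 3) φ.symm x (u i))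
    have h3 : ∀ i, mfderiv (𝓡 3) (𝓡 3) φ (φ.symm x) (mfderiv (𝓡 3) (𝓡 3) φ.symm x (u i)) = u i :=
      fun i => congrArg (fun L => L (u i)) h1
    simp only [h3] at h2
    have h4 : ∀ z : M, z = x → ∀ w : Fin 3 → E3, μ z w = μ x w := by rintro _ rfl _; rfl
    exact h2.symm.trans (h4 _ (φ.apply_symm_apply x) u)

lemma SDiff.isDiffeo {μ : TopForm M} (φ : SDiff μ) : IsDiffeo φ.1 := φ.2.1

lemma SDiff.contractsTo_push {μ : TopForm M} (φ : SDiff μ) {w : VField M} {α : CovField M}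
    (hα : α ∈ SmoothForms M) (h : ContractsTo μ w α) :
    ContractsTo μ (pushField φ.1 w) (pushForm φ.1 α) := by
  intro X Y hX hY x
  have hφ := SDiff.isDiffeo φ
  have hX' := hφ.symm.pushField_smooth hX
  have hY' := hφ.symm.pushField_smooth hY
  have h1 := h _ _ hX' hY' (φ.1.symm x)
  rw [← hφ.dForm_push hα hX' hY', hφ.pushField_symm, hφ.pushField_symm] at h1
  rw [← h1]
  have h2 := (φ⁻¹).2.2 x ![pushField φ.1 w x, X x, Y x]
  rw [← h2]
  have e : ((φ⁻¹ : SDiff μ).1 : M → M) = φ.1.symm := rfl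
  have hw := hφ.mfderiv_pushField w x
  have hXx := hφ.mfderiv_pushField (pushField φ.1.symm X) x
  have hYx := hφ.mfderiv_pushField (pushField φ.1.symm Y) x
  rw [hφ.pushField_symm] at hXx hYx
  refine congrArg (μ (φ.1.symm x)) ?_
  funext i
  fin_cases i
  · exact hw
  · exact hXx
  · exact hYx

/-- Push-forward on smooth one-forms. -/
def pushOneForm {μ : TopForm M} (φ : SDiff μ) : OneForm M →ₗ[ℝ] OneForm M where
  toFun α := ⟨pushForm φ.1 α.val, (SDiff.isDiffeo φ).pushForm_smooth α.val_mem⟩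
  map_add' _ _ := rfl
  map_smul' _ _ := rfl

lemma pushOneForm_closed {μ : TopForm M} (φ : SDiff μ) :
    ClosedForm M ≤ (ClosedForm M).comap (pushOneForm φ) := by
  intro α hα X Y hX hY x
  have hφ := SDiff.isDiffeo φ
  have hX' := hφ.symm.pushField_smooth hX
  have hY' := hφ.symm.pushField_smooth hY
  have h1 := hφ.dForm_push α.val_mem hX' hY' x
  rw [hφ.pushField_symm, hφ.pushField_symm, hα _ _ hX' hY'] at h1
  exact h1

/-- The action `φ · [α] = [(φ⁻¹)^* α]` of `SDiff(M)` on `𝔛*(M)`. -/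
def pushDual {μ : TopForm M} (φ : SDiff μ) : DualX M →ₗ[ℝ] DualX M :=
  (ClosedForm M).mapQ (ClosedForm M) (pushOneForm φ) (pushOneForm_closed φ)

lemma pushDual_mk {μ : TopForm M} (φ : SDiff μ) (α : OneForm M) :
    pushDual φ (Submodule.Quotient.mk α) = Submodule.Quotient.mk (pushOneForm φ α) := rfl

instance (μ : TopForm M) : DistribMulAction (SDiff μ) (DualX M) where
  smul φ a := pushDual φ a
  one_smul a := by
    obtain ⟨α, rfl⟩ := Submodule.Quotient.mk_surjective _ a
    have h : pushOneForm (1 : SDiff μ) α = α := OneForm.ext (pushForm_one α.val)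
    exact congrArg Submodule.Quotient.mk h
  mul_smul φ ψ a := by
    obtain ⟨α, rfl⟩ := Submodule.Quotient.mk_surjective _ a
    have h : pushOneForm (φ * ψ) α = pushOneForm φ (pushOneForm ψ α) :=
      OneForm.ext (pushForm_mul (SDiff.isDiffeo φ) (SDiff.isDiffeo ψ) α.val)
    exact congrArg Submodule.Quotient.mk h
  smul_zero φ := map_zero (pushDual φ)
  smul_add φ := map_add (pushDual φ)

/-- Push-forward of exact fields by volume-preserving diffeomorphisms. -/
def pushExact {μ : TopForm M} (φ : SDiff μ) (w : ExactField μ) : ExactField μ :=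
  ⟨pushField φ.1 w.1, by
    obtain ⟨hw, α, hα, h⟩ := w.2
    exact ⟨(SDiff.isDiffeo φ).pushField_smooth hw, _, (SDiff.isDiffeo φ).pushForm_smooth hα,
      SDiff.contractsTo_push φ hα h⟩⟩

/-! ### The group `SDiff(M) ⋉ 𝔛*(M)` and its adjoint action -/

/-- The semidirect product `SDiff(M) ⋉ 𝔛*(M)`, with the product
`([α], φ) ([β], ψ) = ([α] + φ · [β], φ ψ)`. -/
abbrev MHDGroup (μ : TopForm M) : Type _ :=
  Multiplicative (DualX M) ⋊[(MulAutMultiplicative (DualX M)).symm.toMonoidHom.comp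
    (DistribMulAction.toAddAut (SDiff μ) (DualX M))] SDiff μ

/-- `β` is the Lie derivative `L_w α`: `(L_w α)(Y) = w (α Y) - α [w, Y]` for all `Y`. -/
def IsLieDeriv (w : VField M) (α β : OneForm M) : Prop :=
  ∀ Y : VField M, SmoothField Y → ∀ x,
    contract β.val Y x = dirDeriv w (contract α.val Y) x - contract α.val (bracket w Y) x

open Classical in
/-- The Lie derivative `L_w α` of a smooth one-form along a smooth vector field. -/
def lieForm (w : VField M) (α : OneForm M) : OneForm M :=
  if h : ∃ β, IsLieDeriv w α β then h.choose else 0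

/-- The Lie derivative `L_w [α]` of a coset of one-forms. -/
def lieDual (w : VField M) (a : DualX M) : DualX M :=
  Submodule.Quotient.mk (lieForm w (rep a))

/-- The Lie algebra `𝔤 = 𝔛(M) ⋉ 𝔛*(M)` (as a vector space). -/
abbrev MHDAlgebra (μ : TopForm M) : Type _ := ExactField μ × DualX M

/-- The adjoint action of `SDiff(M) ⋉ 𝔛*(M)` on its Lie algebra (the derivative of conjugation):
`Ad_{(φ, a)} (w, c) = (φ_* w, φ · c + L_{φ_* w} a)`. -/
def Ad {μ : TopForm M} (Φ : MHDGroup μ) (ξ : MHDAlgebra μ) : MHDAlgebra μ :=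
  (pushExact Φ.right ξ.1,
    Φ.right • ξ.2 + lieDual (pushExact Φ.right ξ.1).1 (Multiplicative.toAdd Φ.left))

/-! ### Integration -/

variable [CompactSpace M] [T2Space M]

variable (M) in
/-- A smooth partition of unity subordinate to the domains of the preferred charts. -/
def partition : SmoothPartitionOfUnity M (𝓡 3) M Set.univ :=
  (SmoothPartitionOfUnity.exists_isSubordinate_chartAt_source (𝓡 3) M).choose

/-- The density of `μ` in the chart at `c`: at the point with coordinates `y`, it is
`|μ(∂₁, ∂₂, ∂₃)|`. -/
def density (μ : TopForm M) (c : M) (y : E3) : ℝ :=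
  |μ ((extChartAt (𝓡 3) c).symm y)
    (fun j => mfderiv 𝓘(ℝ, E3) (𝓡 3) (extChartAt (𝓡 3) c).symm y
      (EuclideanSpace.single j (1 : ℝ) : E3))|

/-- The integral `∫_M f dμ` of a function against the density of `μ`, computed in charts with the
help of a partition of unity. -/
def integral (μ : TopForm M) (f : M → ℝ) : ℝ :=
  ∑ᶠ c : M, ∫ y in (extChartAt (𝓡 3) c).target,
    partition M c ((extChartAt (𝓡 3) c).symm y) * f ((extChartAt (𝓡 3) c).symm y) *
      density μ c y

end Forms

/-! ### Riemannian geometry -/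

section Riemannian

variable {M : Type*} [TopologicalSpace M] [ChartedSpace E3 M] [IsManifold (𝓡 3) ∞ M]
  [Bundle.RiemannianBundle (fun x : M => TangentSpace (𝓡 3) x)]

/-- `μ` is a Riemannian volume form: it is smooth and takes the values `±1` on orthonormal frames.
Such a form is the same thing as an orientation of the Riemannian manifold. -/
structure IsVolumeForm (μ : TopForm M) : Prop where
  smooth : ∀ X Y Z : VField M, SmoothField X → SmoothField Y → SmoothField Z →
    SmoothFun (fun x => μ x ![X x, Y x, Z x])
  unit : ∀ (x : M) (e : Fin 3 → TangentSpace (𝓡 3) x), Orthonormal ℝ e → |μ x e| = 1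

/-- The one-form `v^♭`. -/
def flat (v : VField M) : CovField M := fun x => innerSL ℝ (v x)

instance (x : M) : FiniteDimensional ℝ (TangentSpace (𝓡 3) x) :=
  inferInstanceAs (FiniteDimensional ℝ E3)

instance (x : M) : CompleteSpace (TangentSpace (𝓡 3) x) := FiniteDimensional.complete ℝ _

/-- The vector `α^♯` dual to a covector. -/
def sharp {x : M} (α : TangentSpace (𝓡 3) x →L[ℝ] ℝ) : TangentSpace (𝓡 3) x :=
  (InnerProductSpace.toDual ℝ (TangentSpace (𝓡 3) x)).symm α

/-- The gradient of a function. -/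
def grad (f : M → ℝ) : VField M := fun x => sharp (mvfderiv (𝓡 3) f x)

/-- `w` is the curl of `v`: the smooth field with `i_w μ = d(v^♭)`. -/
def IsCurl (μ : TopForm M) (v w : VField M) : Prop := SmoothField w ∧ ContractsTo μ w (flat v)

open Classical in
/-- The curl of a smooth vector field. -/
def curl (μ : TopForm M) (v : VField M) : VField M :=
  if h : ∃ w, IsCurl μ v w then h.choose else 0

open Classical in
/-- The inverse of `curl : 𝔛(M) → 𝔛(M)`: the exact divergence-free field whose curl is `u`.
(The second alternative, an arbitrary smooth field with curl `u`, is never needed, by the Hodge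
theorem; it is there only so that the definition makes sense without that theorem.) -/
def curlInv (μ : TopForm M) (u : VField M) : VField M :=
  if h : ∃ v ∈ ExactField μ, IsCurl μ v u then h.choose
  else if h' : ∃ v, SmoothField v ∧ IsCurl μ v u then h'.choose
  else 0

/-- The cross product: `⟨a × b, c⟩ = μ(a, b, c)`. -/
def cross (μ : TopForm M) (a b : VField M) : VField M := fun x =>
  sharp (LinearMap.toContinuousLinearMap
    ((μ x).toMultilinearMap.toLinearMap ![a x, b x, 0] 2))

section Helicity

variable [CompactSpace M] [T2Space M]

/-- The bilinear form `H(u, B) = ∫_M B · curl⁻¹ u dμ`. For `u = curl v` it is the cross-helicity,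
and `H(B, B)` is the magnetic helicity. -/
def helicity (μ : TopForm M) (u B : VField M) : ℝ :=
  integral μ (fun x => inner ℝ (B x) (curlInv μ u x))

/-- The dual space `𝔤^* = 𝔛*(M) ⊕ 𝔛(M)`, written as the space of pairs `(ω, B)` of exact fields:
`ω` stands for the coset of `(curl⁻¹ ω)^♭`. -/
abbrev MHDDual (μ : TopForm M) : Type _ := ExactField μ × ExactField μ

/-- The pairing of `𝔤^*` with `𝔤`:
`⟨(ω, B), (w, [γ])⟩ = ∫_M curl⁻¹ ω · w dμ + ∫_M γ(B) dμ`. -/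
def pairing {μ : TopForm M} (m : MHDDual μ) (ξ : MHDAlgebra μ) : ℝ :=
  integral μ (fun x => inner ℝ (curlInv μ m.1.1 x) (ξ.1.1 x)) +
    integral μ (contract (rep ξ.2).val m.2.1)

/-- `m' = Ad^*_Φ m`, the coadjoint action of `Φ ∈ SDiff(M) ⋉ 𝔛*(M)` on `m ∈ 𝔤^*`, that is,
`⟨m', ξ⟩ = ⟨m, Ad_{Φ⁻¹} ξ⟩` for all `ξ ∈ 𝔤`. -/
def IsCoadjoint {μ : TopForm M} (Φ : MHDGroup μ) (m m' : MHDDual μ) : Prop :=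
  ∀ ξ : MHDAlgebra μ, pairing m' ξ = pairing m (Ad Φ⁻¹ ξ)

end Helicity

/-! ### The equations of ideal magnetohydrodynamics -/

section Equations

variable [IsContMDiffRiemannianBundle (𝓡 3) ∞ E3 (fun x : M => TangentSpace (𝓡 3) x)]

instance : IsContMDiffRiemannianBundle (𝓡 3) 1 E3 (fun x : M => TangentSpace (𝓡 3) x) :=
  IsContMDiffRiemannianBundle.of_le (n := ∞) (by simp)

/-- `D` is the Levi-Civita connection. -/
def IsLeviCivita
    (D : CovariantDerivative (𝓡 3) E3 (fun x : M => TangentSpace (𝓡 3) x)) : Prop :=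
  D.torsion = 0 ∧ D.IsMetricCompatible

/-- The time-dependent vector field `v` is jointly smooth in time and space, for times in `J`. -/
def SmoothFlow (J : Set ℝ) (v : ℝ → VField M) : Prop :=
  ContMDiffOn (𝓘(ℝ, ℝ).prod (𝓡 3)) (𝓡 3).tangent ∞
    (fun q : ℝ × M => (⟨q.2, v q.1 q.2⟩ : TangentBundle (𝓡 3) M)) (J ×ˢ Set.univ)

/-- `(v, B, p)` is a smooth solution, for times in `J`, of the equations
`∂_t v = -(v, ∇) v + (curl B) × B - ∇ p`, `∂_t B = -[v, B]`, `div B = div v = 0`. -/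
structure IsMHDSolution (μ : TopForm M)
    (D : CovariantDerivative (𝓡 3) E3 (fun x : M => TangentSpace (𝓡 3) x))
    (J : Set ℝ) (v B : ℝ → VField M) (p : ℝ → M → ℝ) : Prop where
  smooth_v : SmoothFlow J v
  smooth_B : SmoothFlow J B
  smooth_p : ∀ t ∈ J, SmoothFun (p t)
  momentum : ∀ t ∈ J, ∀ x, HasDerivWithinAt (fun s => v s x)
    (-(D (v t) x (v t x)) + cross μ (curl μ (B t)) (B t) x - grad (p t) x) J t
  induction : ∀ t ∈ J, ∀ x, HasDerivWithinAt (fun s => B s x) (-(bracket (v t) (B t) x)) J t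
  div_v : ∀ t ∈ J, DivFree μ (v t)
  div_B : ∀ t ∈ J, DivFree μ (B t)

end Equations

end Riemannian

end

end MHD

namespace MHD

noncomputable section

set_option linter.unusedSectionVars false

open scoped Topology
open VectorField Filter Set MeasureTheory

/-! ### Derivatives along smooth fields and Lie brackets. -/

section Calculus

variable {M : Type*} [TopologicalSpace M] [ChartedSpace E3 M] [IsManifold (𝓡 3) ∞ M]

/-! Both halves rest on Stokes' theorem in the form `∫ α ∧ dβ = ∫ β ∧ dα`
(`IsVolumeForm.integral_wedge`), that is, on the symmetry of the curl. It implies that for an exact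
field `B` the integral `∫ α(B) dμ` depends on `α` only through `dα`. Hence `H(u, B) = ∫ α(B) dμ` for
every smooth `α` with `dα = i_u μ` (`IsVolumeForm.helicity_eq`), whichever field `curlInv` selects.
No Hodge theory is needed.

Casimirs. Let `u = curl⁻¹ ω`, let `φ` be the diffeomorphism in `Φ`, and let `z` be the curl of a
one-form representing the `𝔛*`-component `a` of `Φ⁻¹`. Cartan's formula gives `∫ (L_w a)(B) = ∫ (B ×
z) · w` (`IsVolumeForm.integral_lieDual`). So the coadjoint image of `(ω, B)` is `(ω', φ_* B)`,
where `i_{ω'} μ = d(φ_*(u + B × z)^♭)`. Integrals are invariant under `φ`, so the magnetic helicity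
is unchanged, and the cross-helicity changes by `∫ (B × z) · B = 0`. Uniqueness is the nondegeneracy
of the pairing (`IsVolumeForm.pairing_injective`).

Conservation. The cross-helicity is `∫ v · B`. The integrand of its rate is `B(|v|²/2 - p) - v(v ·
B)`, and derivatives of functions along divergence-free fields integrate to zero
(`IsVolumeForm.integral_dirDeriv_eq_zero`). For the magnetic helicity, write `A_t = curl⁻¹ B_t`,
about whose dependence on time nothing is known. By symmetry the increment from `s` to `t` is `∫
(A_t + A_s) · (B_t - B_s)`. With `A_t + A_s` frozen, the mean value theorem turns it into `(t - s) ∫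
μ(B_t + B_s, v_τ, B_τ)`. As `μ(B_τ, v_τ, B_τ) = 0`, the vector `2 B_τ` may be subtracted from the
first entry, so the increment is `o(t - s)` and the derivative is zero.

The preliminary sections supply the calculus. The Levi-Civita connection shows that `d` is
tensorial. Coordinate frames, cut off to global fields, reduce identities to `ℝ³`. A partition of
unity reduces integrals to charts. -/

lemma SmoothField.mdiff {X : VField M} (hX : SmoothField X) (x : M) :
    MDifferentiableAt (𝓡 3) (𝓡 3).tangent (fun y => (⟨y, X y⟩ : TangentBundle (𝓡 3) M)) x :=
  (ContMDiff.mdifferentiable hX (by simp)) x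

lemma SmoothField.dirDeriv_smooth {X : VField M} (hX : SmoothField X) {f : M → ℝ}
    (hf : SmoothFun f) : SmoothFun (dirDeriv X f) := by
  have h1 : ContMDiff (𝓡 3).tangent 𝓘(ℝ, ℝ).tangent ∞ (tangentMap (𝓡 3) 𝓘(ℝ, ℝ) f) :=
    ContMDiff.contMDiff_tangentMap hf (by simp)
  have h2 := h1.comp hX
  have h3 := (contMDiff_snd_tangentBundle_modelSpace (n := ∞) ℝ 𝓘(ℝ, ℝ)).comp h2
  exact h3

lemma SmoothField.bracket_smooth {X Y : VField M} (hX : SmoothField X) (hY : SmoothField Y) :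
    SmoothField (bracket X Y) := by
  have h1 : IsManifold (𝓡 3) (((⊤ : ℕ∞) : ℕ∞ω) + 1) M := inferInstanceAs (IsManifold (𝓡 3) ∞ M)
  have h2 : IsManifold (𝓡 3) (minSmoothness ℝ 2) M := by
    rw [minSmoothness_of_isRCLikeNormedField]; infer_instance
  exact ContDiff.mlieBracket_vectorField (m := ⊤) (n := ⊤) hX hY (by simp)

lemma dirDeriv_add {X : VField M} {f g : M → ℝ} (hf : SmoothFun f) (hg : SmoothFun g) (x : M) :
    dirDeriv X (fun y => f y + g y) x = dirDeriv X f x + dirDeriv X g x :=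
  congrArg (fun L => L (X x)) (mvfderiv_add (hf.mdiff x) (hg.mdiff x))

lemma dirDeriv_sub {X : VField M} {f g : M → ℝ} (hf : SmoothFun f) (hg : SmoothFun g) (x : M) :
    dirDeriv X (fun y => f y - g y) x = dirDeriv X f x - dirDeriv X g x :=
  congrArg (fun L => L (X x)) (mvfderiv_sub (hf.mdiff x) (hg.mdiff x))

lemma dirDeriv_mul {X : VField M} {f g : M → ℝ} (hf : SmoothFun f) (hg : SmoothFun g) (x : M) :
    dirDeriv X (fun y => f y * g y) x = f x * dirDeriv X g x + g x * dirDeriv X f x := by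
  have := congrArg (fun L => L (X x)) (mvfderiv_mul (hf.mdiff x) (hg.mdiff x))
  simpa [dirDeriv] using! this

lemma dirDeriv_congr {X : VField M} {f g : M → ℝ} {x : M} (h : f =ᶠ[𝓝 x] g) :
    dirDeriv X f x = dirDeriv X g x := by
  unfold dirDeriv mvfderiv
  rw [h.mfderiv_eq]
  rw [h.self_of_nhds]

end Calculus

/-! ### Coordinate vector fields of a chart. -/

section Charts

variable {M : Type*} [TopologicalSpace M] [ChartedSpace E3 M] [IsManifold (𝓡 3) ∞ M]

/-- The standard basis vectors of `ℝ³`. -/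
def stdVec (i : Fin 3) : E3 := EuclideanSpace.single i (1 : ℝ)

/-- The constant vector fields on `ℝ³`. -/
def constField (i : Fin 3) : (y : E3) → TangentSpace 𝓘(ℝ, E3) y := fun _ => stdVec i

/-- The coordinate vector fields of the preferred chart at `c`. -/
def chartField (c : M) (i : Fin 3) : VField M :=
  mpullback (𝓡 3) 𝓘(ℝ, E3) (extChartAt (𝓡 3) c) (constField i)

lemma isOpen_chart_target (c : M) : IsOpen (extChartAt (𝓡 3) c).target :=
  isOpen_extChartAt_target c

lemma chart_target_mem_nhds {c : M} {y : E3} (hy : y ∈ (extChartAt (𝓡 3) c).target) :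
    (extChartAt (𝓡 3) c).target ∈ 𝓝 y := (isOpen_chart_target c).mem_nhds hy

lemma contMDiffAt_chart_symm {c : M} {y : E3} (hy : y ∈ (extChartAt (𝓡 3) c).target) :
    ContMDiffAt 𝓘(ℝ, E3) (𝓡 3) ∞ (extChartAt (𝓡 3) c).symm y :=
  (contMDiffOn_extChartAt_symm c).contMDiffAt (chart_target_mem_nhds hy)

lemma mdiff_chart_symm {c : M} {y : E3} (hy : y ∈ (extChartAt (𝓡 3) c).target) :
    MDifferentiableAt 𝓘(ℝ, E3) (𝓡 3) (extChartAt (𝓡 3) c).symm y :=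
  (contMDiffAt_chart_symm hy).mdifferentiableAt (by simp)

lemma mdiff_chart {c x : M} (hx : x ∈ (extChartAt (𝓡 3) c).source) :
    MDifferentiableAt (𝓡 3) 𝓘(ℝ, E3) (extChartAt (𝓡 3) c) x :=
  mdifferentiableAt_extChartAt (by simpa using hx)

lemma mfderiv_symm_comp_chart {c x : M} (hx : x ∈ (extChartAt (𝓡 3) c).source)
    (v : TangentSpace (𝓡 3) x) :
    mfderiv 𝓘(ℝ, E3) (𝓡 3) (extChartAt (𝓡 3) c).symm (extChartAt (𝓡 3) c x)
      (mfderiv (𝓡 3) 𝓘(ℝ, E3) (extChartAt (𝓡 3) c) x v) = v := by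
  have h := mfderivWithin_extChartAt_symm_comp_mfderiv_extChartAt' (I := 𝓡 3) hx
  simp only [ModelWithCorners.range_eq_univ, mfderivWithin_univ] at h
  exact congrArg (fun L => L v) h

lemma mfderiv_chart_chartField {c x : M} (hx : x ∈ (extChartAt (𝓡 3) c).source) (i : Fin 3) :
    mfderiv (𝓡 3) 𝓘(ℝ, E3) (extChartAt (𝓡 3) c) x (chartField c i x) = stdVec i := by
  have h := (isInvertible_mfderiv_extChartAt (I := 𝓡 3) hx).self_apply_inverse
    (constField i (extChartAt (𝓡 3) c x))
  exact h

lemma chartField_eq {c x : M} (hx : x ∈ (extChartAt (𝓡 3) c).source) (i : Fin 3) :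
    chartField c i x = mfderiv 𝓘(ℝ, E3) (𝓡 3) (extChartAt (𝓡 3) c).symm
      (extChartAt (𝓡 3) c x) (stdVec i) := by
  rw [← mfderiv_chart_chartField hx i, mfderiv_symm_comp_chart hx]

lemma chartField_symm {c : M} {y : E3} (hy : y ∈ (extChartAt (𝓡 3) c).target) (i : Fin 3) :
    chartField c i ((extChartAt (𝓡 3) c).symm y) =
      mfderiv 𝓘(ℝ, E3) (𝓡 3) (extChartAt (𝓡 3) c).symm y (stdVec i) := by
  have h := chartField_eq ((extChartAt (𝓡 3) c).map_target hy) i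
  -- The base points `chart (chart.symm y)` and `y` are only propositionally equal and the tangent
  -- spaces depend on them, so the comparison is made in the model space `E3`.
  have h2 : ∀ z : E3, z = y → ∀ w : E3,
     (mfderiv 𝓘(ℝ, E3) (𝓡 3) (extChartAt (𝓡 3) c).symm z (stdVec i) : E3) = w →
      w = (mfderiv 𝓘(ℝ, E3) (𝓡 3) (extChartAt (𝓡 3) c).symm y (stdVec i) : E3) := by
    rintro z rfl w rfl; rfl
  exact h2 _ ((extChartAt (𝓡 3) c).right_inv hy) _ h.symm

lemma chartField_smoothAt {c x : M} (hx : x ∈ (extChartAt (𝓡 3) c).source) (i : Fin 3) :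
    ContMDiffAt (𝓡 3) (𝓡 3).tangent ∞
      (fun y => (⟨y, chartField c i y⟩ : TangentBundle (𝓡 3) M)) x := by
  refine ContMDiffAt.mpullback_vectorField_preimage (n := ∞) (I' := 𝓘(ℝ, E3)) ?_
    (contMDiffAt_extChartAt' (by simpa using hx)) (isInvertible_mfderiv_extChartAt hx) (by simp)
  exact (contMDiff_vectorSpace_iff_contDiff.2 contDiff_const).contMDiffAt

/-- Brackets commute with pull-back along the chart, and constant fields on `ℝ³` commute. -/
lemma bracket_chartField {c x : M} (hx : x ∈ (extChartAt (𝓡 3) c).source) (i j : Fin 3) :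
    bracket (chartField c i) (chartField c j) x = 0 := by
  have : IsManifold (𝓡 3) (minSmoothness ℝ 2) M := by
    rw [minSmoothness_of_isRCLikeNormedField]; infer_instance
  have : IsManifold (𝓡 3) (minSmoothness ℝ 3) M := by
    rw [minSmoothness_of_isRCLikeNormedField]; infer_instance
  have hs : ∀ k, ContMDiff 𝓘(ℝ, E3) 𝓘(ℝ, E3).tangent ∞
     (fun y => (⟨y, constField k y⟩ : TangentBundle 𝓘(ℝ, E3) E3)) := fun k =>
    contMDiff_vectorSpace_iff_contDiff.2 contDiff_const
  have h := mpullback_mlieBracket (I := 𝓡 3) (I' := 𝓘(ℝ, E3)) (n := ∞)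
    (f := extChartAt (𝓡 3) c) (V := constField i) (W := constField j) (x₀ := x)
    ((hs i).mdifferentiable (by simp) _) ((hs j).mdifferentiable (by simp) _)
    (contMDiffAt_extChartAt' (by simpa using hx))
    (by simpa using (ENat.LEInfty.out : (2 : ℕ∞ω) ≤ ∞))
  refine h.symm.trans ?_
  rw [mpullback_apply, ← mlieBracketWithin_univ, mlieBracketWithin_eq_lieBracketWithin]
  have : lieBracketWithin ℝ (constField i) (constField j) univ = 0 := by
    funext y
    unfold constField
    simp [lieBracketWithin]
  rw [this]
  exact map_zero _

/-- The coordinates of a tangent vector in the preferred chart at `c`. -/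
def chartCoord (c : M) {x : M} (v : TangentSpace (𝓡 3) x) : E3 :=
  mfderiv (𝓡 3) 𝓘(ℝ, E3) (extChartAt (𝓡 3) c) x v

lemma eq_sum_stdVec (w : E3) : w = ∑ i, w i • stdVec i := by
  ext j
  fin_cases j <;> simp [Fin.sum_univ_three, stdVec]

lemma eq_sum_chartField {c x : M} (hx : x ∈ (extChartAt (𝓡 3) c).source)
    (v : TangentSpace (𝓡 3) x) : v = ∑ i, chartCoord c v i • chartField c i x := by
  let L : E3 →L[ℝ] E3 :=
    mfderiv 𝓘(ℝ, E3) (𝓡 3) (extChartAt (𝓡 3) c).symm (extChartAt (𝓡 3) c x)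
  have h1 : L (chartCoord c v) = v := mfderiv_symm_comp_chart hx v
  have h2 : ∀ i, L (stdVec i) = chartField c i x := fun i => (chartField_eq hx i).symm
  have h3 : L (chartCoord c v) = ∑ i, chartCoord c v i • L (stdVec i) := by
    conv_lhs => rw [eq_sum_stdVec (chartCoord c v)]
    rw [map_sum]
    simp only [map_smul]
  rw [h1] at h3
  simp only [h2] at h3
  exact h3

lemma contDiffAt_comp_chart_symm {c : M} {f : M → ℝ} (hf : SmoothFun f) {y : E3}
    (hy : y ∈ (extChartAt (𝓡 3) c).target) :
    ContDiffAt ℝ ∞ (f ∘ (extChartAt (𝓡 3) c).symm) y :=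
  (hf.contMDiffAt.comp y (contMDiffAt_chart_symm hy)).contDiffAt

lemma dirDeriv_chartField {c : M} {f : M → ℝ} {y : E3} (hy : y ∈ (extChartAt (𝓡 3) c).target)
    (hf : SmoothFun f) (i : Fin 3) :
    dirDeriv (chartField c i) f ((extChartAt (𝓡 3) c).symm y) =
      fderiv ℝ (f ∘ (extChartAt (𝓡 3) c).symm) y (stdVec i) := by
  have h := mvfderiv_comp_apply y (hf.mdiff ((extChartAt (𝓡 3) c).symm y)) (mdiff_chart_symm hy)
    (stdVec i)
  rw [← chartField_symm hy] at h
  rw [dirDeriv, ← h, mvfderiv, mfderiv_eq_fderiv]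
  rfl

/-- In the chart this is the symmetry of the second derivative. Global fields `X`, `Y` that agree
with the coordinate fields near `x` are used so that `X f` and `Y f` are smooth on all of `M`. -/
lemma dirDeriv_chartField_comm {c x : M} {f : M → ℝ} (hf : SmoothFun f)
    (hx : x ∈ (extChartAt (𝓡 3) c).source) {X Y : VField M} (hX : SmoothField X)
    (hY : SmoothField Y) {i j : Fin 3} (hXi : X =ᶠ[𝓝 x] chartField c i)
    (hYj : Y =ᶠ[𝓝 x] chartField c j) :
    dirDeriv X (dirDeriv Y f) x = dirDeriv Y (dirDeriv X f) x := by
  set φ := extChartAt (𝓡 3) c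
  set y := φ x
  have hy : y ∈ φ.target := φ.map_source hx
  have hxy : φ.symm y = x := φ.left_inv hx
  have key : ∀ (Z W : VField M) (k l : Fin 3), SmoothField Z → SmoothField W →
      Z =ᶠ[𝓝 x] chartField c k → W =ᶠ[𝓝 x] chartField c l → dirDeriv Z (dirDeriv W f) x =
      fderiv ℝ (fderiv ℝ (f ∘ φ.symm)) y (stdVec k) (stdVec l) := by
    intro Z W k l hZ hW hZk hWl
    have h1 : dirDeriv Z (dirDeriv W f) x =
        dirDeriv (chartField c k) (dirDeriv W f) (φ.symm y) := by
      rw [hxy]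
      unfold dirDeriv
      rw [hZk.self_of_nhds]
    rw [h1, dirDeriv_chartField hy (hW.dirDeriv_smooth hf)]
    have h2 : dirDeriv W f ∘ φ.symm =ᶠ[𝓝 y] fun z => fderiv ℝ (f ∘ φ.symm) z (stdVec l) := by
      have hc : Tendsto φ.symm (𝓝 y) (𝓝 x) := by
        have := (contMDiffAt_chart_symm hy).continuousAt
        rwa [ContinuousAt, hxy] at this
      filter_upwards [hc.eventually hWl, chart_target_mem_nhds hy] with z hz hz'
      rw [← dirDeriv_chartField hz' hf]
      simp only [Function.comp, dirDeriv]
      rw [hz]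
    rw [h2.fderiv_eq]
    have h3 : DifferentiableAt ℝ (fderiv ℝ (f ∘ φ.symm)) y :=
      ((contDiffAt_comp_chart_symm hf hy).fderiv_right (m := 1)
        (by exact (ENat.LEInfty.out : (2 : ℕ∞ω) ≤ ∞))).differentiableAt (by simp)
    rw [fderiv_clm_apply h3 (differentiableAt_const _)]
    simp
  rw [key X Y i j hX hY hXi hYj, key Y X j i hY hX hYj hXi]
  refine ContDiffAt.isSymmSndFDerivAt (n := ∞) (contDiffAt_comp_chart_symm hf hy) ?_ _ _
  simpa using (ENat.LEInfty.out : (2 : ℕ∞ω) ≤ ∞)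

end Charts

/-! ### Linear algebra of alternating three-forms. -/

section Alternating

variable {V : Type*} [AddCommGroup V] [Module ℝ V]

lemma alternating_swap (η : AlternatingMap ℝ V ℝ (Fin 3)) (a b c : V) :
    η ![a, c, b] = - η ![a, b, c] := by
  have h := η.map_swap ![a, b, c] (i := 1) (j := 2) (by decide)
  rw [← h]
  congr 1
  funext j
  fin_cases j <;> rfl

lemma alternating_swap_fst (η : AlternatingMap ℝ V ℝ (Fin 3)) (a b c : V) :
    η ![b, a, c] = - η ![a, b, c] := by
  have h := η.map_swap ![a, b, c] (i := 0) (j := 1) (by decide)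
  rw [← h]
  congr 1
  funext j
  fin_cases j <;> rfl

lemma alternating_rotate (η : AlternatingMap ℝ V ℝ (Fin 3)) (a b c : V) :
    η ![b, c, a] = η ![a, b, c] := by
  rw [alternating_swap, alternating_swap_fst, neg_neg]

lemma alternating_cyclic (η : AlternatingMap ℝ V ℝ (Fin 3)) (e : Fin 3 → V) (i : Fin 3) :
    η ![e i, e (i + 1), e (i + 2)] = η e := by
  have h : e = ![e 0, e 1, e 2] := by
    funext j
    fin_cases j <;> rfl
  conv_rhs => rw [h]
  fin_cases i
  · rfl
  · exact alternating_rotate η (e 0) (e 1) (e 2)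
  · exact (alternating_rotate η (e 2) (e 0) (e 1)).symm

/-- Cramer's rule: the two terms with a repeated vector vanish. Indices are taken modulo 3, so `(i,
i + 1, i + 2)` is always an even permutation of the basis. This formula recovers a vector from its
contraction with the volume form. -/
lemma alternating_sum_fst (η : AlternatingMap ℝ V ℝ (Fin 3)) (e : Fin 3 → V) (a : Fin 3 → ℝ)
    (i : Fin 3) : η ![∑ j, a j • e j, e (i + 1), e (i + 2)] = a i * η e := by
  rw [← alternating_cyclic η e i]
  have hs : (∑ j, a j • e j) = a i • e i + (a (i + 1) • e (i + 1) + a (i + 2) • e (i + 2)) := by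
    fin_cases i <;> simp [Fin.sum_univ_three] <;> abel
  rw [hs, AlternatingMap.map_vecCons_add, AlternatingMap.map_vecCons_add,
    AlternatingMap.map_vecCons_smul, AlternatingMap.map_vecCons_smul,
    AlternatingMap.map_vecCons_smul]
  rw [η.map_eq_zero_of_eq (i := 0) (j := 1) ![e (i + 1), e (i + 1), e (i + 2)] rfl (by decide),
    η.map_eq_zero_of_eq (i := 0) (j := 2) ![e (i + 2), e (i + 1), e (i + 2)] rfl (by decide)]
  simp

/-- Two alternating bilinear forms, one of them the contraction of a three-form, agree when they
agree on the cyclic pairs of a basis. -/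
lemma alternating_contract_ext (η : AlternatingMap ℝ V ℝ (Fin 3)) (b : Module.Basis (Fin 3) ℝ V)
    (w : V) (T : V →ₗ[ℝ] V →ₗ[ℝ] ℝ) (hT : ∀ u v, T u v = - T v u)
    (h : ∀ i, η ![w, b (i + 1), b (i + 2)] = T (b (i + 1)) (b (i + 2))) (u v : V) :
    η ![w, u, v] = T u v := by
  let S : V →ₗ[ℝ] V →ₗ[ℝ] ℝ := LinearMap.mk₂ ℝ (fun u v => η ![w, u, v])
    (fun u u' v => by
      simp only [← alternating_rotate η w]; exact η.map_vecCons_add ![v, w] u u')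
    (fun c u v => by
      simp only [← alternating_rotate η w]; exact η.map_vecCons_smul ![v, w] c u)
    (fun u v v' => by
      rw [alternating_rotate η (v + v') w u, alternating_rotate η v w u,
        alternating_rotate η v' w u]
      exact η.map_vecCons_add ![w, u] v v')
    (fun c u v => by
      rw [alternating_rotate η (c • v) w u, alternating_rotate η v w u]
      exact η.map_vecCons_smul ![w, u] c v)
  have hS : ∀ u v, S u v = - S v u := fun u v => alternating_swap η w v u
  have key : S = T := by
    refine LinearMap.ext_basis b b fun i j => ?_
    have h0 : ∀ u, S u u = 0 := fun u => by have := hS u u; linarith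
    have h1 : ∀ u, T u u = 0 := fun u => by have := hT u u; linarith
    have h2 : ∀ i, S (b (i + 1)) (b (i + 2)) = T (b (i + 1)) (b (i + 2)) := h
    have h3 : ∀ i, S (b (i + 2)) (b (i + 1)) = T (b (i + 2)) (b (i + 1)) := fun i => by
      rw [hS, hT, h2]
    have h20 := h2 0
    have h21 := h2 1
    have h22 := h2 2
    have h30 := h3 0
    have h31 := h3 1
    have h32 := h3 2
    fin_cases i <;> fin_cases j <;> first | (rw [h0, h1]) | assumption
  exact congrArg (fun L => L u v) key

end Alternating

/-! ### Coordinate frames extended to global smooth fields. -/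

section Frames

variable {M : Type*} [TopologicalSpace M] [ChartedSpace E3 M] [IsManifold (𝓡 3) ∞ M]

/-- The coordinate basis of the tangent space. -/
def chartBasis (c : M) {x : M} (hx : x ∈ (extChartAt (𝓡 3) c).source) :
    Module.Basis (Fin 3) ℝ (TangentSpace (𝓡 3) x) :=
  (EuclideanSpace.basisFun (Fin 3) ℝ).toBasis.map
    (isInvertible_mfderiv_extChartAt (I := 𝓡 3) hx).choose.symm.toLinearEquiv

lemma chartBasis_apply {c x : M} (hx : x ∈ (extChartAt (𝓡 3) c).source) (i : Fin 3) :
    chartBasis c hx i = chartField c i x := by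
  have he := (isInvertible_mfderiv_extChartAt (I := 𝓡 3) hx).choose_spec
  set e := (isInvertible_mfderiv_extChartAt (I := 𝓡 3) hx).choose
  have h := mfderiv_chart_chartField hx i
  rw [← he] at h
  have h2 : e (chartField c i x) = stdVec i := h
  have h3 : e.symm (stdVec i) = chartField c i x := by
    rw [← h2]; exact e.symm_apply_apply _
  have h4 : (EuclideanSpace.basisFun (Fin 3) ℝ).toBasis i = stdVec i := by
    simp [stdVec]
  rw [← h3, ← h4]
  exact Module.Basis.map_apply _ _ _

/-- Smoothness is local, so it suffices to have smooth coefficients near each point with respect to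
global smooth fields. -/
lemma smoothField_of_frame {X : VField M}
    (h : ∀ x : M, ∃ (f : Fin 3 → M → ℝ) (E : Fin 3 → VField M),
      (∀ i, ContMDiffAt (𝓡 3) 𝓘(ℝ, ℝ) ∞ (f i) x) ∧ (∀ i, SmoothField (E i)) ∧
      ∀ᶠ y in 𝓝 x, X y = ∑ i, f i y • E i y) : SmoothField X := by
  intro x
  obtain ⟨f, E, hf, hE, hX⟩ := h x
  have h1 : ContMDiffAt (𝓡 3) (𝓡 3).tangent ∞
      (fun y => (⟨y, ∑ i, f i y • E i y⟩ : TangentBundle (𝓡 3) M)) x :=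
    ContMDiffAt.sum_section (t := fun i y => f i y • E i y)
      fun i _ => ContMDiffAt.smul_section (hf i) ((hE i) x)
  refine h1.congr_of_eventuallyEq ?_
  filter_upwards [hX] with y hy
  rw [hy]

/-- `E`, `ξ` are global smooth fields and functions which extend the coordinate fields and the
coordinates of the preferred chart at `c` near the points of `K`. -/
structure IsChartFrame (c : M) (K : Set M) (E : Fin 3 → VField M) (ξ : Fin 3 → M → ℝ) : Prop where
  subset : K ⊆ (extChartAt (𝓡 3) c).source
  smooth : ∀ i, SmoothField (E i)
  smooth_coord : ∀ i, SmoothFun (ξ i)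
  eq : ∀ x ∈ K, ∀ i, E i =ᶠ[𝓝 x] chartField c i
  eq_coord : ∀ x ∈ K, ∀ i, ξ i =ᶠ[𝓝 x] fun y => extChartAt (𝓡 3) c y i

/-- Coordinate fields and coordinates are multiplied by a bump function that is 1 near `K` and has
support inside the chart domain. Global objects are needed because smooth forms and `dForm`
identities are tested on global smooth fields. -/
lemma exists_isChartFrame [CompactSpace M] [T2Space M] {c : M} {K : Set M} (hK : IsClosed K)
    (hKc : K ⊆ (extChartAt (𝓡 3) c).source) : ∃ E ξ, IsChartFrame c K E ξ := by
  have hd : Disjoint ((extChartAt (𝓡 3) c).sourceᶜ) K :=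
    disjoint_left.2 fun x hx hx' => hx (hKc hx')
  obtain ⟨χ, h0, h1, -⟩ := exists_contMDiffMap_zero_one_nhds_of_isClosed (n := ⊤) (𝓡 3)
    (isOpen_extChartAt_source (I := 𝓡 3) c).isClosed_compl hK hd
  have hχ : SmoothFun χ := χ.contMDiff
  have ht : tsupport χ ⊆ (extChartAt (𝓡 3) c).source := by
    intro x hx
    by_contra hxs
    have := (eventually_nhdsSet_iff_forall.1 h0) x hxs
    exact (notMem_tsupport_iff_eventuallyEq.2 this) hx
  have hev : ∀ x ∈ K, ∀ᶠ y in 𝓝 x, χ y = 1 := eventually_nhdsSet_iff_forall.1 h1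
  refine ⟨fun i => (χ : M → ℝ) • chartField c i, fun i y => χ y * extChartAt (𝓡 3) c y i,
    hKc, fun i => ?_, fun i => ?_, fun x hx i => ?_, fun x hx i => ?_⟩
  · exact ContMDiffOn.smul_section_of_tsupport hχ.contMDiffOn
      (isOpen_extChartAt_source (I := 𝓡 3) c) ht
      fun x hx => (chartField_smoothAt hx i).contMDiffWithinAt
  · refine contMDiff_of_tsupport fun x hx => ?_
    have hxs := ht (tsupport_mul_subset_left hx)
    have h2 : ContMDiffAt (𝓡 3) 𝓘(ℝ, E3) ∞ (extChartAt (𝓡 3) c) x :=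
      contMDiffAt_extChartAt' (by simpa using hxs)
    have h3 : ContMDiff 𝓘(ℝ, E3) 𝓘(ℝ, ℝ) ∞ (fun v : E3 => v i) :=
      (EuclideanSpace.proj i : E3 →L[ℝ] ℝ).contDiff.contMDiff
    exact (hχ x).mul (h3.contMDiffAt.comp x h2)
  · filter_upwards [hev x hx] with y hy
    rw [Pi.smul_apply', hy, one_smul]
  · filter_upwards [hev x hx] with y hy
    simp [hy]

lemma exists_isChartFrame_self [CompactSpace M] [T2Space M] (x : M) :
    ∃ E ξ, IsChartFrame x {x} E ξ :=
  exists_isChartFrame isClosed_singleton (by simp)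

namespace IsChartFrame

variable {c : M} {K : Set M} {E : Fin 3 → VField M} {ξ : Fin 3 → M → ℝ}

lemma eventually (h : IsChartFrame c K E ξ) {x : M} (hx : x ∈ K) :
    ∀ᶠ y in 𝓝 x, y ∈ (extChartAt (𝓡 3) c).source ∧ ∀ i, E i y = chartField c i y := by
  have h1 : ∀ᶠ y in 𝓝 x, ∀ i, E i y = chartField c i y :=
    eventually_all.2 fun i => h.eq x hx i
  filter_upwards [h1, (isOpen_extChartAt_source (I := 𝓡 3) c).mem_nhds (h.subset hx)] with y h1 h2
  exact ⟨h2, h1⟩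

lemma bracket_eq_zero (h : IsChartFrame c K E ξ) {x : M} (hx : x ∈ K) (i j : Fin 3) :
    bracket (E i) (E j) x = 0 := by
  rw [← bracket_chartField (h.subset hx) i j]
  exact (h.eq x hx i).mlieBracket_vectorField_eq (h.eq x hx j)

lemma dForm_eq (h : IsChartFrame c K E ξ) {x : M} (hx : x ∈ K) (α : CovField M) (i j : Fin 3) :
    dForm α (E i) (E j) x =
      dirDeriv (E i) (contract α (E j)) x - dirDeriv (E j) (contract α (E i)) x := by
  have : contract α (bracket (E i) (E j)) x = 0 := by
    rw [contract, h.bracket_eq_zero hx, map_zero]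
  rw [dForm, this, sub_zero]

lemma dirDeriv_coord (h : IsChartFrame c K E ξ) {x : M} (hx : x ∈ K) (X : VField M) (j : Fin 3) :
    dirDeriv X (ξ j) x = chartCoord c (X x) j := by
  rw [dirDeriv_congr (h.eq_coord x hx j)]
  have h1 : (fun y => extChartAt (𝓡 3) c y j) =
    (EuclideanSpace.proj j : E3 →L[ℝ] ℝ) ∘ (extChartAt (𝓡 3) c) := rfl
  have h2 : MDifferentiableAt 𝓘(ℝ, E3) 𝓘(ℝ, ℝ) (EuclideanSpace.proj j : E3 →L[ℝ] ℝ)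
     (extChartAt (𝓡 3) c x) :=
    (EuclideanSpace.proj j : E3 →L[ℝ] ℝ).differentiableAt.mdifferentiableAt
  rw [h1, dirDeriv, mvfderiv_comp_apply x h2 (mdiff_chart (h.subset hx)), mvfderiv,
    mfderiv_eq_fderiv, ContinuousLinearMap.fderiv]
  rfl

/-- The coefficients are written as derivatives of the global functions `ξ i`; for smooth `X` they
are then smooth on `M` and can be differentiated again. -/
lemma expand (h : IsChartFrame c K E ξ) {x : M} (hx : x ∈ K) (X : VField M) :
    X x = ∑ i, dirDeriv X (ξ i) x • E i x := by
  simp only [h.dirDeriv_coord hx, (h.eventually hx).self_of_nhds.2]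
  exact eq_sum_chartField (h.subset hx) (X x)

lemma dirDeriv_coord_self (h : IsChartFrame c K E ξ) {x : M} (hx : x ∈ K) (i j : Fin 3) :
    dirDeriv (E i) (ξ j) =ᶠ[𝓝 x] fun _ => if j = i then (1 : ℝ) else 0 := by
  filter_upwards [h.eventually hx, (h.eq_coord x hx j).eventuallyEq_nhds] with y hy hj
  rw [dirDeriv_congr hj]
  have h1 : (fun y => extChartAt (𝓡 3) c y j) =
    (EuclideanSpace.proj j : E3 →L[ℝ] ℝ) ∘ (extChartAt (𝓡 3) c) := rfl
  have h2 : MDifferentiableAt 𝓘(ℝ, E3) 𝓘(ℝ, ℝ) (EuclideanSpace.proj j : E3 →L[ℝ] ℝ)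
     (extChartAt (𝓡 3) c y) :=
    (EuclideanSpace.proj j : E3 →L[ℝ] ℝ).differentiableAt.mdifferentiableAt
  rw [h1, dirDeriv, mvfderiv_comp_apply y h2 (mdiff_chart hy.1), mvfderiv,
    mfderiv_eq_fderiv, ContinuousLinearMap.fderiv, hy.2, mfderiv_chart_chartField hy.1]
  change (stdVec i) j = _
  simp [stdVec]

lemma dirDeriv_comm (h : IsChartFrame c K E ξ) {x : M} (hx : x ∈ K) {f : M → ℝ} (hf : SmoothFun f)
    (i j : Fin 3) : dirDeriv (E i) (dirDeriv (E j) f) x = dirDeriv (E j) (dirDeriv (E i) f) x :=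
  dirDeriv_chartField_comm hf (h.subset hx) (h.smooth i) (h.smooth j) (h.eq x hx i) (h.eq x hx j)

end IsChartFrame

end Frames

/-! ### Pointwise properties of the Riemannian volume form. -/

section Volume

variable {M : Type*} [TopologicalSpace M] [ChartedSpace E3 M] [IsManifold (𝓡 3) ∞ M]
  [Bundle.RiemannianBundle (fun x : M => TangentSpace (𝓡 3) x)]

lemma finrank_tangentSpace (x : M) : Module.finrank ℝ (TangentSpace (𝓡 3) x) = 3 :=
  (finrank_euclideanSpace_fin : Module.finrank ℝ E3 = 3)

/-- An orthonormal basis of a tangent space. -/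
def orthoBasis (x : M) : OrthonormalBasis (Fin 3) ℝ (TangentSpace (𝓡 3) x) :=
  (stdOrthonormalBasis ℝ (TangentSpace (𝓡 3) x)).reindex (finCongr (finrank_tangentSpace x))

namespace IsVolumeForm

variable {μ : TopForm M}

/-- An alternating three-form that vanishes on one basis is zero, but `μ` is `±1` on an orthonormal
basis. -/
lemma ne_zero (hμ : IsVolumeForm μ) {x : M} (b : Module.Basis (Fin 3) ℝ (TangentSpace (𝓡 3) x)) :
    μ x b ≠ 0 := by
  intro h
  have h1 := hμ.unit x (orthoBasis x) (orthoBasis x).orthonormal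
  rw [(μ x).eq_smul_basis_det b, h] at h1
  simp at h1

lemma ne_zero_chartField (hμ : IsVolumeForm μ) {c x : M}
    (hx : x ∈ (extChartAt (𝓡 3) c).source) : μ x (fun i => chartField c i x) ≠ 0 := by
  have h := hμ.ne_zero (chartBasis c hx)
  have h2 : (fun i => chartField c i x) = chartBasis c hx := by
    funext i; rw [chartBasis_apply]
  rw [h2]
  exact h

/-- Up to sign `μ` is the determinant in an orthonormal basis, so this is Hadamard's inequality. -/
lemma abs_le (hμ : IsVolumeForm μ) (x : M) (a b c : TangentSpace (𝓡 3) x) :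
    |μ x ![a, b, c]| ≤ ‖a‖ * ‖b‖ * ‖c‖ := by
  have : Fact (Module.finrank ℝ (TangentSpace (𝓡 3) x) = 3) := ⟨finrank_tangentSpace x⟩
  set o := (orthoBasis x).toBasis.orientation
  have h1 := hμ.unit x (orthoBasis x) (orthoBasis x).orthonormal
  have h2 := o.volumeForm_robust' (orthoBasis x) ![a, b, c]
  have h3 := o.abs_volumeForm_apply_le ![a, b, c]
  rw [(μ x).eq_smul_basis_det (orthoBasis x).toBasis]
  simp only [OrthonormalBasis.coe_toBasis, AlternatingMap.smul_apply, smul_eq_mul, abs_mul, h1,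
    one_mul]
  rw [← h2]
  simpa [Fin.prod_univ_three] using h3

/-- A vector is determined by its contraction with the volume form. -/
lemma eq_zero_of_contract (hμ : IsVolumeForm μ) {x : M}
    (b : Module.Basis (Fin 3) ℝ (TangentSpace (𝓡 3) x))
    {w : TangentSpace (𝓡 3) x} (h : ∀ i, μ x ![w, b (i + 1), b (i + 2)] = 0) : w = 0 := by
  rw [← b.sum_repr w]
  refine Finset.sum_eq_zero fun i _ => ?_
  have h1 := h i
  rw [← b.sum_repr w] at h1
  have h2 := alternating_sum_fst (μ x) b (b.repr w) i
  rw [h2] at h1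
  rw [(mul_eq_zero.1 h1).resolve_right (hμ.ne_zero b), zero_smul]

end IsVolumeForm

lemma IsChartFrame.vol_ne_zero {μ : TopForm M} (hμ : IsVolumeForm μ) {c : M} {K : Set M}
    {E : Fin 3 → VField M} {ξ : Fin 3 → M → ℝ} (h : IsChartFrame c K E ξ) {x : M} (hx : x ∈ K) :
    μ x (fun i => E i x) ≠ 0 := by
  have h1 := (h.eventually hx).self_of_nhds
  simp only [h1.2]
  exact hμ.ne_zero_chartField h1.1

end Volume

/-! ### Musical isomorphisms, the exterior derivative via the Levi-Civita connection, existence of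
the curl. -/

section Musical

variable {M : Type*} [TopologicalSpace M] [ChartedSpace E3 M] [IsManifold (𝓡 3) ∞ M]
  [Bundle.RiemannianBundle (fun x : M => TangentSpace (𝓡 3) x)]
  [IsContMDiffRiemannianBundle (𝓡 3) ∞ E3 (fun x : M => TangentSpace (𝓡 3) x)]

lemma SmoothField.inner_smooth {v w : VField M} (hv : SmoothField v) (hw : SmoothField w) :
    SmoothFun (fun x => inner ℝ (v x) (w x)) :=
  ContMDiff.inner_bundle (b := id) hv hw

lemma SmoothField.flat_mem {v : VField M} (hv : SmoothField v) : flat v ∈ SmoothForms M :=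
  fun _ hX => hv.inner_smooth hX

lemma contMDiffAt_det {n : ℕ} {A : M → Matrix (Fin n) (Fin n) ℝ} {x : M}
    (hA : ∀ i j, ContMDiffAt (𝓡 3) 𝓘(ℝ, ℝ) ∞ (fun y => A y i j) x) :
    ContMDiffAt (𝓡 3) 𝓘(ℝ, ℝ) ∞ (fun y => (A y).det) x := by
  simp only [Matrix.det_apply']
  refine ContMDiffAt.sum fun σ _ => contMDiffAt_const.mul ?_
  exact contMDiffAt_finsetProd fun i _ => hA _ _

lemma contMDiffAt_inv {n : ℕ} {A : M → Matrix (Fin n) (Fin n) ℝ} {x : M}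
    (hA : ∀ i j, ContMDiffAt (𝓡 3) 𝓘(ℝ, ℝ) ∞ (fun y => A y i j) x) (h0 : (A x).det ≠ 0)
    (i j : Fin n) : ContMDiffAt (𝓡 3) 𝓘(ℝ, ℝ) ∞ (fun y => (A y)⁻¹ i j) x := by
  simp only [Matrix.inv_def, Matrix.smul_apply, Matrix.adjugate_apply, smul_eq_mul,
    Ring.inverse_eq_inv']
  refine ContMDiffAt.mul ((contMDiffAt_det hA).inv₀ h0) (contMDiffAt_det fun k l => ?_)
  by_cases hk : k = j
  · simp only [Matrix.updateRow_apply, hk, if_true]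
    exact contMDiffAt_const
  · simp only [Matrix.updateRow_apply, hk, if_false]
    exact hA k l

/-- The dual vector exists pointwise; the issue is its smoothness. In a coordinate frame its
components are the inverse Gram matrix applied to the components of `α`, and the inverse is smooth
by the adjugate formula. -/
lemma exists_flat_eq [CompactSpace M] [T2Space M] {α : CovField M} (hα : α ∈ SmoothForms M) :
    ∃ v, SmoothField v ∧ flat v = α := by
  have hsharp : ∀ x w, inner ℝ (sharp (α x)) w = α x w := fun x w =>
    InnerProductSpace.toDual_symm_apply
  refine ⟨fun x => sharp (α x), ?_, ?_⟩
  swap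
  · funext x
    ext w
    exact hsharp x w
  refine smoothField_of_frame fun x => ?_
  obtain ⟨E, ξ, hE⟩ := exists_isChartFrame_self x
  let G : M → Matrix (Fin 3) (Fin 3) ℝ := fun y => Matrix.of fun i j => inner ℝ (E i y) (E j y)
  have hG : ∀ i j, SmoothFun (fun y => G y i j) := fun i j =>
    (hE.smooth i).inner_smooth (hE.smooth j)
  have hdet : ∀ᶠ y in 𝓝 x, (∃ b : Module.Basis (Fin 3) ℝ (TangentSpace (𝓡 3) y), ∀ i, b i = E i y) ∧
      (G y).det ≠ 0 := by
    filter_upwards [hE.eventually (mem_singleton x)] with y hy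
    have hb : ∃ b : Module.Basis (Fin 3) ℝ (TangentSpace (𝓡 3) y), ∀ i, b i = E i y :=
      ⟨chartBasis x hy.1, fun i => by rw [chartBasis_apply, hy.2]⟩
    refine ⟨hb, fun h0 => ?_⟩
    obtain ⟨b, hb⟩ := hb
    -- A kernel vector of the Gram matrix gives a combination of the frame orthogonal to every frame
    -- vector, hence to itself.
    obtain ⟨a, ha, ha0⟩ := Matrix.exists_mulVec_eq_zero_iff.2 h0
    set u : TangentSpace (𝓡 3) y := ∑ j, a j • E j y with hu
    have h1 : ∀ i, inner ℝ (E i y) u = 0 := fun i => by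
      have := congrFun ha0 i
      simp only [Matrix.mulVec, dotProduct, G, Matrix.of_apply, Pi.zero_apply] at this
      rw [hu, inner_sum, ← this]
      refine Finset.sum_congr rfl fun j _ => ?_
      rw [inner_smul_right, mul_comm]
    have h2 : inner ℝ u u = (0 : ℝ) := by
      conv_lhs => rw [hu, sum_inner]
      refine Finset.sum_eq_zero fun i _ => ?_
      rw [inner_smul_left, ← hu, h1, mul_zero]
    have h3 : u = 0 := inner_self_eq_zero.1 h2
    have h4 : ∑ j, a j • b j = 0 := by simp only [hb]; exact h3
    exact ha (funext fun i => (Fintype.linearIndependent_iff.1 b.linearIndependent) a h4 i)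
  refine ⟨fun i y => ∑ j, (G y)⁻¹ i j * α y (E j y), E, fun i => ?_, hE.smooth, ?_⟩
  · refine ContMDiffAt.sum fun j _ => ContMDiffAt.mul ?_ (hα _ (hE.smooth j) x)
    exact contMDiffAt_inv (fun i j => hG i j x) hdet.self_of_nhds.2 i j
  · filter_upwards [hdet] with y hy
    obtain ⟨⟨b, hb⟩, hdet⟩ := hy
    have hw : ∀ k, inner ℝ (E k y) (∑ i, (∑ j, (G y)⁻¹ i j * α y (E j y)) • E i y) =
        α y (E k y) := fun k => by
      have h1 : G y * (G y)⁻¹ = 1 := Matrix.mul_nonsing_inv _ (isUnit_iff_ne_zero.2 hdet)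
      have h2 : (G y).mulVec ((G y)⁻¹.mulVec fun j => α y (E j y)) k = α y (E k y) := by
        rw [Matrix.mulVec_mulVec, h1, Matrix.one_mulVec]
      rw [← h2, inner_sum]
      refine (Finset.sum_congr rfl fun i _ => ?_ : _ = ∑ i, G y k i *
        (∑ j, (G y)⁻¹ i j * α y (E j y)))
      rw [inner_smul_right, mul_comm]
      rfl
    refine ext_inner_left ℝ fun u => ?_
    rw [← b.sum_repr u, sum_inner, sum_inner]
    refine Finset.sum_congr rfl fun k _ => ?_
    rw [inner_smul_left, inner_smul_left, hb, hw, real_inner_comm, hsharp]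

/-- The value of `d(v^♭)` in terms of the Levi-Civita connection. -/
lemma IsLeviCivita.dForm_flat
    {D : CovariantDerivative (𝓡 3) E3 (fun x : M => TangentSpace (𝓡 3) x)} (hD : IsLeviCivita D)
    {v X Y : VField M} (hv : SmoothField v) (hX : SmoothField X) (hY : SmoothField Y) (x : M) :
    dForm (flat v) X Y x = inner ℝ (D v x (X x)) (Y x) - inner ℝ (D v x (Y x)) (X x) := by
  have h1 : dirDeriv X (contract (flat v) Y) x = inner ℝ (D v x (X x)) (Y x) +
      inner ℝ (v x) (D Y x (X x)) := hD.2.mvfderiv_inner_eq X (hv.mdiff x) (hY.mdiff x)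
  have h2 : dirDeriv Y (contract (flat v) X) x = inner ℝ (D v x (Y x)) (X x) +
      inner ℝ (v x) (D X x (Y x)) := hD.2.mvfderiv_inner_eq Y (hv.mdiff x) (hX.mdiff x)
  have h3 : D Y x (X x) - D X x (Y x) = bracket X Y x :=
    D.torsion_eq_zero_iff.1 hD.1 (hX.mdiff x) (hY.mdiff x)
  have h4 : contract (flat v) (bracket X Y) x =
      inner ℝ (v x) (D Y x (X x)) - inner ℝ (v x) (D X x (Y x)) := by
    rw [← inner_sub_right, h3]
    rfl
  rw [dForm, h1, h2, h4]
  ring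

/-- The exterior derivative of a smooth one-form is tensorial. -/
lemma IsLeviCivita.exists_tensor [CompactSpace M] [T2Space M]
    {D : CovariantDerivative (𝓡 3) E3 (fun x : M => TangentSpace (𝓡 3) x)} (hD : IsLeviCivita D)
    {α : CovField M} (hα : α ∈ SmoothForms M) (x : M) :
    ∃ T : TangentSpace (𝓡 3) x →ₗ[ℝ] TangentSpace (𝓡 3) x →ₗ[ℝ] ℝ, (∀ u v, T u v = - T v u) ∧
      ∀ X Y, SmoothField X → SmoothField Y → dForm α X Y x = T (X x) (Y x) := by
  -- With `α = v^♭`, the value is `⟨D_X v, Y⟩ - ⟨D_Y v, X⟩`, which visibly depends only on `X x` and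
  -- `Y x`.
  obtain ⟨v, hv, rfl⟩ := exists_flat_eq hα
  refine ⟨LinearMap.mk₂ ℝ (fun a b => inner ℝ (D v x a) b - inner ℝ (D v x b) a)
    (fun a a' b => ?_) (fun r a b => ?_) (fun a b b' => ?_) (fun r a b => ?_),
    fun a b => (neg_sub _ _).symm, fun X Y hX hY => hD.dForm_flat hv hX hY x⟩ <;>
  simp only [map_add, map_smul, inner_add_left, inner_add_right, inner_smul_left,
    inner_smul_right, smul_eq_mul, conj_trivial] <;> ring

variable [CompactSpace M] [T2Space M]

/-- The second exterior derivative vanishes on functions. -/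
lemma IsLeviCivita.dForm_mvfderiv
    {D : CovariantDerivative (𝓡 3) E3 (fun x : M => TangentSpace (𝓡 3) x)} (hD : IsLeviCivita D)
    {f : M → ℝ} (hf : SmoothFun f) {X Y : VField M} (hX : SmoothField X) (hY : SmoothField Y)
    (x : M) : dForm (mvfderiv (𝓡 3) f) X Y x = 0 := by
  have hα : (mvfderiv (𝓡 3) f : CovField M) ∈ SmoothForms M := fun Z hZ => hZ.dirDeriv_smooth hf
  obtain ⟨E, ξ, hE⟩ := exists_isChartFrame_self x
  obtain ⟨T, hT, hTd⟩ := hD.exists_tensor hα x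
  have hb := (hE.eventually (mem_singleton x)).self_of_nhds
  -- By tensoriality it is enough to test coordinate fields, whose brackets vanish and whose
  -- derivatives commute.
  have h0 : T = 0 := by
    refine LinearMap.ext_basis (chartBasis x hb.1) (chartBasis x hb.1) fun i j => ?_
    rw [chartBasis_apply, chartBasis_apply, ← hb.2, ← hb.2, ← hTd _ _ (hE.smooth i) (hE.smooth j),
      hE.dForm_eq (mem_singleton x)]
    exact sub_eq_zero.2 (hE.dirDeriv_comm (mem_singleton x) hf i j)
  rw [hTd X Y hX hY, h0]
  rfl

/-- `bracket` is not defined as a commutator of derivations; the commutator formula is `d(df) = 0`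
written out. -/
lemma IsLeviCivita.dirDeriv_bracket
    {D : CovariantDerivative (𝓡 3) E3 (fun x : M => TangentSpace (𝓡 3) x)} (hD : IsLeviCivita D)
    {f : M → ℝ} (hf : SmoothFun f) {X Y : VField M} (hX : SmoothField X) (hY : SmoothField Y)
    (x : M) : dirDeriv (bracket X Y) f x =
      dirDeriv X (dirDeriv Y f) x - dirDeriv Y (dirDeriv X f) x :=
  (sub_eq_zero.1 (hD.dForm_mvfderiv hf hX hY x)).symm

lemma IsVolumeForm.smooth_frame {μ : TopForm M} (hμ : IsVolumeForm μ) {E : Fin 3 → VField M}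
    (hE : ∀ i, SmoothField (E i)) : SmoothFun (fun x => μ x (fun i => E i x)) := by
  have h : (fun x => μ x (fun i => E i x)) = fun x => μ x ![E 0 x, E 1 x, E 2 x] := by
    funext x
    congr 1
    funext j
    fin_cases j <;> rfl
  rw [h]
  exact hμ.smooth _ _ _ (hE 0) (hE 1) (hE 2)

lemma SmoothForms.dForm_smooth {α : CovField M} (hα : α ∈ SmoothForms M) {X Y : VField M}
    (hX : SmoothField X) (hY : SmoothField Y) : SmoothFun (dForm α X Y) :=
  ((hX.dirDeriv_smooth (hα Y hY)).sub (hY.dirDeriv_smooth (hα X hX))).sub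
    (hα _ (hX.bracket_smooth hY))

/-- Every smooth one-form has a curl. -/
lemma IsLeviCivita.exists_contractsTo {μ : TopForm M} (hμ : IsVolumeForm μ)
    {D : CovariantDerivative (𝓡 3) E3 (fun x : M => TangentSpace (𝓡 3) x)} (hD : IsLeviCivita D)
    {α : CovField M} (hα : α ∈ SmoothForms M) :
    ∃ w, SmoothField w ∧ ContractsTo μ w α := by
  have hloc : ∀ x, ∃ w : TangentSpace (𝓡 3) x, ∀ X Y, SmoothField X → SmoothField Y →
      μ x ![w, X x, Y x] = dForm α X Y x := by
    intro x
    obtain ⟨T, hT, hTd⟩ := hD.exists_tensor hα x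
    let b := chartBasis x (mem_extChartAt_source (I := 𝓡 3) x)
    -- For a combination `∑ aᵢ bᵢ`, inserting `b (i + 1)` and `b (i + 2)` yields `aᵢ μ(b)`, which
    -- forces these coefficients.
    refine ⟨∑ i, (T (b (i + 1)) (b (i + 2)) / μ x b) • b i, fun X Y hX hY => ?_⟩
    rw [hTd X Y hX hY]
    refine alternating_contract_ext (μ x) b _ T hT (fun i => ?_) _ _
    rw [alternating_sum_fst (μ x) b, div_mul_cancel₀ _ (hμ.ne_zero b)]
  choose w hw using hloc
  refine ⟨w, smoothField_of_frame fun x => ?_, fun X Y hX hY x => hw x X Y hX hY⟩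
  obtain ⟨E, ξ, hE⟩ := exists_isChartFrame_self x
  -- The same coefficients, now computed in a global frame, show that the pointwise choice `w` is
  -- smooth.
  refine ⟨fun i y => dForm α (E (i + 1)) (E (i + 2)) y * (μ y (fun i => E i y))⁻¹, E,
    fun i => ?_, hE.smooth, ?_⟩
  · exact ((SmoothForms.dForm_smooth hα (hE.smooth _) (hE.smooth _)) x).mul
      (((hμ.smooth_frame hE.smooth) x).inv₀ (hE.vol_ne_zero hμ (mem_singleton x)))
  · filter_upwards [hE.eventually (mem_singleton x)] with y hy
    have hb : (fun i => E i y) = chartBasis x hy.1 := by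
      funext i
      rw [chartBasis_apply, hy.2]
    have hb' : ∀ i, E i y = chartBasis x hy.1 i := fun i => congrFun hb i
    have h0 := hμ.ne_zero (chartBasis x hy.1)
    rw [← (chartBasis x hy.1).sum_repr (w y)]
    refine Finset.sum_congr rfl fun i _ => ?_
    rw [← hw y _ _ (hE.smooth _) (hE.smooth _), hb]
    simp only [hb']
    have h2 := alternating_sum_fst (μ y) (chartBasis x hy.1) ((chartBasis x hy.1).repr (w y)) i
    rw [(chartBasis x hy.1).sum_repr] at h2
    rw [h2, mul_inv_cancel_right₀ h0]

lemma IsVolumeForm.contractsTo_unique {μ : TopForm M} (hμ : IsVolumeForm μ) {w w' : VField M}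
    {α : CovField M} (h : ContractsTo μ w α) (h' : ContractsTo μ w' α) : w = w' := by
  funext x
  obtain ⟨E, ξ, hE⟩ := exists_isChartFrame_self x
  have hb := (hE.eventually (mem_singleton x)).self_of_nhds
  refine sub_eq_zero.1 (hμ.eq_zero_of_contract (chartBasis x hb.1) fun i => ?_)
  have h1 := h _ _ (hE.smooth (i + 1)) (hE.smooth (i + 2)) x
  rw [← h' _ _ (hE.smooth (i + 1)) (hE.smooth (i + 2)) x] at h1
  rw [chartBasis_apply, chartBasis_apply, ← hb.2, ← hb.2]
  have h2 := (μ x).map_vecCons_add ![E (i + 1) x, E (i + 2) x] (w x - w' x) (w' x)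
  rw [sub_add_cancel] at h2
  exact (add_eq_right.1 (h2.symm.trans h1))

end Musical

/-! ### Change of variables between charts. -/

section ChangeOfVariables

variable {M : Type*} [TopologicalSpace M] [ChartedSpace E3 M] [IsManifold (𝓡 3) ∞ M]

/-- The standard basis of `ℝ³`. -/
def stdBasis : Module.Basis (Fin 3) ℝ E3 := (EuclideanSpace.basisFun (Fin 3) ℝ).toBasis

lemma stdBasis_apply (i : Fin 3) : stdBasis i = stdVec i := by simp [stdBasis, stdVec]

lemma alternating_comp_det {V : Type*} [AddCommGroup V] [Module ℝ V]
    (η : AlternatingMap ℝ V ℝ (Fin 3)) (A : E3 →ₗ[ℝ] V) (L : E3 →ₗ[ℝ] E3) :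
    η (fun j => A (L (stdVec j))) = LinearMap.det L * η (fun j => A (stdVec j)) := by
  have h1 := (η.compLinearMap A).eq_smul_basis_det stdBasis
  have h2 : η (fun j => A (L (stdVec j))) = η.compLinearMap A (L ∘ stdBasis) := by
    simp only [AlternatingMap.compLinearMap_apply, Function.comp, stdBasis_apply]
  have h3 : η (fun j => A (stdVec j)) = η.compLinearMap A stdBasis := by
    simp only [AlternatingMap.compLinearMap_apply, stdBasis_apply]
  rw [h2, h3]
  rw [h1]
  simp only [AlternatingMap.smul_apply, Module.Basis.det_comp, smul_eq_mul]
  ring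

lemma density_eq (μ : TopForm M) {c : M} {y : E3} (hy : y ∈ (extChartAt (𝓡 3) c).target) :
    density μ c y = |μ ((extChartAt (𝓡 3) c).symm y)
      (fun j => chartField c j ((extChartAt (𝓡 3) c).symm y))| := by
  simp only [chartField_symm hy]
  rfl

lemma density_chart (μ : TopForm M) {c x : M} (hx : x ∈ (extChartAt (𝓡 3) c).source) :
    density μ c (extChartAt (𝓡 3) c x) = |μ x (fun j => chartField c j x)| := by
  rw [density_eq μ ((extChartAt (𝓡 3) c).map_source hx), (extChartAt (𝓡 3) c).left_inv hx]

/-- The integral of a function in one chart. -/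
def chartInt (μ : TopForm M) (c : M) (f : M → ℝ) : ℝ :=
  ∫ y in (extChartAt (𝓡 3) c).target, f ((extChartAt (𝓡 3) c).symm y) * density μ c y

/-- Change of variables: integrals in charts are compatible with volume-preserving
diffeomorphisms. -/
lemma chartInt_comp {μ : TopForm M} (φ : SDiff μ) {c c' : M} {f : M → ℝ}
    (h : ∀ x ∉ (extChartAt (𝓡 3) c).source, f (φ.1 x) = 0)
    (h' : ∀ x ∉ (extChartAt (𝓡 3) c').source, f x = 0) :
    chartInt μ c (f ∘ φ.1) = chartInt μ c' f := by
  set s := extChartAt (𝓡 3) c with hs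
  set s' := extChartAt (𝓡 3) c' with hs'
  have hφ := SDiff.isDiffeo φ
  have hφc : Continuous φ.1 := hφ.1.continuous
  -- The points of the first chart that `φ` sends into the second; both integrands vanish off `S`
  -- and off its image under `Ψ`, which is `φ` in coordinates.
  set S : Set E3 := s.target ∩ s.symm ⁻¹' (φ.1 ⁻¹' s'.source) with hS
  have hSo : IsOpen S := (continuousOn_extChartAt_symm c).isOpen_inter_preimage
    (isOpen_chart_target c) ((isOpen_extChartAt_source c').preimage hφc)
  set Ψ : E3 → E3 := fun y => s' (φ.1 (s.symm y)) with hΨ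
  let Ψ' : E3 → (E3 →L[ℝ] E3) := fun y =>
    (mfderiv (𝓡 3) 𝓘(ℝ, E3) s' (φ.1 (s.symm y))).comp
      ((mfderiv (𝓡 3) (𝓡 3) φ.1 (s.symm y)).comp (mfderiv 𝓘(ℝ, E3) (𝓡 3) s.symm y))
  have hd : ∀ y ∈ S, HasFDerivWithinAt Ψ (Ψ' y) S y := by
    intro y hy
    have h1 := (mdiff_chart_symm hy.1).hasMFDerivAt
    have h2 := (hφ.mdiff (s.symm y)).hasMFDerivAt
    have h3 := (mdiff_chart (c := c') (x := φ.1 (s.symm y)) hy.2).hasMFDerivAt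
    have h4 := (h3.comp y (h2.comp y h1)).hasFDerivAt
    exact h4.hasFDerivWithinAt
  have hinj : InjOn Ψ S := by
    intro y hy z hz hyz
    have h1 : φ.1 (s.symm y) = φ.1 (s.symm z) := s'.injOn hy.2 hz.2 hyz
    exact s.symm.injOn hy.1 hz.1 (φ.1.injective h1)
  -- Volume preservation read in coordinates: the densities differ by the Jacobian of `Ψ`.
  have hdens : ∀ y ∈ S, density μ c y = |(Ψ' y).det| * density μ c' (Ψ y) := by
    intro y hy
    have hx' : φ.1 (s.symm y) ∈ s'.source := hy.2
    rw [hΨ, density_chart μ hx', density_eq μ hy.1]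
    let A : E3 →L[ℝ] TangentSpace (𝓡 3) (φ.1 (s.symm y)) :=
      (mfderiv 𝓘(ℝ, E3) (𝓡 3) s'.symm (s' (φ.1 (s.symm y))) : E3 →L[ℝ] E3)
    have hA : ∀ i, A (stdVec i) = chartField c' i (φ.1 (s.symm y)) := fun i =>
      (chartField_eq hx' i).symm
    have hAΨ : ∀ i, A (Ψ' y (stdVec i)) =
        mfderiv (𝓡 3) (𝓡 3) φ.1 (s.symm y) (chartField c i (s.symm y)) := fun i => by
      rw [chartField_symm hy.1]
      exact mfderiv_symm_comp_chart hx' _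
    have h1 := alternating_comp_det (μ (φ.1 (s.symm y))) A.toLinearMap (Ψ' y).toLinearMap
    simp only [ContinuousLinearMap.coe_coe, hA, hAΨ] at h1
    have h2 := φ.2.2 (s.symm y) (fun j => chartField c j (s.symm y))
    rw [← h2, h1, abs_mul]
  have e1 : chartInt μ c (f ∘ φ.1) = ∫ y in S, f (φ.1 (s.symm y)) * density μ c y := by
    refine setIntegral_eq_of_subset_of_forall_sdiff_eq_zero (isOpen_chart_target c).measurableSet
      inter_subset_left fun y hy => ?_
    have : f (φ.1 (s.symm y)) = 0 := h' _ fun hx => hy.2 ⟨hy.1, hx⟩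
    simp only [Function.comp, ← hs, this, zero_mul]
  have e2 : chartInt μ c' f = ∫ y in Ψ '' S, f (s'.symm y) * density μ c' y := by
    refine setIntegral_eq_of_subset_of_forall_sdiff_eq_zero (isOpen_chart_target c').measurableSet
      ?_ fun y hy => ?_
    · rintro _ ⟨y, hy, rfl⟩
      exact s'.map_source hy.2
    · have : f (s'.symm y) = 0 := by
        by_contra hne
        refine hy.2 ⟨s (φ.1.symm (s'.symm y)), ?_, ?_⟩
        · have hx : φ.1.symm (s'.symm y) ∈ s.source := by
            by_contra hx
            exact hne (by simpa using h _ hx)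
          refine ⟨s.map_source hx, ?_⟩
          rw [mem_preimage, mem_preimage, s.left_inv hx, Equiv.apply_symm_apply]
          exact s'.map_target hy.1
        · have hx : φ.1.symm (s'.symm y) ∈ s.source := by
            by_contra hx
            exact hne (by simpa using h _ hx)
          simp only [hΨ]
          rw [s.left_inv hx, Equiv.apply_symm_apply, s'.right_inv hy.1]
      rw [this, zero_mul]
  rw [e1, e2, integral_image_eq_integral_abs_det_fderiv_smul volume hSo.measurableSet hd hinj]
  refine setIntegral_congr_fun hSo.measurableSet fun y hy => ?_
  simp only [smul_eq_mul, hΨ]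
  rw [hdens y hy, s'.left_inv hy.2]
  ring

end ChangeOfVariables

/-! ### The partition of unity as a finite sum. -/

section Partition

variable {M : Type*} [TopologicalSpace M] [ChartedSpace E3 M] [IsManifold (𝓡 3) ∞ M]
  [CompactSpace M] [T2Space M]

lemma partition_finite :
    {c : M | (Function.support (partition M c)).Nonempty}.Finite :=
  (partition M).locallyFinite.finite_nonempty_of_compact

lemma tsupport_partition (c : M) : tsupport (partition M c) ⊆ (extChartAt (𝓡 3) c).source := by
  rw [extChartAt_source]
  exact (SmoothPartitionOfUnity.exists_isSubordinate_chartAt_source (𝓡 3) M).choose_spec c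

lemma partition_smooth (c : M) : SmoothFun (partition M c) := (partition M c).contMDiff

variable (M) in
/-- The charts which meet the support of the partition of unity. -/
def chartSet : Finset M :=
  (partition_finite (M := M)).toFinset

lemma partition_eq_zero {c : M} (hc : c ∉ chartSet M) (x : M) : partition M c x = 0 := by
  by_contra h
  exact hc ((partition_finite (M := M)).mem_toFinset.2 ⟨x, h⟩)

lemma sum_partition (x : M) : ∑ c ∈ chartSet M, partition M c x = 1 := by
  rw [← (partition M).sum_eq_one (mem_univ x)]
  refine (finsum_eq_sum_of_support_subset _ fun c hc => ?_).symm
  by_contra h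
  exact hc (partition_eq_zero h x)

lemma integral_eq_sum (μ : TopForm M) (f : M → ℝ) :
    integral μ f = ∑ c ∈ chartSet M, chartInt μ c (fun x => partition M c x * f x) := by
  refine finsum_eq_sum_of_support_subset _ fun c hc => ?_
  by_contra h
  refine hc ?_
  simp only [partition_eq_zero h, zero_mul]
  exact integral_zero _ _

end Partition

/-! ### Linearity, invariance and positivity of the integral. -/

section Integration

variable {M : Type*} [TopologicalSpace M] [ChartedSpace E3 M] [IsManifold (𝓡 3) ∞ M]
  [CompactSpace M] [T2Space M]
  [Bundle.RiemannianBundle (fun x : M => TangentSpace (𝓡 3) x)]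

/-- The coefficient of `μ` in the preferred chart at `c`. -/
def chartCoeff (μ : TopForm M) (c : M) (y : E3) : ℝ :=
  μ ((extChartAt (𝓡 3) c).symm y) (fun j => chartField c j ((extChartAt (𝓡 3) c).symm y))

section

variable {μ : TopForm M}

lemma chartCoeff_eventuallyEq {c : M} {K : Set M} {E : Fin 3 → VField M} {ξ : Fin 3 → M → ℝ}
    (hE : IsChartFrame c K E ξ) {y : E3} (hy : y ∈ (extChartAt (𝓡 3) c).target)
    (hyK : (extChartAt (𝓡 3) c).symm y ∈ K) :
    chartCoeff μ c =ᶠ[𝓝 y] (fun x => μ x (fun i => E i x)) ∘ (extChartAt (𝓡 3) c).symm := by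
  have hc := (contMDiffAt_chart_symm hy).continuousAt
  filter_upwards [hc.eventually (hE.eventually hyK)] with z hz
  simp only [chartCoeff, Function.comp, hz.2]

lemma IsVolumeForm.continuousAt_chartCoeff
    [IsContMDiffRiemannianBundle (𝓡 3) ∞ E3 (fun x : M => TangentSpace (𝓡 3) x)]
    (hμ : IsVolumeForm μ) {c : M} {y : E3}
    (hy : y ∈ (extChartAt (𝓡 3) c).target) : ContinuousAt (chartCoeff μ c) y := by
  obtain ⟨E, ξ, hE⟩ := exists_isChartFrame (c := c) (K := {(extChartAt (𝓡 3) c).symm y})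
    isClosed_singleton (singleton_subset_iff.2 ((extChartAt (𝓡 3) c).map_target hy))
  have h := contDiffAt_comp_chart_symm (hμ.smooth_frame hE.smooth) hy
  exact h.continuousAt.congr (chartCoeff_eventuallyEq hE hy rfl).symm

lemma density_eq_abs {c : M} {y : E3} (hy : y ∈ (extChartAt (𝓡 3) c).target) :
    density μ c y = |chartCoeff μ c y| := density_eq μ hy

lemma IsVolumeForm.chartCoeff_ne_zero (hμ : IsVolumeForm μ) {c : M} {y : E3}
    (hy : y ∈ (extChartAt (𝓡 3) c).target) : chartCoeff μ c y ≠ 0 :=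
  hμ.ne_zero_chartField ((extChartAt (𝓡 3) c).map_target hy)

variable [IsContMDiffRiemannianBundle (𝓡 3) ∞ E3 (fun x : M => TangentSpace (𝓡 3) x)]

lemma IsVolumeForm.continuousOn_density (hμ : IsVolumeForm μ) (c : M) :
    ContinuousOn (density μ c) (extChartAt (𝓡 3) c).target := by
  have h : ContinuousOn (fun y => |chartCoeff μ c y|) (extChartAt (𝓡 3) c).target := fun y hy =>
    (hμ.continuousAt_chartCoeff hy).abs.continuousWithinAt
  exact h.congr fun y hy => density_eq_abs hy

lemma isCompact_chart_image {c : M} {K : Set M} (hK : IsClosed K)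
    (hKc : K ⊆ (extChartAt (𝓡 3) c).source) : IsCompact (extChartAt (𝓡 3) c '' K) :=
  hK.isCompact.image_of_continuousOn ((continuousOn_extChartAt c).mono hKc)

lemma IsVolumeForm.integrableOn_chart (hμ : IsVolumeForm μ) {c : M} {f : M → ℝ}
    (hf : Continuous f) (hfc : tsupport f ⊆ (extChartAt (𝓡 3) c).source) :
    IntegrableOn (fun y => f ((extChartAt (𝓡 3) c).symm y) * density μ c y)
      (extChartAt (𝓡 3) c).target := by
  have hK := isCompact_chart_image (isClosed_tsupport f) hfc
  have hsub : extChartAt (𝓡 3) c '' tsupport f ⊆ (extChartAt (𝓡 3) c).target := by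
    rintro _ ⟨x, hx, rfl⟩
    exact (extChartAt (𝓡 3) c).map_source (hfc hx)
  have hc : ContinuousOn (fun y => f ((extChartAt (𝓡 3) c).symm y) * density μ c y)
      (extChartAt (𝓡 3) c).target :=
    (hf.comp_continuousOn (continuousOn_extChartAt_symm c)).mul (hμ.continuousOn_density c)
  refine IntegrableOn.of_forall_sdiff_eq_zero ((hc.mono hsub).integrableOn_compact hK)
    (isOpen_chart_target c).measurableSet fun y hy => ?_
  have : f ((extChartAt (𝓡 3) c).symm y) = 0 := by
    by_contra hne
    exact hy.2 ⟨_, subset_tsupport f hne, (extChartAt (𝓡 3) c).right_inv hy.1⟩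
  rw [this, zero_mul]

/-- Integration against a volume form is integration against a finite measure. -/
lemma IsVolumeForm.exists_measure (hμ : IsVolumeForm μ) [MeasurableSpace M] [BorelSpace M] :
    ∃ ν : Measure M, IsFiniteMeasure ν ∧ ∀ f : M → ℝ, Continuous f →
      integral μ f = ∫ x, f x ∂ν := by
  have key : ∀ c : M, ∃ ν : Measure M, IsFiniteMeasure ν ∧ ∀ f : M → ℝ, Continuous f →
      chartInt μ c (fun x => partition M c x * f x) = ∫ x, f x ∂ν := by
    intro c
    set s := extChartAt (𝓡 3) c with hs
    set g : E3 → ℝ := fun y => partition M c (s.symm y) * density μ c y with hg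
    have hint : Integrable g (volume.restrict s.target) :=
      hμ.integrableOn_chart (partition_smooth c).continuous (tsupport_partition c)
    -- The measure on `M` is the push-forward under the inverse chart of Lebesgue measure weighted
    -- by the density and the partition function; the weight is integrable because the partition
    -- function has compact support in the chart.
    set ρ := (volume.restrict s.target).withDensity fun y => ENNReal.ofReal (g y) with hρ
    have hfin : IsFiniteMeasure ρ := isFiniteMeasure_withDensity_ofReal hint.2
    have hm : AEMeasurable s.symm ρ :=
      ((continuousOn_extChartAt_symm c).aemeasurable
        (isOpen_chart_target c).measurableSet).mono_ac (withDensity_absolutelyContinuous _ _)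
    refine ⟨ρ.map s.symm, inferInstance, fun f hf => ?_⟩
    rw [integral_map hm hf.aestronglyMeasurable, hρ,
      integral_withDensity_eq_integral_toReal_smul₀ hint.1.aemeasurable.ennreal_ofReal
        (ae_of_all _ fun _ => ENNReal.ofReal_lt_top)]
    refine integral_congr_ae (ae_of_all _ fun y => ?_)
    have h0 : 0 ≤ g y := mul_nonneg ((partition M).nonneg c _) (abs_nonneg _)
    change partition M c (s.symm y) * f (s.symm y) * density μ c y =
      (ENNReal.ofReal (g y)).toReal • f (s.symm y)
    rw [ENNReal.toReal_ofReal h0]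
    simp only [smul_eq_mul, hg]
    ring
  choose ν hν hνf using key
  refine ⟨∑ c ∈ chartSet M, ν c, inferInstance, fun f hf => ?_⟩
  rw [integral_eq_sum, integral_finsetSum_measure]
  · exact Finset.sum_congr rfl fun c _ => hνf c f hf
  · intro c _
    have := hν c
    exact hf.integrable_of_hasCompactSupport (HasCompactSupport.of_compactSpace f)

lemma IsVolumeForm.integral_add (hμ : IsVolumeForm μ) {f g : M → ℝ} (hf : Continuous f)
    (hg : Continuous g) : integral μ (fun x => f x + g x) = integral μ f + integral μ g := by
  let : MeasurableSpace M := borel M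
  have : BorelSpace M := ⟨rfl⟩
  obtain ⟨ν, hν, h⟩ := hμ.exists_measure
  rw [h _ hf, h _ hg, h (fun x => f x + g x) (hf.add hg)]
  exact MeasureTheory.integral_add
    (hf.integrable_of_hasCompactSupport (HasCompactSupport.of_compactSpace f))
    (hg.integrable_of_hasCompactSupport (HasCompactSupport.of_compactSpace g))

lemma IsVolumeForm.integral_const_mul (hμ : IsVolumeForm μ) {f : M → ℝ} (hf : Continuous f)
    (r : ℝ) : integral μ (fun x => r * f x) = r * integral μ f := by
  let : MeasurableSpace M := borel M
  have : BorelSpace M := ⟨rfl⟩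
  obtain ⟨ν, hν, h⟩ := hμ.exists_measure
  rw [h _ hf, h (fun x => r * f x) (continuous_const.mul hf)]
  exact MeasureTheory.integral_const_mul r f

lemma IsVolumeForm.integral_sub (hμ : IsVolumeForm μ) {f g : M → ℝ} (hf : Continuous f)
    (hg : Continuous g) : integral μ (fun x => f x - g x) = integral μ f - integral μ g := by
  have h := hμ.integral_add hf (g := fun x => -1 * g x) (continuous_const.mul hg)
  rw [hμ.integral_const_mul hg] at h
  simp only [neg_mul, one_mul, ← sub_eq_add_neg] at h
  exact h

lemma IsVolumeForm.integral_sum (hμ : IsVolumeForm μ) {ι : Type*} (s : Finset ι) {f : ι → M → ℝ}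
    (hf : ∀ i ∈ s, Continuous (f i)) :
    integral μ (fun x => ∑ i ∈ s, f i x) = ∑ i ∈ s, integral μ (f i) := by
  let : MeasurableSpace M := borel M
  have : BorelSpace M := ⟨rfl⟩
  obtain ⟨ν, hν, h⟩ := hμ.exists_measure
  rw [h _ (continuous_finsetSum _ hf), Finset.sum_congr rfl fun i hi => h _ (hf i hi)]
  exact MeasureTheory.integral_finsetSum s fun i hi =>
    (hf i hi).integrable_of_hasCompactSupport (HasCompactSupport.of_compactSpace _)

lemma IsVolumeForm.chartInt_sum (hμ : IsVolumeForm μ) {c : M} {ι : Type*} (s : Finset ι)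
    {f : ι → M → ℝ} (hf : ∀ i ∈ s, Continuous (f i))
    (hfc : ∀ i ∈ s, tsupport (f i) ⊆ (extChartAt (𝓡 3) c).source) :
    chartInt μ c (fun x => ∑ i ∈ s, f i x) = ∑ i ∈ s, chartInt μ c (f i) := by
  unfold chartInt
  simp only [Finset.sum_mul]
  exact MeasureTheory.integral_finsetSum s fun i hi => hμ.integrableOn_chart (hf i hi) (hfc i hi)

/-- Each piece of the integral is carried into the chart at `c` by `chartInt_comp`, and the
transported partition functions still sum to 1. For `φ = 1` this says that the integral of `g` may
be computed in any chart containing its support. -/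
lemma IsVolumeForm.integral_comp_of_tsupport (hμ : IsVolumeForm μ) (φ : SDiff μ) {c : M}
    {g : M → ℝ} (hg : Continuous g) (hgc : tsupport g ⊆ (extChartAt (𝓡 3) c).source) :
    integral μ (g ∘ φ.1) = chartInt μ c g := by
  have hφ := SDiff.isDiffeo φ
  have hφc : Continuous φ.1.symm := hφ.2.continuous
  have h0 : ∀ x ∉ (extChartAt (𝓡 3) c).source, g x = 0 := fun x hx =>
    image_eq_zero_of_notMem_tsupport fun h => hx (hgc h)
  have h1 : ∀ c' : M, chartInt μ c' (fun x => partition M c' x * (g ∘ φ.1) x) =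
      chartInt μ c (fun x => partition M c' (φ.1.symm x) * g x) := by
    intro c'
    have h2 := chartInt_comp φ (c := c') (c' := c)
      (f := fun x => partition M c' (φ.1.symm x) * g x) (fun x hx => ?_) (fun x hx => ?_)
    · rw [← h2]
      congr 1
      funext x
      simp
    · have : partition M c' x = 0 :=
        image_eq_zero_of_notMem_tsupport fun h => hx (tsupport_partition c' h)
      simp [this]
    · rw [h0 x hx, mul_zero]
  rw [integral_eq_sum, Finset.sum_congr rfl fun c' _ => h1 c', ← hμ.chartInt_sum]
  · congr 1
    funext x
    rw [← Finset.sum_mul, sum_partition, one_mul]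
  · exact fun c' _ => ((partition_smooth c').continuous.comp hφc).mul hg
  · exact fun c' _ => (tsupport_mul_subset_right).trans hgc

lemma IsVolumeForm.integral_of_tsupport (hμ : IsVolumeForm μ) {c : M}
    {g : M → ℝ} (hg : Continuous g) (hgc : tsupport g ⊆ (extChartAt (𝓡 3) c).source) :
    integral μ g = chartInt μ c g :=
  hμ.integral_comp_of_tsupport (1 : SDiff μ) hg hgc

lemma integral_partition (hμ : IsVolumeForm μ) {f : M → ℝ} (hf : Continuous f) :
    integral μ f = ∑ c ∈ chartSet M, integral μ (fun x => partition M c x * f x) := by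
  rw [← hμ.integral_sum (chartSet M) (f := fun c x => partition M c x * f x)
    fun c _ => (partition_smooth c).continuous.mul hf]
  congr 1
  funext x
  rw [← Finset.sum_mul, sum_partition, one_mul]

/-- The integral is invariant under volume-preserving diffeomorphisms. -/
lemma IsVolumeForm.integral_comp (hμ : IsVolumeForm μ) (φ : SDiff μ) {f : M → ℝ}
    (hf : Continuous f) : integral μ (f ∘ φ.1) = integral μ f := by
  have hφc : Continuous φ.1 := (SDiff.isDiffeo φ).1.continuous
  have hc : ∀ c, Continuous fun x => partition M c x * f x := fun c =>
    (partition_smooth c).continuous.mul hf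
  have hs : ∀ c, tsupport (fun x => partition M c x * f x) ⊆ (extChartAt (𝓡 3) c).source :=
    fun c => tsupport_mul_subset_left.trans (tsupport_partition c)
  have h1 : f ∘ φ.1 = fun x => ∑ c ∈ chartSet M, ((fun x => partition M c x * f x) ∘ φ.1) x := by
    funext x
    simp only [Function.comp]
    rw [← Finset.sum_mul, sum_partition, one_mul]
  rw [h1, hμ.integral_sum _ fun c _ => (hc c).comp hφc, integral_partition hμ hf]
  refine Finset.sum_congr rfl fun c _ => ?_
  rw [hμ.integral_comp_of_tsupport φ (hc c) (hs c), hμ.integral_of_tsupport (hc c) (hs c)]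

/-- A continuous nonnegative function with vanishing integral vanishes. -/
lemma IsVolumeForm.eq_zero_of_integral_eq_zero (hμ : IsVolumeForm μ) {f : M → ℝ}
    (hf : Continuous f) (h0 : ∀ x, 0 ≤ f x) (h : integral μ f = 0) (x : M) : f x = 0 := by
  have hd : ∀ c y, 0 ≤ density μ c y := fun c y => abs_nonneg _
  have hρ : ∀ c x, 0 ≤ partition M c x * f x := fun c x =>
    mul_nonneg ((partition M).nonneg c x) (h0 x)
  have hnn : ∀ c ∈ chartSet M, 0 ≤ chartInt μ c (fun x => partition M c x * f x) := fun c _ =>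
    integral_nonneg fun y => mul_nonneg (hρ c _) (hd c y)
  rw [integral_eq_sum] at h
  have hz := (Finset.sum_eq_zero_iff_of_nonneg hnn).1 h
  have hall : ∀ c ∈ chartSet M, partition M c x * f x = 0 := by
    intro c hc
    set s := extChartAt (𝓡 3) c with hs
    by_cases hx : x ∈ s.source
    swap
    · have : partition M c x = 0 :=
        image_eq_zero_of_notMem_tsupport fun h => hx (tsupport_partition c h)
      rw [this, zero_mul]
    have hcont : Continuous fun x => partition M c x * f x :=
      (partition_smooth c).continuous.mul hf
    have h1 := hz c hc
    rw [chartInt, setIntegral_eq_zero_iff_of_nonneg_ae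
      (ae_of_all _ fun y => mul_nonneg (hρ c _) (hd c y))
      (hμ.integrableOn_chart hcont (tsupport_mul_subset_left.trans (tsupport_partition c)))] at h1
    have h2 := Measure.eqOn_open_of_ae_eq h1 (isOpen_chart_target c)
      ((hcont.comp_continuousOn (continuousOn_extChartAt_symm c)).mul
        (hμ.continuousOn_density c)) continuousOn_const (s.map_source hx)
    have h3 : partition M c (s.symm (s x)) * f (s.symm (s x)) * density μ c (s x) = 0 := h2
    rw [s.left_inv hx] at h3
    refine (mul_eq_zero.1 h3).resolve_right ?_
    rw [density_eq_abs (s.map_source hx)]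
    exact abs_ne_zero.2 (hμ.chartCoeff_ne_zero (s.map_source hx))
  have h4 := Finset.sum_eq_zero hall
  rwa [← Finset.sum_mul, sum_partition, one_mul] at h4

end

end Integration

/-! ### The divergence theorem. -/

section Stokes

variable {M : Type*} [TopologicalSpace M] [ChartedSpace E3 M] [IsManifold (𝓡 3) ∞ M]
  [CompactSpace M] [T2Space M]
  [Bundle.RiemannianBundle (fun x : M => TangentSpace (𝓡 3) x)]
  [IsContMDiffRiemannianBundle (𝓡 3) ∞ E3 (fun x : M => TangentSpace (𝓡 3) x)]
  {μ : TopForm M}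

lemma dirDeriv_const (X : VField M) (r : ℝ) (x : M) : dirDeriv X (fun _ => r) x = 0 := by
  simp [dirDeriv, mvfderiv_const]

lemma IsChartFrame.dirDeriv_expand {c : M} {K : Set M} {E : Fin 3 → VField M}
    {ξ : Fin 3 → M → ℝ} (hE : IsChartFrame c K E ξ) {x : M} (hx : x ∈ K) (X : VField M)
    (g : M → ℝ) : dirDeriv X g x = ∑ j, dirDeriv X (ξ j) x * dirDeriv (E j) g x := by
  have h := congrArg (mvfderiv (𝓡 3) g x) (hE.expand hx X)
  rw [map_sum] at h
  refine h.trans (Finset.sum_congr rfl fun j _ => ?_)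
  exact (mvfderiv (𝓡 3) g x).map_smul _ _

/-- Integration by parts against the constant function 1. -/
lemma integral_fderiv_eq_zero {Q : E3 → ℝ} (hQ : ContDiff ℝ 1 Q) (hc : HasCompactSupport Q)
    (v : E3) : Integrable (fun y => fderiv ℝ Q y v) ∧ ∫ y, fderiv ℝ Q y v = 0 := by
  have hcont : Continuous fun y => fderiv ℝ Q y v :=
    (hQ.continuous_fderiv (by simp)).clm_apply continuous_const
  have hint : Integrable (fun y => fderiv ℝ Q y v) :=
    hcont.integrable_of_hasCompactSupport (hc.fderiv_apply ℝ v)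
  refine ⟨hint, ?_⟩
  have h := integral_mul_fderiv_eq_neg_fderiv_mul_of_integrable (μ := (volume : Measure E3))
    (f := fun _ => (1 : ℝ)) (g := Q) (v := v) (by simp) (by simpa using hint)
    (by simpa using hQ.continuous.integrable_of_hasCompactSupport hc)
    (fun _ _ => differentiableAt_const _) (fun _ _ => hQ.differentiable (by simp) _)
  simpa using h

open Classical in
/-- The function `g`, read in the chart at `c`, with the sign of the coefficient of `μ`. -/
def signedPull (μ : TopForm M) (c : M) (g : M → ℝ) (y : E3) : ℝ :=
  if y ∈ (extChartAt (𝓡 3) c).target then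
    Real.sign (chartCoeff μ c y) * g ((extChartAt (𝓡 3) c).symm y) else 0

/-- The coefficient is continuous and has no zeros. Locally the density is therefore a constant sign
times a smooth coefficient, and no orientation of the charts is required. -/
lemma IsVolumeForm.sign_chartCoeff (hμ : IsVolumeForm μ) {c : M} {y : E3}
    (hy : y ∈ (extChartAt (𝓡 3) c).target) :
    ∀ᶠ z in 𝓝 y, Real.sign (chartCoeff μ c z) = Real.sign (chartCoeff μ c y) := by
  have hc := hμ.continuousAt_chartCoeff hy
  rcases lt_or_gt_of_ne (hμ.chartCoeff_ne_zero hy) with h | h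
  · filter_upwards [hc.eventually_lt continuousAt_const h] with z hz
    rw [Real.sign_of_neg h, Real.sign_of_neg hz]
  · filter_upwards [continuousAt_const.eventually_lt hc h] with z hz
    rw [Real.sign_of_pos h, Real.sign_of_pos hz]

lemma IsVolumeForm.signedPull_eventuallyEq (hμ : IsVolumeForm μ) {c : M} (g : M → ℝ) {y : E3}
    (hy : y ∈ (extChartAt (𝓡 3) c).target) :
    signedPull μ c g =ᶠ[𝓝 y]
      fun z => Real.sign (chartCoeff μ c y) * (g ∘ (extChartAt (𝓡 3) c).symm) z := by
  filter_upwards [hμ.sign_chartCoeff hy, chart_target_mem_nhds hy] with z hz hz'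
  rw [signedPull, if_pos hz', hz]
  rfl

lemma signedPull_eventuallyEq_zero {c : M} {g : M → ℝ}
    (hgc : tsupport g ⊆ (extChartAt (𝓡 3) c).source) {y : E3}
    (hy : y ∉ extChartAt (𝓡 3) c '' tsupport g) : signedPull μ c g =ᶠ[𝓝 y] fun _ => 0 := by
  have hK := isCompact_chart_image (isClosed_tsupport g) hgc
  filter_upwards [hK.isClosed.isOpen_compl.mem_nhds hy] with z hz
  unfold signedPull
  split_ifs with h
  · have : g ((extChartAt (𝓡 3) c).symm z) = 0 := by
      by_contra hne
      exact hz ⟨_, subset_tsupport g hne, (extChartAt (𝓡 3) c).right_inv h⟩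
    rw [this, mul_zero]
  · rfl

lemma IsVolumeForm.contDiff_signedPull (hμ : IsVolumeForm μ) {c : M} {g : M → ℝ}
    (hg : SmoothFun g) (hgc : tsupport g ⊆ (extChartAt (𝓡 3) c).source) :
    ContDiff ℝ 1 (signedPull μ c g) ∧ HasCompactSupport (signedPull μ c g) := by
  have hK := isCompact_chart_image (isClosed_tsupport g) hgc
  constructor
  · refine contDiff_iff_contDiffAt.2 fun y => ?_
    by_cases hy : y ∈ extChartAt (𝓡 3) c '' tsupport g
    · have hyt : y ∈ (extChartAt (𝓡 3) c).target := by
        obtain ⟨x, hx, rfl⟩ := hy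
        exact (extChartAt (𝓡 3) c).map_source (hgc hx)
      have h := (contDiffAt_comp_chart_symm hg hyt).of_le (m := 1) ENat.LEInfty.out
      exact (contDiffAt_const.mul h).congr_of_eventuallyEq (hμ.signedPull_eventuallyEq g hyt)
    · exact contDiffAt_const.congr_of_eventuallyEq (signedPull_eventuallyEq_zero hgc hy)
  · refine HasCompactSupport.of_support_subset_isCompact hK fun y hy => ?_
    by_contra hne
    exact hy (signedPull_eventuallyEq_zero hgc hne).self_of_nhds

lemma IsVolumeForm.fderiv_signedPull (hμ : IsVolumeForm μ) {c : M} {g : M → ℝ}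
    (hg : SmoothFun g) {y : E3} (hy : y ∈ (extChartAt (𝓡 3) c).target) (j : Fin 3) :
    fderiv ℝ (signedPull μ c g) y (stdVec j) = Real.sign (chartCoeff μ c y) *
      dirDeriv (chartField c j) g ((extChartAt (𝓡 3) c).symm y) := by
  rw [(hμ.signedPull_eventuallyEq g hy).fderiv_eq, dirDeriv_chartField hy hg, fderiv_const_mul]
  · rfl
  · exact (contDiffAt_comp_chart_symm hg hy).differentiableAt (by simp)

/-- The divergence theorem in one chart. -/
lemma IsVolumeForm.chartInt_eq_zero (hμ : IsVolumeForm μ) {c : M} {K : Set M}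
    {E : Fin 3 → VField M} {ξ : Fin 3 → M → ℝ} (hE : IsChartFrame c K E ξ)
    {G : Fin 3 → M → ℝ} (hG : ∀ j, SmoothFun (G j)) (hGK : ∀ j, tsupport (G j) ⊆ K)
    {h : M → ℝ} (h0 : ∀ x ∉ K, h x = 0)
    (hh : ∀ x ∈ K, h x * μ x (fun i => E i x) = ∑ j, dirDeriv (E j) (G j) x) :
    chartInt μ c h = 0 := by
  have hGc : ∀ j, tsupport (G j) ⊆ (extChartAt (𝓡 3) c).source := fun j =>
    (hGK j).trans hE.subset
  have hQ := fun j => hμ.contDiff_signedPull (hG j) (hGc j)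
  have hI := fun j => integral_fderiv_eq_zero (hQ j).1 (hQ j).2 (stdVec j)
  -- In coordinates the integrand is the Euclidean divergence of a compactly supported field, namely
  -- `G` multiplied by the sign of the coefficient.
  have hpt : ∀ y ∈ (extChartAt (𝓡 3) c).target,
      h ((extChartAt (𝓡 3) c).symm y) * density μ c y =
        ∑ j, fderiv ℝ (signedPull μ c (G j)) y (stdVec j) := by
    intro y hy
    simp only [hμ.fderiv_signedPull (hG _) hy]
    by_cases hx : (extChartAt (𝓡 3) c).symm y ∈ K
    · have h1 := hh _ hx
      have h2 := (chartCoeff_eventuallyEq (μ := μ) hE hy hx).self_of_nhds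
      simp only [Function.comp] at h2
      rw [← h2] at h1
      have h3 : ∀ j, dirDeriv (chartField c j) (G j) ((extChartAt (𝓡 3) c).symm y) =
          dirDeriv (E j) (G j) ((extChartAt (𝓡 3) c).symm y) := fun j => by
        unfold dirDeriv
        rw [(hE.eventually hx).self_of_nhds.2 j]
      simp only [h3]
      rw [← Finset.mul_sum, ← h1, density_eq_abs hy]
      rcases lt_or_gt_of_ne (hμ.chartCoeff_ne_zero hy) with h | h
      · rw [Real.sign_of_neg h, abs_of_neg h]; ring
      · rw [Real.sign_of_pos h, abs_of_pos h]; ring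
    · rw [h0 _ hx, zero_mul]
      refine (Finset.sum_eq_zero fun j _ => ?_).symm
      have h1 : G j =ᶠ[𝓝 ((extChartAt (𝓡 3) c).symm y)] fun _ => (0 : ℝ) :=
        notMem_tsupport_iff_eventuallyEq.1 fun hx' => hx (hGK j hx')
      have h2 := dirDeriv_congr (X := chartField c j) h1
      rw [dirDeriv_const] at h2
      rw [h2, mul_zero]
  have hoff : ∀ y ∉ (extChartAt (𝓡 3) c).target,
      ∑ j, fderiv ℝ (signedPull μ c (G j)) y (stdVec j) = 0 := by
    intro y hy
    refine Finset.sum_eq_zero fun j _ => ?_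
    have h1 := signedPull_eventuallyEq_zero (μ := μ) (hGc j) (y := y) (by
      rintro ⟨x, hx, rfl⟩
      exact hy ((extChartAt (𝓡 3) c).map_source (hGc j hx)))
    rw [h1.fderiv_eq]
    simp
  rw [chartInt, setIntegral_congr_fun (isOpen_chart_target c).measurableSet hpt,
    setIntegral_eq_integral_of_forall_compl_eq_zero hoff,
    MeasureTheory.integral_finsetSum _ fun j _ => (hI j).1]
  exact Finset.sum_eq_zero fun j _ => (hI j).2

variable {D : CovariantDerivative (𝓡 3) E3 (fun x : M => TangentSpace (𝓡 3) x)}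

/-- The derivative of a function along a divergence-free field has vanishing integral. -/
lemma IsVolumeForm.integral_dirDeriv_eq_zero (hμ : IsVolumeForm μ) (hD : IsLeviCivita D)
    {X : VField M} (hX : SmoothField X) (hdiv : DivFree μ X) {f : M → ℝ} (hf : SmoothFun f) :
    integral μ (dirDeriv X f) = 0 := by
  have hρ : ∀ c, SmoothFun (fun x => partition M c x * f x) := fun c => (partition_smooth c).mul hf
  have h1 : dirDeriv X f =
      fun x => ∑ c ∈ chartSet M, dirDeriv X (fun x => partition M c x * f x) x := by
    funext x
    have h2 : f = fun x => ∑ c ∈ chartSet M, partition M c x * f x := by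
      funext x
      rw [← Finset.sum_mul, sum_partition, one_mul]
    have h3 : ∀ s : Finset M, SmoothFun (fun x => ∑ c ∈ s, partition M c x * f x) ∧
        dirDeriv X (fun x => ∑ c ∈ s, partition M c x * f x) x =
        ∑ c ∈ s, dirDeriv X (fun x => partition M c x * f x) x := by
      classical
      intro s
      induction s using Finset.induction_on with
      | empty =>
        refine ⟨by simpa using! contMDiff_const, ?_⟩
        simp [dirDeriv, mvfderiv_const]
      | insert c s hc ih =>
        simp only [Finset.sum_insert hc]
        exact ⟨(hρ c).add ih.1, by rw [dirDeriv_add (hρ c) ih.1, ih.2]⟩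
    rw [← (h3 _).2, ← h2]
  rw [h1, hμ.integral_sum _ fun c _ => (hX.dirDeriv_smooth (hρ c)).continuous]
  refine Finset.sum_eq_zero fun c _ => ?_
  set g : M → ℝ := fun x => partition M c x * f x with hg
  have hgs : tsupport g ⊆ (extChartAt (𝓡 3) c).source :=
    tsupport_mul_subset_left.trans (tsupport_partition c)
  obtain ⟨E, ξ, hE⟩ := exists_isChartFrame (isClosed_tsupport g) hgs
  have hoff : ∀ x ∉ tsupport g, dirDeriv X g x = 0 := by
    intro x hx
    rw [dirDeriv_congr (notMem_tsupport_iff_eventuallyEq.1 hx)]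
    exact dirDeriv_const X 0 x
  have hsupp : tsupport (dirDeriv X g) ⊆ tsupport g :=
    closure_minimal (fun x hx => by by_contra h; exact hx (hoff x h)) (isClosed_tsupport g)
  rw [hμ.integral_of_tsupport (hX.dirDeriv_smooth (hρ c)).continuous (hsupp.trans hgs)]
  set m : M → ℝ := fun x => μ x (fun i => E i x) with hm
  have hms : SmoothFun m := hμ.smooth_frame hE.smooth
  have hXs : ∀ j, SmoothFun (dirDeriv X (ξ j)) := fun j => hX.dirDeriv_smooth (hE.smooth_coord j)
  -- With `Xʲ = X ξⱼ` and `m = μ(E)`, the field `G` represents the two-form `i_{gX} μ`. Its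
  -- divergence is `m X(g) + g (X(m) + m ∑ EⱼXʲ)`, and the last bracket is the coordinate form of
  -- `L_X μ = 0`.
  refine hμ.chartInt_eq_zero hE (G := fun j x => dirDeriv X (ξ j) x * (m x * g x))
    (fun j => (hXs j).mul (hms.mul (hρ c)))
    (fun j => tsupport_mul_subset_right.trans tsupport_mul_subset_right) hoff fun x hx => ?_
  -- The term `X (Eⱼ ξᵢ)` drops out because `Eⱼ ξᵢ` is locally constant.
  have hb : ∀ j, bracket X (E j) x = ∑ i, (-dirDeriv (E j) (dirDeriv X (ξ i)) x) • E i x := by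
    intro j
    rw [hE.expand hx (bracket X (E j))]
    refine Finset.sum_congr rfl fun i _ => ?_
    rw [hD.dirDeriv_bracket (hE.smooth_coord i) hX (hE.smooth j),
      dirDeriv_congr (hE.dirDeriv_coord_self hx j i)]
    rw [dirDeriv_const, zero_sub]
  have hd := hdiv E hE.smooth x
  have hupd : ∀ j, μ x (Function.update (fun j => E j x) j (bracket X (E j) x)) =
      -dirDeriv (E j) (dirDeriv X (ξ j)) x * m x := by
    intro j
    rw [hb, AlternatingMap.map_update_sum, Finset.sum_eq_single j]
    · rw [AlternatingMap.map_update_smul, Function.update_eq_self, smul_eq_mul]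
    · intro i _ hij
      rw [AlternatingMap.map_update_smul, AlternatingMap.map_update_self _ _ hij.symm, smul_zero]
    · simp
  simp only [hupd] at hd
  have hXg := hE.dirDeriv_expand hx X g
  have hXm := hE.dirDeriv_expand hx X m
  have hprod : ∀ j, dirDeriv (E j) (fun x => dirDeriv X (ξ j) x * (m x * g x)) x =
      dirDeriv X (ξ j) x * (m x * dirDeriv (E j) g x + g x * dirDeriv (E j) m x) +
        (m x * g x) * dirDeriv (E j) (dirDeriv X (ξ j)) x := by
    intro j
    rw [dirDeriv_mul (g := fun x => m x * g x) (hXs j) (hms.mul (hρ c)),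
      dirDeriv_mul (g := g) hms (hρ c)]
  simp only [hprod, Fin.sum_univ_three] at hd hXg hXm ⊢
  change dirDeriv X m x - _ = 0 at hd
  rw [hXg]
  rw [hXm] at hd
  linear_combination g x * (-hd)

end Stokes

/-! ### Stokes' theorem for products of one-forms. -/

section Wedge

variable {M : Type*} [TopologicalSpace M] [ChartedSpace E3 M] [IsManifold (𝓡 3) ∞ M]
  [CompactSpace M] [T2Space M]
  [Bundle.RiemannianBundle (fun x : M => TangentSpace (𝓡 3) x)]
  [IsContMDiffRiemannianBundle (𝓡 3) ∞ E3 (fun x : M => TangentSpace (𝓡 3) x)]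
  {μ : TopForm M}

lemma dForm_eq_zero_of_eventuallyEq {α : CovField M} {x : M} (h : ∀ᶠ y in 𝓝 x, α y = 0)
    (X Y : VField M) : dForm α X Y x = 0 := by
  have h1 : ∀ Z : VField M, contract α Z =ᶠ[𝓝 x] fun _ => (0 : ℝ) := fun Z => by
    filter_upwards [h] with y hy
    rw [contract, hy]
    rfl
  rw [dForm, dirDeriv_congr (h1 Y), dirDeriv_congr (h1 X), (h1 _).self_of_nhds, dirDeriv_const,
    dirDeriv_const]
  ring

lemma ContractsTo.eq_zero (hμ : IsVolumeForm μ) {α : CovField M} {a : VField M}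
    (h : ContractsTo μ a α) {x : M} (hx : ∀ᶠ y in 𝓝 x, α y = 0) : a x = 0 := by
  obtain ⟨E, ξ, hE⟩ := exists_isChartFrame_self x
  have hb := (hE.eventually (mem_singleton x)).self_of_nhds
  refine hμ.eq_zero_of_contract (chartBasis x hb.1) fun i => ?_
  have h1 := h _ _ (hE.smooth (i + 1)) (hE.smooth (i + 2)) x
  rw [dForm_eq_zero_of_eventuallyEq hx] at h1
  rw [chartBasis_apply, chartBasis_apply, ← hb.2, ← hb.2]
  exact h1

/-- Both sides are the coefficient of `α ∧ dβ = α(b) μ` in the frame. -/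
lemma IsChartFrame.contract_mul_vol {c : M} {K : Set M} {E : Fin 3 → VField M}
    {ξ : Fin 3 → M → ℝ} (hE : IsChartFrame c K E ξ) {x : M} (hx : x ∈ K) {α β : CovField M}
    {b : VField M} (h : ContractsTo μ b β) :
    contract α b x * μ x (fun i => E i x) =
      ∑ i, contract α (E i) x * dForm β (E (i + 1)) (E (i + 2)) x := by
  have h1 : contract α b x = ∑ i, dirDeriv b (ξ i) x * contract α (E i) x := by
    have h2 := congrArg (α x) (hE.expand hx b)
    rw [map_sum] at h2
    exact h2.trans (Finset.sum_congr rfl fun j _ => (α x).map_smul _ _)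
  rw [h1, Finset.sum_mul]
  refine Finset.sum_congr rfl fun i _ => ?_
  rw [← h _ _ (hE.smooth (i + 1)) (hE.smooth (i + 2)), hE.expand hx b]
  have h3 := alternating_sum_fst (μ x) (fun i => E i x) (fun j => dirDeriv b (ξ j) x) i
  rw [h3]
  ring

/-- `α ∧ dβ - β ∧ dα = d(β ∧ α)`, and the functions `G` in the proof are the components of `β ∧ α`
on the cyclic pairs of the frame. Only `α` must be supported in the chart, since its curl `a`
vanishes wherever `α` is locally zero. -/
lemma IsVolumeForm.integral_wedge_of_support (hμ : IsVolumeForm μ) {α β : CovField M}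
    (hα : α ∈ SmoothForms M) (hβ : β ∈ SmoothForms M) {a b : VField M} (ha : SmoothField a)
    (hb : SmoothField b) (hαa : ContractsTo μ a α) (hβb : ContractsTo μ b β) {c : M} {K : Set M}
    (hK : IsClosed K) (hKc : K ⊆ (extChartAt (𝓡 3) c).source) (h0 : ∀ x ∉ K, α x = 0) :
    integral μ (contract α b) = integral μ (contract β a) := by
  obtain ⟨E, ξ, hE⟩ := exists_isChartFrame hK hKc
  have hev : ∀ x ∉ K, ∀ᶠ y in 𝓝 x, α y = 0 := fun x hx => by
    filter_upwards [hK.isOpen_compl.mem_nhds hx] with y hy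
    exact h0 y hy
  have ha0 : ∀ x ∉ K, a x = 0 := fun x hx => hαa.eq_zero hμ (hev x hx)
  have hoff : ∀ x ∉ K, contract α b x - contract β a x = 0 := fun x hx => by
    rw [contract, contract, h0 x hx, ha0 x hx, map_zero, sub_zero]
    rfl
  have hsupp : tsupport (fun x => contract α b x - contract β a x) ⊆ K :=
    closure_minimal (fun x hx => by by_contra h; exact hx (hoff x h)) hK
  have hcont : Continuous fun x => contract α b x - contract β a x :=
    (hα b hb).continuous.sub (hβ a ha).continuous
  have h := hμ.integral_of_tsupport hcont (hsupp.trans hKc)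
  rw [hμ.integral_sub (hα b hb).continuous (hβ a ha).continuous] at h
  refine sub_eq_zero.1 (h.trans ?_)
  have hs : ∀ i, SmoothFun (contract α (E i)) := fun i => hα _ (hE.smooth i)
  have ht : ∀ i, SmoothFun (contract β (E i)) := fun i => hβ _ (hE.smooth i)
  refine hμ.chartInt_eq_zero hE
    (G := fun j x => contract α (E (j + 2)) x * contract β (E (j + 1)) x -
      contract α (E (j + 1)) x * contract β (E (j + 2)) x)
    (fun j => ((hs _).mul (ht _)).sub ((hs _).mul (ht _)))
    (fun j => closure_minimal (fun x hx => ?_) hK) hoff fun x hx => ?_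
  · by_contra h
    refine hx ?_
    have h2 : ∀ i, contract α (E i) x = 0 := fun i => by
      rw [contract, h0 x h]; rfl
    simp only [h2, zero_mul, sub_zero]
  · have hG : ∀ j, dirDeriv (E j) (fun x => contract α (E (j + 2)) x * contract β (E (j + 1)) x -
        contract α (E (j + 1)) x * contract β (E (j + 2)) x) x =
        contract α (E (j + 2)) x * dirDeriv (E j) (contract β (E (j + 1))) x +
        contract β (E (j + 1)) x * dirDeriv (E j) (contract α (E (j + 2))) x -
        (contract α (E (j + 1)) x * dirDeriv (E j) (contract β (E (j + 2))) x +
        contract β (E (j + 2)) x * dirDeriv (E j) (contract α (E (j + 1))) x) := fun j => by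
      rw [dirDeriv_sub (f := fun x => contract α (E (j + 2)) x * contract β (E (j + 1)) x)
        (g := fun x => contract α (E (j + 1)) x * contract β (E (j + 2)) x)
        ((hs _).mul (ht _)) ((hs _).mul (ht _)), dirDeriv_mul (hs _) (ht _),
        dirDeriv_mul (hs _) (ht _)]
    simp only [hG]
    rw [sub_mul, hE.contract_mul_vol hx hβb, hE.contract_mul_vol hx hαa]
    simp only [hE.dForm_eq hx, Fin.sum_univ_three, Fin.isValue, Fin.reduceAdd, zero_add]
    ring

variable {D : CovariantDerivative (𝓡 3) E3 (fun x : M => TangentSpace (𝓡 3) x)}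

lemma contractsTo_add {α β : CovField M} (hα : α ∈ SmoothForms M) (hβ : β ∈ SmoothForms M)
    {a b : VField M} (ha : ContractsTo μ a α) (hb : ContractsTo μ b β) :
    ContractsTo μ (a + b) (α + β) := fun X Y hX hY x => by
  rw [dForm_add hα hβ hX hY, ← ha X Y hX hY, ← hb X Y hX hY]
  exact (μ x).map_vecCons_add ![X x, Y x] (a x) (b x)

lemma SmoothField.add {X Y : VField M} (hX : SmoothField X) (hY : SmoothField Y) :
    SmoothField (X + Y) := ContMDiff.add_section hX hY

lemma SmoothField.sub {X Y : VField M} (hX : SmoothField X) (hY : SmoothField Y) :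
    SmoothField (X - Y) := ContMDiff.sub_section hX hY

lemma contractsTo_zero : ContractsTo μ 0 0 := fun X Y _ _ x => by
  rw [dForm_zero]
  exact (μ x).map_coord_zero 0 rfl

lemma smoothField_zero : SmoothField (0 : VField M) := Bundle.contMDiff_zeroSection ℝ _

/-- Stokes' theorem for the wedge product of two one-forms: `∫ α ∧ dβ = ∫ β ∧ dα`. -/
lemma IsVolumeForm.integral_wedge (hμ : IsVolumeForm μ) (hD : IsLeviCivita D) {α β : CovField M}
    (hα : α ∈ SmoothForms M) (hβ : β ∈ SmoothForms M) {a b : VField M}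
    (hb : SmoothField b) (hαa : ContractsTo μ a α) (hβb : ContractsTo μ b β) :
    integral μ (contract α b) = integral μ (contract β a) := by
  have hρ : ∀ c, (fun x => partition M c x • α x) ∈ SmoothForms M := fun c X hX =>
    (partition_smooth c).mul (hα X hX)
  -- Only `α` is cut by the partition. The curls of the pieces sum to a curl of `α`, which must be
  -- `a` since a curl is unique.
  choose A hA hAα using fun c => hD.exists_contractsTo hμ (hρ c)
  have hsum : ∀ s : Finset M, (∑ c ∈ s, fun x => partition M c x • α x) ∈ SmoothForms M ∧
      SmoothField (∑ c ∈ s, A c) ∧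
      ContractsTo μ (∑ c ∈ s, A c) (∑ c ∈ s, fun x => partition M c x • α x) := by
    classical
    intro s
    induction s using Finset.induction_on with
    | empty => exact ⟨zero_mem _, smoothField_zero, contractsTo_zero⟩
    | insert c s hc ih =>
      simp only [Finset.sum_insert hc]
      exact ⟨add_mem (hρ c) ih.1, (hA c).add ih.2.1, contractsTo_add (hρ c) ih.1 (hAα c) ih.2.2⟩
  have hαs : (∑ c ∈ chartSet M, fun x => partition M c x • α x) = α := by
    funext x
    rw [Finset.sum_apply, ← Finset.sum_smul, sum_partition, one_smul]
  have has : a = ∑ c ∈ chartSet M, A c := by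
    have h := (hsum (chartSet M)).2.2
    rw [hαs] at h
    exact hμ.contractsTo_unique hαa h
  have h1 : contract α b =
      fun x => ∑ c ∈ chartSet M, contract (fun x => partition M c x • α x) b x := by
    funext x
    have h2 := congrArg (fun η : CovField M => η x (b x)) hαs
    simp only [Finset.sum_apply, sum_apply] at h2
    exact h2.symm
  have h2 : contract β a = fun x => ∑ c ∈ chartSet M, contract β (A c) x := by
    funext x
    rw [contract, has, Finset.sum_apply, map_sum]
    rfl
  rw [h1, h2, hμ.integral_sum _ (f := fun c => contract (fun x => partition M c x • α x) b)
    fun c _ => (hρ c b hb).continuous,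
    hμ.integral_sum _ fun c _ => (hβ _ (hA c)).continuous]
  refine Finset.sum_congr rfl fun c _ => ?_
  refine hμ.integral_wedge_of_support (hρ c) hβ (hA c) hb (hAα c) hβb
    (K := tsupport (partition M c)) (isClosed_tsupport _) (tsupport_partition c) fun x hx => ?_
  rw [image_eq_zero_of_notMem_tsupport hx, zero_smul]

end Wedge

/-! ### Helicity through arbitrary primitives; the Lie derivative of one-forms. -/

section Helicity

variable {M : Type*} [TopologicalSpace M] [ChartedSpace E3 M] [IsManifold (𝓡 3) ∞ M]
  [CompactSpace M] [T2Space M]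
  [Bundle.RiemannianBundle (fun x : M => TangentSpace (𝓡 3) x)]
  [IsContMDiffRiemannianBundle (𝓡 3) ∞ E3 (fun x : M => TangentSpace (𝓡 3) x)]
  {μ : TopForm M} {D : CovariantDerivative (𝓡 3) E3 (fun x : M => TangentSpace (𝓡 3) x)}

lemma integral_zero_fun (μ : TopForm M) : integral μ (fun _ : M => (0 : ℝ)) = 0 := by
  simp [integral]

/-- The integral of the contraction with an exact field depends only on the differential of the
one-form. -/
lemma IsVolumeForm.integral_contract_congr (hμ : IsVolumeForm μ) (hD : IsLeviCivita D)
    {α α' : CovField M} (hα : α ∈ SmoothForms M) (hα' : α' ∈ SmoothForms M) {a : VField M}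
    (h : ContractsTo μ a α) (h' : ContractsTo μ a α')
    {B : VField M} (hB : B ∈ ExactField μ) :
    integral μ (contract α B) = integral μ (contract α' B) := by
  obtain ⟨hBs, β, hβ, hBβ⟩ := hB
  rw [hμ.integral_wedge hD hα hβ hBs h hBβ, hμ.integral_wedge hD hα' hβ hBs h' hBβ]

lemma IsVolumeForm.integral_contract_closed (hμ : IsVolumeForm μ) (hD : IsLeviCivita D)
    {α : CovField M} (hα : α ∈ SmoothForms M)
    (h : ∀ X Y : VField M, SmoothField X → SmoothField Y → ∀ x, dForm α X Y x = 0)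
    {B : VField M} (hB : B ∈ ExactField μ) : integral μ (contract α B) = 0 := by
  have h0 : ContractsTo μ 0 α := fun X Y hX hY x => by
    rw [h X Y hX hY]
    exact (μ x).map_coord_zero 0 rfl
  rw [hμ.integral_contract_congr hD hα (zero_mem _) h0 contractsTo_zero hB]
  exact integral_zero_fun μ

lemma IsVolumeForm.integral_dirDeriv_exact (hμ : IsVolumeForm μ) (hD : IsLeviCivita D)
    {B : VField M} (hB : B ∈ ExactField μ) {f : M → ℝ} (hf : SmoothFun f) :
    integral μ (dirDeriv B f) = 0 :=
  hμ.integral_contract_closed hD (α := mvfderiv (𝓡 3) f) (fun _ hX => hX.dirDeriv_smooth hf)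
    (fun _ _ hX hY x => hD.dForm_mvfderiv hf hX hY x) hB

/-- Each of the first two alternatives in `curlInv` provides a smooth primitive. The default value 0
is excluded because the vector field dual to a primitive one-form of `u` has curl `u`. -/
lemma curlInv_spec {u : VField M} (hu : u ∈ ExactField μ) :
    SmoothField (curlInv μ u) ∧ ContractsTo μ u (flat (curlInv μ u)) := by
  obtain ⟨hus, α, hα, hα'⟩ := hu
  obtain ⟨v, hv, rfl⟩ := exists_flat_eq hα
  unfold curlInv
  split_ifs with h h'
  · exact ⟨h.choose_spec.1.1, h.choose_spec.2.2⟩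
  · exact ⟨h'.choose_spec.1, h'.choose_spec.2.2⟩
  · exact absurd ⟨v, hv, hus, hα'⟩ h'

/-- Two primitives of the same two-form have the same integral against an exact field, so the choice
in `curlInv` is immaterial. -/
lemma IsVolumeForm.helicity_eq (hμ : IsVolumeForm μ) (hD : IsLeviCivita D) {u B : VField M}
    (hu : u ∈ ExactField μ) (hB : B ∈ ExactField μ) {α : CovField M} (hα : α ∈ SmoothForms M)
    (h : ContractsTo μ u α) : helicity μ u B = integral μ (contract α B) := by
  obtain ⟨h1, h2⟩ := curlInv_spec hu
  rw [← hμ.integral_contract_congr hD h1.flat_mem hα h2 h hB]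
  unfold helicity
  congr 1
  funext x
  exact real_inner_comm _ _

lemma IsVolumeForm.curl_spec (hμ : IsVolumeForm μ) (hD : IsLeviCivita D) {v : VField M}
    (hv : SmoothField v) : IsCurl μ v (curl μ v) := by
  have h : ∃ w, IsCurl μ v w := hD.exists_contractsTo hμ hv.flat_mem
  rw [curl, dif_pos h]
  exact h.choose_spec

lemma IsVolumeForm.curl_mem (hμ : IsVolumeForm μ) (hD : IsLeviCivita D) {v : VField M}
    (hv : SmoothField v) : curl μ v ∈ ExactField μ :=
  ⟨(hμ.curl_spec hD hv).1, flat v, hv.flat_mem, (hμ.curl_spec hD hv).2⟩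

lemma IsVolumeForm.helicity_curl (hμ : IsVolumeForm μ) (hD : IsLeviCivita D) {v B : VField M}
    (hv : SmoothField v) (hB : B ∈ ExactField μ) :
    helicity μ (curl μ v) B = integral μ (fun x => inner ℝ (v x) (B x)) :=
  hμ.helicity_eq hD (hμ.curl_mem hD hv) hB hv.flat_mem (hμ.curl_spec hD hv).2

lemma inner_sharp {x : M} (α : TangentSpace (𝓡 3) x →L[ℝ] ℝ) (w : TangentSpace (𝓡 3) x) :
    inner ℝ (sharp α) w = α w := InnerProductSpace.toDual_symm_apply

lemma inner_cross (a b : VField M) (x : M) (w : TangentSpace (𝓡 3) x) :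
    inner ℝ (cross μ a b x) w = μ x ![a x, b x, w] := by
  rw [cross, inner_sharp]
  simp only [LinearMap.coe_toContinuousLinearMap', MultilinearMap.toLinearMap_apply]
  change μ x _ = _
  congr 1
  funext j
  fin_cases j <;> rfl

lemma IsVolumeForm.flat_cross_mem (hμ : IsVolumeForm μ) {a b : VField M} (ha : SmoothField a)
    (hb : SmoothField b) : flat (cross μ a b) ∈ SmoothForms M := fun X hX => by
  have h : contract (flat (cross μ a b)) X = fun x => μ x ![a x, b x, X x] :=
    funext fun x => inner_cross a b x (X x)
  rw [h]
  exact hμ.smooth a b X ha hb hX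

/-- Cartan's formula `L_w α = i_w dα + d(α(w))`: its right-hand side at `x` is a covector because
`dα` is tensorial. -/
lemma IsLeviCivita.exists_lieDeriv (hD : IsLeviCivita D) {w : VField M} (hw : SmoothField w)
    (α : OneForm M) : IsLieDeriv w α (lieForm w α) := by
  have h : ∃ β, IsLieDeriv w α β := by
    choose T hT hTd using fun x => hD.exists_tensor α.val_mem x
    have hval : ∀ x, ∃ L : TangentSpace (𝓡 3) x →L[ℝ] ℝ, ∀ Y : VField M, SmoothField Y →
        L (Y x) = dirDeriv w (contract α.val Y) x - contract α.val (bracket w Y) x := by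
      intro x
      refine ⟨LinearMap.toContinuousLinearMap (T x (w x)) +
        mvfderiv (𝓡 3) (contract α.val w) x, fun Y hY => ?_⟩
      have h1 := hTd x w Y hw hY
      change T x (w x) (Y x) + dirDeriv Y (contract α.val w) x = _
      rw [← h1, dForm]
      ring
    choose L hL using hval
    have hLs : (L : CovField M) ∈ SmoothForms M := fun Y hY => by
      have h1 : contract L Y =
          fun x => dirDeriv w (contract α.val Y) x - contract α.val (bracket w Y) x :=
        funext fun x => hL x Y hY
      rw [h1]
      exact (hw.dirDeriv_smooth (α.val_mem Y hY)).sub (α.val_mem _ (hw.bracket_smooth hY))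
    exact ⟨⟨L, hLs⟩, fun Y hY x => hL x Y hY⟩
  rw [lieForm, dif_pos h]
  exact h.choose_spec

end Helicity

/-! ### The coadjoint action and the nondegeneracy of the pairing. -/

section Coadjoint

variable {M : Type*} [TopologicalSpace M] [ChartedSpace E3 M] [IsManifold (𝓡 3) ∞ M]
  [CompactSpace M] [T2Space M]
  [Bundle.RiemannianBundle (fun x : M => TangentSpace (𝓡 3) x)]
  [IsContMDiffRiemannianBundle (𝓡 3) ∞ E3 (fun x : M => TangentSpace (𝓡 3) x)]
  {μ : TopForm M} {D : CovariantDerivative (𝓡 3) E3 (fun x : M => TangentSpace (𝓡 3) x)}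

/-- Representatives differ by a closed form, which integrates to zero against an exact field; so the
pairing is well defined on cosets. -/
lemma IsVolumeForm.integral_rep_mk (hμ : IsVolumeForm μ) (hD : IsLeviCivita D) (γ : OneForm M)
    {B : VField M} (hB : B ∈ ExactField μ) :
    integral μ (contract (rep (Submodule.Quotient.mk γ)).val B) =
      integral μ (contract γ.val B) := by
  set δ := rep (Submodule.Quotient.mk γ : DualX M) with hδ
  have h1 : γ - δ ∈ ClosedForm M :=
    (Submodule.Quotient.eq (ClosedForm M)).1 (mk_rep (Submodule.Quotient.mk γ)).symm
  have h2 := hμ.integral_contract_closed hD (γ - δ).val_mem h1 hB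
  have h3 : integral μ (contract (γ - δ).val B) =
      integral μ (contract γ.val B) - integral μ (contract δ.val B) :=
    hμ.integral_sub (γ.val_mem B hB.1).continuous (δ.val_mem B hB.1).continuous
  linarith

lemma IsVolumeForm.integral_rep_add (hμ : IsVolumeForm μ) (hD : IsLeviCivita D) (c d : DualX M)
    {B : VField M} (hB : B ∈ ExactField μ) :
    integral μ (contract (rep (c + d)).val B) =
      integral μ (contract (rep c).val B) + integral μ (contract (rep d).val B) := by
  have h : c + d = Submodule.Quotient.mk (rep c + rep d) := by
    rw [Submodule.Quotient.mk_add, mk_rep, mk_rep]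
  rw [h, hμ.integral_rep_mk hD _ hB]
  exact hμ.integral_add ((rep c).val_mem B hB.1).continuous ((rep d).val_mem B hB.1).continuous

lemma IsVolumeForm.integral_comp_symm (hμ : IsVolumeForm μ) (φ : SDiff μ) {f : M → ℝ}
    (hf : Continuous f) : integral μ (f ∘ φ.1.symm) = integral μ f :=
  hμ.integral_comp φ⁻¹ hf

lemma IsVolumeForm.integral_contract_push (hμ : IsVolumeForm μ) (φ : SDiff μ) {α : CovField M}
    (hα : α ∈ SmoothForms M) {X : VField M} (hX : SmoothField X) :
    integral μ (contract (pushForm φ.1 α) (pushField φ.1 X)) = integral μ (contract α X) := by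
  rw [(SDiff.isDiffeo φ).contract_push]
  exact hμ.integral_comp_symm φ (hα X hX).continuous

lemma pushExact_val {φ : SDiff μ} (w : ExactField μ) :
    (pushExact φ w).1 = pushField φ.1 w.1 := rfl

lemma pushField_inv (φ : SDiff μ) (X : VField M) :
    pushField φ.1 (pushField (φ⁻¹).1 X) = X := (SDiff.isDiffeo φ).pushField_symm X

lemma IsVolumeForm.integral_rep_smul (hμ : IsVolumeForm μ) (hD : IsLeviCivita D) (φ : SDiff μ)
    (c : DualX M) (B : ExactField μ) :
    integral μ (contract (rep (φ⁻¹ • c)).val B.1) =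
      integral μ (contract (rep c).val (pushExact φ B).1) := by
  have h : φ⁻¹ • c = Submodule.Quotient.mk (pushOneForm φ⁻¹ (rep c)) := by
    conv_lhs => rw [← mk_rep c]
    rfl
  rw [h, hμ.integral_rep_mk hD _ B.2]
  have h1 := hμ.integral_contract_push φ⁻¹ (rep c).val_mem (pushExact φ B).2.1
  have h2 : pushField (φ⁻¹).1 (pushExact φ B).1 = B.1 := by
    have := pushField_inv φ⁻¹ B.1
    rwa [inv_inv] at this
  rw [h2] at h1
  exact h1

/-- By Cartan, `(L_w α)(B) = dα(w, B) + B(α(w))`. The second term integrates to zero as `B` is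
exact, and the first is `μ(z, w, B) = μ(B, z, w) = ⟨B × z, w⟩`. -/
lemma IsVolumeForm.integral_lieDual (hμ : IsVolumeForm μ) (hD : IsLeviCivita D) {w B z : VField M}
    (hw : SmoothField w) (hB : B ∈ ExactField μ) (a : DualX M)
    (hz : ContractsTo μ z (rep a).val) :
    integral μ (contract (rep (lieDual w a)).val B) =
      integral μ (contract (flat (cross μ B z)) w) := by
  have hα := (rep a).val_mem
  rw [lieDual, hμ.integral_rep_mk hD _ hB]
  have h1 : contract (lieForm w (rep a)).val B =
      fun x => dForm (rep a).val w B x + dirDeriv B (contract (rep a).val w) x := by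
    funext x
    rw [hD.exists_lieDeriv hw (rep a) B hB.1 x, dForm]
    ring
  rw [h1, hμ.integral_add (SmoothForms.dForm_smooth hα hw hB.1).continuous
    (hB.1.dirDeriv_smooth (hα w hw)).continuous, hμ.integral_dirDeriv_exact hD hB (hα w hw),
    add_zero]
  congr 1
  funext x
  rw [← hz w B hw hB.1]
  exact (alternating_rotate (μ x) (B x) (z x) (w x)).trans (inner_cross B z x (w x)).symm

/-- The coadjoint action exists and preserves the two helicities. -/
lemma IsVolumeForm.exists_coadjoint (hμ : IsVolumeForm μ) (hD : IsLeviCivita D)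
    (Φ : MHDGroup μ) (m : MHDDual μ) :
    ∃ m' : MHDDual μ, IsCoadjoint Φ m m' ∧ helicity μ m'.2.1 m'.2.1 = helicity μ m.2.1 m.2.1 ∧
      helicity μ m'.1.1 m'.2.1 = helicity μ m.1.1 m.2.1 := by
  obtain ⟨η, B⟩ := m
  obtain ⟨hus, hu⟩ := curlInv_spec η.2
  set u := curlInv μ η.1 with hudef
  set φ := Φ.right
  set a : DualX M := Multiplicative.toAdd Φ⁻¹.left
  obtain ⟨z, hz, hza⟩ := hD.exists_contractsTo hμ (rep a).val_mem
  -- The first summand represents `ω`; the second is the dual of `w ↦ L_w a` evaluated on `B`.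
  -- Pushing `κ` forward by `φ` gives a primitive of the new `ω'`.
  set κ : CovField M := flat u + flat (cross μ B.1 z)
  have hκ : κ ∈ SmoothForms M := add_mem hus.flat_mem (hμ.flat_cross_mem B.2.1 hz)
  have hθ : pushForm φ.1 κ ∈ SmoothForms M := (SDiff.isDiffeo φ).pushForm_smooth hκ
  obtain ⟨ω', hω', hωθ⟩ := hD.exists_contractsTo hμ hθ
  have hω'e : ω' ∈ ExactField μ := ⟨hω', _, hθ, hωθ⟩
  -- The extra summand of `κ` is orthogonal to `B`, hence invisible to the cross-helicity.
  have hBB : contract (flat (cross μ B.1 z)) B.1 = fun _ => 0 := by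
    funext x
    refine (inner_cross B.1 z x (B.1 x)).trans ?_
    exact (μ x).map_eq_zero_of_eq ![B.1 x, z x, B.1 x] (i := 0) (j := 2) rfl (by decide)
  refine ⟨(⟨ω', hω'e⟩, pushExact φ B), fun ξ => ?_, ?_, ?_⟩
  · have e1 : pairing (⟨ω', hω'e⟩, pushExact φ B) ξ =
        integral μ (contract (pushForm φ.1 κ) ξ.1.1) +
          integral μ (contract (rep ξ.2).val (pushExact φ B).1) := by
      have h1 := hμ.helicity_eq hD hω'e ξ.1.2 hθ hωθ
      unfold pairing
      rw [← h1]
      congr 2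
      funext x
      exact real_inner_comm _ _
    set w' : ExactField μ := pushExact φ⁻¹ ξ.1 with hw'
    have e2 : integral μ (contract (pushForm φ.1 κ) ξ.1.1) =
        integral μ (contract (flat u) w'.1) +
          integral μ (contract (flat (cross μ B.1 z)) w'.1) := by
      rw [← pushField_inv φ ξ.1.1, ← pushExact_val, hμ.integral_contract_push φ hκ w'.2.1]
      exact hμ.integral_add (hus.flat_mem _ w'.2.1).continuous
        (hμ.flat_cross_mem B.2.1 hz _ w'.2.1).continuous
    have e3 : pairing (η, B) (Ad Φ⁻¹ ξ) = integral μ (contract (flat u) w'.1) +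
        integral μ (contract (rep (φ⁻¹ • ξ.2 + lieDual w'.1 a)).val B.1) := rfl
    rw [e1, e2, e3, hμ.integral_rep_add hD _ _ B.2, hμ.integral_rep_smul hD,
      hμ.integral_lieDual hD w'.2.1 B.2 a hza]
    ring
  · obtain ⟨hBs, β, hβ, hBβ⟩ := B.2
    rw [hμ.helicity_eq hD B.2 B.2 hβ hBβ, hμ.helicity_eq hD (pushExact φ B).2 (pushExact φ B).2
      ((SDiff.isDiffeo φ).pushForm_smooth hβ) (SDiff.contractsTo_push φ hβ hBβ)]
    exact hμ.integral_contract_push φ hβ hBs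
  · rw [hμ.helicity_eq hD hω'e (pushExact φ B).2 hθ hωθ, hμ.helicity_eq hD η.2 B.2 hus.flat_mem hu]
    rw [pushExact_val, hμ.integral_contract_push φ hκ B.2.1]
    refine (hμ.integral_add (hus.flat_mem _ B.2.1).continuous
        (hμ.flat_cross_mem B.2.1 hz _ B.2.1).continuous).trans ?_
    rw [hBB, integral_zero_fun, add_zero]

/-- The hypothesis says `∫ |X - Y|² dμ = 0`. -/
lemma IsVolumeForm.eq_of_integral_inner (hμ : IsVolumeForm μ) {X Y : VField M}
    (hX : SmoothField X) (hY : SmoothField Y)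
    (h : integral μ (contract (flat (X - Y)) X) = integral μ (contract (flat (X - Y)) Y)) :
    X = Y := by
  have hs := hX.sub hY
  have h1 : integral μ (contract (flat (X - Y)) (X - Y)) = 0 := by
    have h2 := hμ.integral_sub (hs.flat_mem X hX).continuous (hs.flat_mem Y hY).continuous
    rw [h, sub_self] at h2
    rw [← h2]
    congr 1
    funext x
    exact map_sub _ _ _
  funext x
  have h3 := hμ.eq_zero_of_integral_eq_zero (hs.flat_mem _ hs).continuous
    (fun x => show 0 ≤ inner ℝ ((X - Y) x) ((X - Y) x) from real_inner_self_nonneg) h1 x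
  exact sub_eq_zero.1 (inner_self_eq_zero.1 h3)

/-- The pairing of `𝔤^*` with `𝔤` separates the points of `𝔤^*`. -/
lemma IsVolumeForm.pairing_injective (hμ : IsVolumeForm μ) (hD : IsLeviCivita D)
    {m m' : MHDDual μ} (h : ∀ ξ : MHDAlgebra μ, pairing m ξ = pairing m' ξ) : m = m' := by
  have hB : m.2 = m'.2 := by
    have hs := (m.2.2.1).sub (m'.2.2.1)
    let γ : OneForm M := ⟨_, hs.flat_mem⟩
    -- The test one-form is the dual of the difference of the two `B`-components.
    have hξ := h (0, Submodule.Quotient.mk γ)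
    have h0 : ∀ n : MHDDual μ, pairing n (0, Submodule.Quotient.mk γ) =
        integral μ (contract γ.val n.2.1) := fun n => by
      unfold pairing
      rw [hμ.integral_rep_mk hD _ n.2.2]
      have : (fun x => inner ℝ (curlInv μ n.1.1 x)
          (((0, Submodule.Quotient.mk γ) : MHDAlgebra μ).1.1 x)) = fun _ => (0 : ℝ) :=
        funext fun x => inner_zero_right _
      rw [this, integral_zero_fun, zero_add]
    rw [h0, h0] at hξ
    exact Subtype.ext (hμ.eq_of_integral_inner m.2.2.1 m'.2.2.1 hξ)
  have hη : m.1 = m'.1 := by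
    have hs := (m.1.2.1).sub (m'.1.2.1)
    -- The test field is the curl of the difference `δ` of the `ω`-components: symmetry of the curl
    -- gives `∫ curl⁻¹ ω · curl δ = ∫ ω · δ`.
    obtain ⟨w, hw, hwd⟩ := hD.exists_contractsTo hμ hs.flat_mem
    have hξ := h (⟨w, hw, _, hs.flat_mem, hwd⟩, 0)
    have h0 : ∀ n : MHDDual μ, pairing n (⟨w, hw, _, hs.flat_mem, hwd⟩, 0) =
        integral μ (contract (flat (m.1.1 - m'.1.1)) n.1.1) +
          integral μ (contract (rep 0).val n.2.1) := fun n => by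
      obtain ⟨hvs, hv⟩ := curlInv_spec n.1.2
      rw [← hμ.integral_wedge hD hvs.flat_mem hs.flat_mem hw hv hwd]
      rfl
    rw [h0, h0, hB] at hξ
    exact Subtype.ext (hμ.eq_of_integral_inner m.1.2.1 m'.1.2.1 (add_right_cancel hξ))
  exact Prod.ext hη hB

end Coadjoint

/-! ### Integrals depending on time. -/

section Parametric

variable {M : Type*} [TopologicalSpace M] [ChartedSpace E3 M] [IsManifold (𝓡 3) ∞ M]
  [CompactSpace M] [T2Space M]
  [Bundle.RiemannianBundle (fun x : M => TangentSpace (𝓡 3) x)]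
  [IsContMDiffRiemannianBundle (𝓡 3) ∞ E3 (fun x : M => TangentSpace (𝓡 3) x)]
  {μ : TopForm M}

lemma IsVolumeForm.continuousOn_integral (hμ : IsVolumeForm μ) {X : Type*} [TopologicalSpace X]
    [FirstCountableTopology X] {S : Set X} {q : X → M → ℝ}
    (hq : ContinuousOn (fun p : X × M => q p.1 p.2) (S ×ˢ univ)) :
    ContinuousOn (fun t => integral μ (q t)) S := by
  let : MeasurableSpace M := borel M
  have : BorelSpace M := ⟨rfl⟩
  obtain ⟨ν, hν, h⟩ := hμ.exists_measure
  have hc : ∀ t ∈ S, Continuous (q t) := fun t ht =>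
    hq.comp_continuous (Continuous.prodMk_right t) fun x => ⟨ht, mem_univ x⟩
  refine (continuousOn_integral_of_compact_support (μ := ν) isCompact_univ hq
    fun p x _ hx => absurd (mem_univ x) hx).congr fun t ht => h _ (hc t ht)

lemma IsVolumeForm.abs_integral_le (hμ : IsVolumeForm μ) {f g : M → ℝ} (hf : Continuous f)
    (hg : Continuous g) (h : ∀ x, |f x| ≤ g x) : |integral μ f| ≤ integral μ g := by
  let : MeasurableSpace M := borel M
  have : BorelSpace M := ⟨rfl⟩
  obtain ⟨ν, hν, hi⟩ := hμ.exists_measure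
  rw [hi f hf, hi g hg]
  exact norm_integral_le_of_norm_le
    (hg.integrable_of_hasCompactSupport (HasCompactSupport.of_compactSpace g))
    (ae_of_all _ fun x => (Real.norm_eq_abs _).trans_le (h x))

/-- The time derivative of a smooth time-dependent function is continuous. -/
lemma continuousOn_deriv {I : Set ℝ} (hI : IsOpen I) {q : ℝ → M → ℝ}
    (hq : ContMDiffOn (𝓘(ℝ, ℝ).prod (𝓡 3)) 𝓘(ℝ, ℝ) ∞ (fun p : ℝ × M => q p.1 p.2) (I ×ˢ univ)) :
    ContinuousOn (fun p : ℝ × M => deriv (fun r => q r p.2) p.1) (I ×ˢ univ) := by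
  rintro ⟨t, x⟩ ⟨ht, -⟩
  refine ContinuousAt.continuousWithinAt ?_
  -- The time variable is doubled, so that the time derivative is the derivative in `r` of a smooth
  -- family with parameter `(t, x)`, evaluated at `r = t`.
  have h1 : ContMDiffAt ((𝓘(ℝ, ℝ).prod (𝓡 3)).prod 𝓘(ℝ, ℝ)) 𝓘(ℝ, ℝ) ∞
      (Function.uncurry fun (p : ℝ × M) (r : ℝ) => q r p.2) ((t, x), t) := by
    have h2 := hq.contMDiffAt ((hI.prod isOpen_univ).mem_nhds
      (show (t, x) ∈ I ×ˢ univ from ⟨ht, mem_univ x⟩))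
    exact ContMDiffAt.comp ((t, x), t) (f := fun p : (ℝ × M) × ℝ => (p.2, p.1.2)) h2
      (contMDiffAt_snd.prodMk (contMDiffAt_snd.comp _ contMDiffAt_fst))
  have h2 := ContMDiffAt.mfderiv (m := 0) _ Prod.fst h1 contMDiffAt_fst (by simp)
  simp only [mfderiv_eq_fderiv] at h2
  have h3 := inTangentCoordinates_model_space (I := 𝓘(ℝ, ℝ)) (I' := 𝓘(ℝ, ℝ)) Prod.fst
    (fun p : ℝ × M => q p.1 p.2) (fun p => (fderiv ℝ (fun r => q r p.2) p.1 : ℝ →L[ℝ] ℝ)) (t, x)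
  have h4 : ContinuousAt (fun p : ℝ × M => (fderiv ℝ (fun r => q r p.2) p.1 : ℝ →L[ℝ] ℝ))
      (t, x) := by
    rw [← h3]
    exact h2.continuousAt
  exact h4.clm_apply (continuousAt_const (y := (1 : ℝ)))

lemma IsVolumeForm.hasDerivAt_integral (hμ : IsVolumeForm μ) {I : Set ℝ} (hI : IsOpen I)
    {q : ℝ → M → ℝ}
    (hq : ContMDiffOn (𝓘(ℝ, ℝ).prod (𝓡 3)) 𝓘(ℝ, ℝ) ∞ (fun p : ℝ × M => q p.1 p.2) (I ×ˢ univ))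
    {t : ℝ} (ht : t ∈ I) :
    HasDerivAt (fun s => integral μ (q s)) (integral μ fun x => deriv (fun r => q r x) t) t := by
  let : MeasurableSpace M := borel M
  have : BorelSpace M := ⟨rfl⟩
  obtain ⟨ν, hν, h⟩ := hμ.exists_measure
  have hd := continuousOn_deriv hI hq
  have hc : ∀ s ∈ I, Continuous (q s) := fun s hs =>
    hq.continuousOn.comp_continuous (Continuous.prodMk_right s) fun x => ⟨hs, mem_univ x⟩
  have hdc : ∀ s ∈ I, Continuous fun x => deriv (fun r => q r x) s := fun s hs =>
    hd.comp_continuous (Continuous.prodMk_right s) fun x => ⟨hs, mem_univ x⟩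
  have hint : ∀ s ∈ I, Integrable (q s) ν := fun s hs =>
    (hc s hs).integrable_of_hasCompactSupport (HasCompactSupport.of_compactSpace _)
  obtain ⟨δ, hδ, hball⟩ := Metric.nhds_basis_closedBall.mem_iff.1 (hI.mem_nhds ht)
  obtain ⟨K, hK⟩ := IsCompact.exists_bound_of_continuousOn
    ((isCompact_closedBall t δ).prod (isCompact_univ (X := M))) (hd.mono (prod_mono hball subset_rfl))
  have key := hasDerivAt_integral_of_dominated_loc_of_deriv_le (μ := ν) (F := q) (x₀ := t)
    (F' := fun s x => deriv (fun r => q r x) s) (bound := fun _ => K)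
    (Metric.closedBall_mem_nhds t hδ)
    (eventually_of_mem (hI.mem_nhds ht) fun s hs => (hint s hs).1) (hint t ht)
    (hdc t ht).aestronglyMeasurable
    (ae_of_all _ fun x s hs => hK (s, x) ⟨hs, mem_univ x⟩) (integrable_const K)
    (ae_of_all _ fun x s hs => by
      have h1 := hq.contMDiffAt ((hI.prod isOpen_univ).mem_nhds
        (show (s, x) ∈ I ×ˢ univ from ⟨hball hs, mem_univ x⟩))
      have h2 : ContMDiffAt 𝓘(ℝ, ℝ) 𝓘(ℝ, ℝ) ∞ (fun r => q r x) s :=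
        ContMDiffAt.comp s (f := fun r => (r, x)) h1 (contMDiffAt_id.prodMk contMDiffAt_const)
      exact (h2.contDiffAt.differentiableAt (by simp)).hasDerivAt)
  rw [h _ (hdc t ht)]
  refine key.2.congr_of_eventuallyEq ?_
  filter_upwards [hI.mem_nhds ht] with s hs
  exact h _ (hc s hs)

/-- The mean value theorem for the integral of a smooth time-dependent function. -/
lemma IsVolumeForm.exists_integral_slope (hμ : IsVolumeForm μ) {J : Set ℝ} (hJ : J.OrdConnected)
    {q : ℝ → M → ℝ}
    (hq : ContMDiffOn (𝓘(ℝ, ℝ).prod (𝓡 3)) 𝓘(ℝ, ℝ) ∞ (fun p : ℝ × M => q p.1 p.2) (J ×ˢ univ))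
    {g : ℝ → M → ℝ}
    (hg : ∀ t ∈ J, ∀ x, HasDerivWithinAt (fun r => q r x) (g t x) J t)
    {s t : ℝ} (hs : s ∈ J) (ht : t ∈ J) (hst : s < t) :
    ∃ τ ∈ Ioo s t, integral μ (q t) - integral μ (q s) = (t - s) * integral μ (g τ) := by
  have hsub : Icc s t ⊆ J := hJ.out hs ht
  have hd : ∀ τ ∈ Ioo s t, HasDerivAt (fun r => integral μ (q r)) (integral μ (g τ)) τ := by
    intro τ hτ
    have h1 := hμ.hasDerivAt_integral isOpen_Ioo
      (hq.mono (prod_mono (Ioo_subset_Icc_self.trans hsub) subset_rfl)) hτ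
    -- At interior times the derivative within `J` is a genuine derivative; at the endpoints only
    -- continuity is used.
    have h2 : (fun x => deriv (fun r => q r x) τ) = g τ := by
      funext x
      exact ((hg τ (hsub (Ioo_subset_Icc_self hτ)) x).hasDerivAt
        (mem_of_superset (Icc_mem_nhds hτ.1 hτ.2) hsub)).deriv
    rwa [h2] at h1
  obtain ⟨τ, hτ, h⟩ := exists_hasDerivAt_eq_slope (fun r => integral μ (q r))
    (fun τ => integral μ (g τ)) hst
    ((hμ.continuousOn_integral hq.continuousOn).mono hsub) hd
  refine ⟨τ, hτ, ?_⟩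
  have : t - s ≠ 0 := (sub_pos.2 hst).ne'
  field_simp at h
  linarith

section Flow

variable {J : Set ℝ} {v w : ℝ → VField M}

lemma SmoothFlow.smoothField (hv : SmoothFlow J v) {t : ℝ} (ht : t ∈ J) : SmoothField (v t) := by
  have h : ContMDiff (𝓡 3) (𝓘(ℝ, ℝ).prod (𝓡 3)) ∞ (fun x : M => (t, x)) :=
    contMDiff_const.prodMk contMDiff_id
  exact contMDiffOn_univ.1 (ContMDiffOn.comp (f := fun x : M => (t, x)) hv h.contMDiffOn
    fun x _ => ⟨ht, mem_univ x⟩)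

lemma SmoothField.smoothFlow {X : VField M} (hX : SmoothField X) (J : Set ℝ) :
    SmoothFlow J fun _ => X :=
  (ContMDiff.comp hX contMDiff_snd).contMDiffOn

lemma SmoothFlow.contMDiffOn_inner (hv : SmoothFlow J v) (hw : SmoothFlow J w) :
    ContMDiffOn (𝓘(ℝ, ℝ).prod (𝓡 3)) 𝓘(ℝ, ℝ) ∞
      (fun p : ℝ × M => inner ℝ (v p.1 p.2) (w p.1 p.2)) (J ×ˢ univ) :=
  ContMDiffOn.inner_bundle (b := Prod.snd) hv hw

/-- The two times vary independently. The norm is the square root of `|v|² - 2⟨v, w⟩ + |w|²`, whose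
terms are smooth by smoothness of the metric. -/
lemma SmoothFlow.continuousOn_norm_sub (hv : SmoothFlow J v) (hw : SmoothFlow J w) :
    ContinuousOn (fun p : (ℝ × ℝ) × M => ‖v p.1.1 p.2 - w p.1.2 p.2‖) ((J ×ˢ J) ×ˢ univ) := by
  have h1 := ContMDiffOn.comp (I := (𝓘(ℝ, ℝ).prod 𝓘(ℝ, ℝ)).prod (𝓡 3))
    (f := fun p : (ℝ × ℝ) × M => (p.1.1, p.2)) (s := (J ×ˢ J) ×ˢ univ) hv
    ((contMDiff_fst.comp contMDiff_fst).prodMk contMDiff_snd).contMDiffOn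
    fun p hp => ⟨hp.1.1, mem_univ _⟩
  have h2 := ContMDiffOn.comp (I := (𝓘(ℝ, ℝ).prod 𝓘(ℝ, ℝ)).prod (𝓡 3))
    (f := fun p : (ℝ × ℝ) × M => (p.1.2, p.2)) (s := (J ×ˢ J) ×ˢ univ) hw
    ((contMDiff_snd.comp contMDiff_fst).prodMk contMDiff_snd).contMDiffOn
    fun p hp => ⟨hp.1.2, mem_univ _⟩
  have h11 := (ContMDiffOn.inner_bundle (b := Prod.snd) h1 h1).continuousOn
  have h12 := (ContMDiffOn.inner_bundle (b := Prod.snd) h1 h2).continuousOn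
  have h22 := (ContMDiffOn.inner_bundle (b := Prod.snd) h2 h2).continuousOn
  refine ((h11.sub (h12.const_mul 2)).add h22).sqrt.congr fun p _ => ?_
  refine (Real.sqrt_sq (norm_nonneg _)).symm.trans (congrArg Real.sqrt ?_)
  rw [norm_sub_sq_real, ← real_inner_self_eq_norm_sq, ← real_inner_self_eq_norm_sq]
  rfl

lemma SmoothFlow.continuousOn_norm (hw : SmoothFlow J w) :
    ContinuousOn (fun p : (ℝ × ℝ) × M => ‖w p.1.2 p.2‖) ((J ×ˢ J) ×ˢ univ) := by
  have h := (smoothField_zero.smoothFlow J).continuousOn_norm_sub hw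
  simpa only [Pi.zero_apply, zero_sub, norm_neg] using h

end Flow

end Parametric

/-! ### Conservation of the two helicities. -/

section Conservation

variable {M : Type*} [TopologicalSpace M] [ChartedSpace E3 M] [IsManifold (𝓡 3) ∞ M]
  [CompactSpace M] [T2Space M]
  [Bundle.RiemannianBundle (fun x : M => TangentSpace (𝓡 3) x)]
  [IsContMDiffRiemannianBundle (𝓡 3) ∞ E3 (fun x : M => TangentSpace (𝓡 3) x)]
  {μ : TopForm M} {D : CovariantDerivative (𝓡 3) E3 (fun x : M => TangentSpace (𝓡 3) x)}

/-- The right-hand sides of the MHD equations preserve the integral of `v · B` infinitesimally. -/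
lemma IsVolumeForm.integral_crossHelicity_rate (hμ : IsVolumeForm μ) (hD : IsLeviCivita D)
    {v B : VField M} (hv : SmoothField v) (hB : SmoothField B) (hdv : DivFree μ v)
    (hdB : DivFree μ B) {p : M → ℝ} (hp : SmoothFun p) (C : VField M) :
    integral μ (fun x => inner ℝ (v x) (-(bracket v B x)) +
      inner ℝ (-(D v x (v x)) + cross μ C B x - grad p x) (B x)) = 0 := by
  have hvB : SmoothFun (fun y => inner ℝ (v y) (B y)) := hv.inner_smooth hB
  have hvv : SmoothFun (fun y => 2⁻¹ * inner ℝ (v y) (v y)) :=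
    contMDiff_const.mul (hv.inner_smooth hv)
  have hF : SmoothFun (fun y => 2⁻¹ * inner ℝ (v y) (v y) - p y) := hvv.sub hp
  -- The metric and torsion identities for `D` turn the integrand into two derivatives along
  -- divergence-free fields. The Lorentz force contributes `(C × B) · B = 0` for any `C`.
  have hpt : (fun x => inner ℝ (v x) (-(bracket v B x)) +
      inner ℝ (-(D v x (v x)) + cross μ C B x - grad p x) (B x)) =
      fun x => dirDeriv B (fun y => 2⁻¹ * inner ℝ (v y) (v y) - p y) x -
        dirDeriv v (fun y => inner ℝ (v y) (B y)) x := by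
    funext x
    have h1 : dirDeriv v (fun y => inner ℝ (v y) (B y)) x = inner ℝ (D v x (v x)) (B x) +
        inner ℝ (v x) (D B x (v x)) := hD.2.mvfderiv_inner_eq v (hv.mdiff x) (hB.mdiff x)
    have h2 : dirDeriv B (fun y => inner ℝ (v y) (v y)) x = inner ℝ (D v x (B x)) (v x) +
        inner ℝ (v x) (D v x (B x)) := hD.2.mvfderiv_inner_eq B (hv.mdiff x) (hv.mdiff x)
    have h3 : D B x (v x) - D v x (B x) = bracket v B x :=
      D.torsion_eq_zero_iff.1 hD.1 (hv.mdiff x) (hB.mdiff x)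
    have h4 : inner ℝ (cross μ C B x) (B x) = 0 := by
      rw [inner_cross]
      exact (μ x).map_eq_zero_of_eq ![C x, B x, B x] (i := 1) (j := 2) rfl (by decide)
    have h5 : inner ℝ (grad p x) (B x) = dirDeriv B p x := inner_sharp _ _
    have h6 : inner ℝ (v x) (bracket v B x) =
        inner ℝ (v x) (D B x (v x)) - inner ℝ (v x) (D v x (B x)) := by
      rw [← inner_sub_right, h3]
    rw [dirDeriv_sub hvv hp, dirDeriv_mul (f := fun _ => (2⁻¹ : ℝ)) contMDiff_const
      (hv.inner_smooth hv), dirDeriv_const, h1, h2, inner_neg_right, h6, inner_sub_left,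
      inner_add_left, inner_neg_left, h4, h5, real_inner_comm (v x) (D v x (B x))]
    ring
  rw [hpt, hμ.integral_sub (hB.dirDeriv_smooth hF).continuous (hv.dirDeriv_smooth hvB).continuous,
    hμ.integral_dirDeriv_eq_zero hD hB hdB hF, hμ.integral_dirDeriv_eq_zero hD hv hdv hvB, sub_zero]

/-- The pairing of `-[v, B]` with a one-form. -/
lemma IsVolumeForm.integral_inner_bracket (hμ : IsVolumeForm μ) (hD : IsLeviCivita D)
    {v B A : VField M} (hv : SmoothField v) (hB : SmoothField B) (hdv : DivFree μ v)
    (hdB : DivFree μ B) (hA : SmoothField A) :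
    integral μ (fun x => inner ℝ (A x) (-(bracket v B x))) =
      integral μ (dForm (flat A) v B) := by
  have h1 : (fun x => inner ℝ (A x) (-(bracket v B x))) = fun x =>
      (dForm (flat A) v B x - dirDeriv v (contract (flat A) B) x) +
        dirDeriv B (contract (flat A) v) x := by
    funext x
    rw [inner_neg_right, dForm]
    change - contract (flat A) (bracket v B) x = _
    ring
  have hs := hA.flat_mem
  have c1 := (SmoothForms.dForm_smooth hs hv hB).continuous
  have c2 := (hv.dirDeriv_smooth (hs B hB)).continuous
  have c3 := (hB.dirDeriv_smooth (hs v hv)).continuous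
  rw [h1, hμ.integral_add (f := fun x => dForm (flat A) v B x -
    dirDeriv v (contract (flat A) B) x) (c1.sub c2) c3, hμ.integral_sub c1 c2,
    hμ.integral_dirDeriv_eq_zero hD hv hdv (hs B hB),
    hμ.integral_dirDeriv_eq_zero hD hB hdB (hs v hv)]
  ring

/-- A bound for the difference quotient of the magnetic helicity. -/
def helicityBound (μ : TopForm M) (v B : ℝ → VField M) (t s τ : ℝ) : ℝ :=
  integral μ fun x => (‖B t x - B τ x‖ + ‖B s x - B τ x‖) * ‖v τ x‖ * ‖B τ x‖

variable {J : Set ℝ} {v B : ℝ → VField M}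

lemma continuousOn_helicityBound_integrand (hv : SmoothFlow J v) (hB : SmoothFlow J B) {t : ℝ}
    (ht : t ∈ J) : ContinuousOn (fun p : (ℝ × ℝ) × M =>
      (‖B t p.2 - B p.1.2 p.2‖ + ‖B p.1.1 p.2 - B p.1.2 p.2‖) * ‖v p.1.2 p.2‖ * ‖B p.1.2 p.2‖)
      ((J ×ˢ J) ×ˢ univ) :=
  (((((hB.smoothField ht).smoothFlow J).continuousOn_norm_sub hB).add
    (hB.continuousOn_norm_sub hB)).mul hv.continuousOn_norm).mul hB.continuousOn_norm

/-- The potentials at the two end times are frozen, so only `B` is differentiated in time and no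
regularity of `curl⁻¹ B` in time is used. -/
lemma IsVolumeForm.abs_helicity_sub_le (hμ : IsVolumeForm μ) (hD : IsLeviCivita D)
    {p : ℝ → M → ℝ} (hJ : J.OrdConnected) (h : IsMHDSolution μ D J v B p)
    (hBe : ∀ t ∈ J, B t ∈ ExactField μ) {s t : ℝ} (hs : s ∈ J) (ht : t ∈ J) (hst : s < t) :
    ∃ τ ∈ Ioo s t, |helicity μ (B t) (B t) - helicity μ (B s) (B s)| ≤
      (t - s) * helicityBound μ v B t s τ := by
  obtain ⟨hAt, hCt⟩ := curlInv_spec (hBe t ht)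
  obtain ⟨hAs, hCs⟩ := curlInv_spec (hBe s hs)
  set At := curlInv μ (B t)
  set As := curlInv μ (B s)
  have hA := hAt.add hAs
  have hC : ContractsTo μ (B t + B s) (flat (At + As)) := by
    have h1 : flat (At + As) = flat At + flat As := funext fun x => map_add _ _ _
    rw [h1]
    exact contractsTo_add hAt.flat_mem hAs.flat_mem hCt hCs
  have hq := (hA.smoothFlow J).contMDiffOn_inner h.smooth_B
  obtain ⟨τ, hτ, heq⟩ := hμ.exists_integral_slope hJ hq
    (g := fun τ x => inner ℝ ((At + As) x) (-(bracket (v τ) (B τ) x)))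
    (fun τ hτ x => by
      have h1 := (hasDerivWithinAt_const τ J ((At + As) x)).inner ℝ (h.induction τ hτ x)
      rwa [inner_zero_left, add_zero] at h1) hs ht hst
  refine ⟨τ, hτ, ?_⟩
  have hτJ : τ ∈ J := hJ.out hs ht (Ioo_subset_Icc_self hτ)
  have hvτ := h.smooth_v.smoothField hτJ
  have hBτ := h.smooth_B.smoothField hτJ
  have hBt := (hBe t ht).1
  have hBs := (hBe s hs).1
  -- A difference of squares for the symmetric form `H`; the mixed terms cancel by Stokes.
  have hdiff : helicity μ (B t) (B t) - helicity μ (B s) (B s) =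
      integral μ (fun x => inner ℝ ((At + As) x) (B t x)) -
        integral μ (fun x => inner ℝ ((At + As) x) (B s x)) := by
    have hadd : ∀ X, SmoothField X → integral μ (fun x => inner ℝ ((At + As) x) (X x)) =
        integral μ (contract (flat At) X) + integral μ (contract (flat As) X) := by
      intro X hX
      rw [← hμ.integral_add (hAt.flat_mem X hX).continuous (hAs.flat_mem X hX).continuous]
      congr 1
      funext x
      exact inner_add_left _ _ _
    rw [hadd _ hBt, hadd _ hBs, hμ.helicity_eq hD (hBe t ht) (hBe t ht) hAt.flat_mem hCt,
      hμ.helicity_eq hD (hBe s hs) (hBe s hs) hAs.flat_mem hCs,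
      hμ.integral_wedge hD hAt.flat_mem hAs.flat_mem hBs hCt hCs]
    ring
  rw [hdiff, heq, abs_mul, abs_of_pos (sub_pos.2 hst),
    hμ.integral_inner_bracket hD hvτ hBτ (h.div_v τ hτJ) (h.div_B τ hτJ) hA]
  refine mul_le_mul_of_nonneg_left ?_ (sub_pos.2 hst).le
  refine hμ.abs_integral_le (SmoothForms.dForm_smooth hA.flat_mem hvτ hBτ).continuous
    ((continuousOn_helicityBound_integrand h.smooth_v h.smooth_B ht).comp_continuous
      (Continuous.prodMk_right (s, τ)) fun x => ⟨⟨hs, hτJ⟩, mem_univ x⟩) fun x => ?_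
  rw [← hC _ _ hvτ hBτ]
  -- The multiple of `B τ` is removed because `μ(B τ, v τ, B τ) = 0`; what remains is small when
  -- `s`, `t` and `τ` are close.
  have hsplit : (B t + B s) x = ((B t x - B τ x) + (B s x - B τ x)) + (2 : ℝ) • B τ x := by
    rw [Pi.add_apply]
    module
  have h0 : μ x ![B τ x, v τ x, B τ x] = 0 :=
    (μ x).map_eq_zero_of_eq ![B τ x, v τ x, B τ x] (i := 0) (j := 2) rfl (by decide)
  rw [hsplit, AlternatingMap.map_vecCons_add, AlternatingMap.map_vecCons_smul, h0, smul_zero,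
    add_zero]
  refine (hμ.abs_le x _ _ _).trans ?_
  gcongr
  exact norm_add_le _ _

/-- `helicityBound` is continuous in `(s, τ)` and vanishes at `s = τ = t`, so the increment of the
helicity is `o(|s - t|)`. -/
lemma IsVolumeForm.hasDerivWithinAt_helicity (hμ : IsVolumeForm μ) (hD : IsLeviCivita D)
    {p : ℝ → M → ℝ} (hJ : J.OrdConnected) (h : IsMHDSolution μ D J v B p)
    (hBe : ∀ t ∈ J, B t ∈ ExactField μ) {t : ℝ} (ht : t ∈ J) :
    HasDerivWithinAt (fun s => helicity μ (B s) (B s)) 0 J t := by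
  have hcont := hμ.continuousOn_integral (q := fun (r : ℝ × ℝ) x =>
    (‖B t x - B r.2 x‖ + ‖B r.1 x - B r.2 x‖) * ‖v r.2 x‖ * ‖B r.2 x‖)
    (continuousOn_helicityBound_integrand h.smooth_v h.smooth_B ht)
  have h0 : helicityBound μ v B t t t = 0 := by
    simp only [helicityBound, sub_self, norm_zero, add_zero, zero_mul]
    exact integral_zero_fun μ
  rw [hasDerivWithinAt_iff_isLittleO, Asymptotics.isLittleO_iff]
  intro ε hε
  obtain ⟨δ, hδ, hball⟩ := Metric.continuousWithinAt_iff.1 (hcont (t, t) ⟨ht, ht⟩) ε hε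
  have hbound : ∀ s ∈ J, ∀ τ ∈ J, |s - t| < δ → |τ - t| < δ →
      helicityBound μ v B t s τ ≤ ε := by
    intro s hs τ hτ h1 h2
    have h3 := hball (x := (s, τ)) ⟨hs, hτ⟩ (max_lt h1 h2)
    have h4 : dist (helicityBound μ v B t s τ) (helicityBound μ v B t t t) < ε := h3
    rw [h0, Real.dist_eq, sub_zero] at h4
    exact (le_abs_self _).trans h4.le
  filter_upwards [self_mem_nhdsWithin, mem_nhdsWithin_of_mem_nhds (Metric.ball_mem_nhds t hδ)]
    with s hs hsδ
  rw [smul_zero, sub_zero, Real.norm_eq_abs, Real.norm_eq_abs]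
  have hsδ' : |s - t| < δ := hsδ
  rcases lt_trichotomy s t with hst | rfl | hst
  · obtain ⟨τ, hτ, hle⟩ := hμ.abs_helicity_sub_le hD hJ h hBe hs ht hst
    have hτδ : |τ - t| < δ := by
      rw [abs_of_neg (sub_neg.2 hst)] at hsδ'
      rw [abs_of_neg (sub_neg.2 hτ.2)]
      linarith [hτ.1]
    rw [abs_sub_comm, abs_of_neg (sub_neg.2 hst)]
    refine hle.trans ?_
    have h1 := hbound s hs τ (hJ.out hs ht (Ioo_subset_Icc_self hτ)) hsδ' hτδ
    nlinarith
  · simp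
  · obtain ⟨τ, hτ, hle⟩ := hμ.abs_helicity_sub_le hD hJ h hBe ht hs hst
    have hτδ : |τ - t| < δ := by
      rw [abs_of_pos (sub_pos.2 hst)] at hsδ'
      rw [abs_of_pos (sub_pos.2 hτ.1)]
      linarith [hτ.2]
    rw [abs_of_pos (sub_pos.2 hst)]
    refine hle.trans ?_
    have h1 := hbound s hs τ (hJ.out ht hs (Ioo_subset_Icc_self hτ)) hsδ' hτδ
    -- For `t < s` the estimate comes with the end times exchanged, and the bound is symmetric in
    -- them.
    have h2 : helicityBound μ v B s t τ = helicityBound μ v B t s τ := by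
      unfold helicityBound
      congr 1
      funext x
      rw [add_comm]
    rw [h2]
    nlinarith

/-- The magnetic helicity is conserved. -/
lemma IsVolumeForm.magneticHelicity_eq (hμ : IsVolumeForm μ) (hD : IsLeviCivita D)
    {p : ℝ → M → ℝ} (hJ : J.OrdConnected) (h : IsMHDSolution μ D J v B p)
    (hBe : ∀ t ∈ J, B t ∈ ExactField μ) {s t : ℝ} (hs : s ∈ J) (ht : t ∈ J) :
    helicity μ (B t) (B t) = helicity μ (B s) (B s) := by
  have h1 := hJ.convex.norm_image_sub_le_of_norm_hasDerivWithin_le (C := 0)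
    (fun r hr => hμ.hasDerivWithinAt_helicity hD hJ h hBe hr) (fun _ _ => norm_zero.le) hs ht
  rw [zero_mul] at h1
  exact sub_eq_zero.1 (norm_le_zero_iff.1 h1)

/-- The cross-helicity is conserved. -/
lemma IsVolumeForm.crossHelicity_eq (hμ : IsVolumeForm μ) (hD : IsLeviCivita D)
    {p : ℝ → M → ℝ} (hJ : J.OrdConnected) (h : IsMHDSolution μ D J v B p)
    (hBe : ∀ t ∈ J, B t ∈ ExactField μ) {s t : ℝ} (hs : s ∈ J) (ht : t ∈ J) :
    helicity μ (curl μ (v t)) (B t) = helicity μ (curl μ (v s)) (B s) := by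
  wlog hst : s < t generalizing s t
  · rcases (not_lt.1 hst).lt_or_eq with hlt | rfl
    · exact (this ht hs hlt).symm
    · rfl
  rw [hμ.helicity_curl hD (h.smooth_v.smoothField ht) (hBe t ht),
    hμ.helicity_curl hD (h.smooth_v.smoothField hs) (hBe s hs)]
  obtain ⟨τ, hτ, heq⟩ := hμ.exists_integral_slope hJ (h.smooth_v.contMDiffOn_inner h.smooth_B)
    (fun τ hτ x => (h.momentum τ hτ x).inner ℝ (h.induction τ hτ x)) hs ht hst
  have hτJ : τ ∈ J := hJ.out hs ht (Ioo_subset_Icc_self hτ)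
  have h0 := hμ.integral_crossHelicity_rate hD (h.smooth_v.smoothField hτJ)
    (h.smooth_B.smoothField hτJ) (h.div_v τ hτJ) (h.div_B τ hτJ) (h.smooth_p τ hτJ)
    (curl μ (B τ))
  rw [h0, mul_zero] at heq
  exact sub_eq_zero.1 heq

end Conservation

end

end MHD

theorem proposition1 {M : Type*} [TopologicalSpace M] [ChartedSpace MHD.E3 M]
    [IsManifold (𝓡 3) ∞ M] [CompactSpace M] [T2Space M]
    [Bundle.RiemannianBundle (fun x : M => TangentSpace (𝓡 3) x)]
    [IsContMDiffRiemannianBundle (𝓡 3) ∞ MHD.E3 (fun x : M => TangentSpace (𝓡 3) x)]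
    (μ : MHD.TopForm M) (hμ : MHD.IsVolumeForm μ)
    (D : CovariantDerivative (𝓡 3) MHD.E3 (fun x : M => TangentSpace (𝓡 3) x))
    (hD : MHD.IsLeviCivita D) :
    -- the two helicities are first integrals of the MHD equations
    (∀ (J : Set ℝ) (v B : ℝ → MHD.VField M) (p : ℝ → M → ℝ), J.OrdConnected →
      MHD.IsMHDSolution μ D J v B p → (∀ t ∈ J, B t ∈ MHD.ExactField μ) →
      ∀ s ∈ J, ∀ t ∈ J,
        MHD.helicity μ (B t) (B t) = MHD.helicity μ (B s) (B s) ∧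
        MHD.helicity μ (MHD.curl μ (v t)) (B t) = MHD.helicity μ (MHD.curl μ (v s)) (B s)) ∧
    -- they are invariants of the coadjoint action of the group on the dual of its Lie algebra
    (∀ (Φ : MHD.MHDGroup μ) (m : MHD.MHDDual μ),
      (∃! m' : MHD.MHDDual μ, MHD.IsCoadjoint Φ m m') ∧
      ∀ m' : MHD.MHDDual μ, MHD.IsCoadjoint Φ m m' →
        MHD.helicity μ m'.2.1 m'.2.1 = MHD.helicity μ m.2.1 m.2.1 ∧
        MHD.helicity μ m'.1.1 m'.2.1 = MHD.helicity μ m.1.1 m.2.1) := by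
  refine ⟨fun J v B p hJ h hBe s hs t ht => ⟨hμ.magneticHelicity_eq hD hJ h hBe hs ht,
    hμ.crossHelicity_eq hD hJ h hBe hs ht⟩, fun Φ m => ?_⟩
  obtain ⟨m₁, h₁, hmag, hcross⟩ := hμ.exists_coadjoint hD Φ m
  have huniq : ∀ m', MHD.IsCoadjoint Φ m m' → m' = m₁ := fun m' h' =>
    hμ.pairing_injective hD fun ξ => (h' ξ).trans (h₁ ξ).symm
  refine ⟨⟨m₁, h₁, huniq⟩, fun m' h' => ?_⟩
  rw [huniq m' h']
  exact ⟨hmag, hcross⟩
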